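/- **Setting.** There are $K$ players, a horizon $T$ and a sharing delay $n\ge 1$. The state and the observations are $$X_{t+1}=f_t(X_t,U_t^1,\dots,U_t^K,W_t)\quad(0\le t<T),\qquad Y_t^k=h_t^k(X_t,Z_t^k)\quad(0\le t\le T,\ 1\le k\le K),$$ where the spaces of states, observations and actions are standard Borel, the functions are measurable, and $X_0$, all $W_t$ and all $Z_t^k$ are mutually independent. There are $\sigma$-finite reference measures $dx_t$, $dy_t^k$ and jointly measurable densities: $X_0$ has a density, $S_{t+1}(\cdot\mid x,u)$ is the density of $f_t(x,u,W_t)$, and $Q_t^k(\cdot\mid x)$ is the density of $h_t^k(x,Z_t^k)$. The costs $c_t(x,u^1,\dots,u^K)$, $t<T$, and $c_T(x)$ are measurable (for instance lower semicontinuous) with values in $(-\infty,\infty]$, and each is bounded below by a real constant. The common information is $\Delta_t=\{Y_s^j,U_s^j: 0\le s\le t-n,\ 1\le j\le K\}$, and the private information of player $j$ is $\Lambda_t^j=\{Y_s^j: t-n<s\le t\}\cup\{U_s^j: t-n<s\le t-1\}$ (times $s\ge0$); $\Lambda_t^{-k}=(\Lambda_t^j)_{j\ne k}$. A strategy $g^k$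 of player $k$ consists of measurable functions with $U_t^k=g_t^k(\Delta_t,\Lambda_t^k)$. For a profile $g=(g^k,g^{-k})$ let $$J_T(g)=\mathbb E^{g}\Big[\sum_{t<T}c_t(X_t,U_t)+c_T(X_T)\Big],\qquad J_{t,T}^{g}(\delta_t,\lambda_t^k)=\mathbb E^{g}\Big[\sum_{s=t}^{T-1}c_s(X_s,U_s)+c_T(X_T)\,\Big|\,\Delta_t=\delta_t,\Lambda_t^k=\lambda_t^k\Big].$$ A profile $g^{o}$ is person-by-person (PbP) optimal if $J_T(g^{k,o},g^{-k,o})\le J_T(g^k,g^{-k,o})$ for all $k$ and all $g^k$. The cost-to-go $\mathcal V_t^{g^k,g^{-k,o}}(\delta_t,\lambda_t^k)$ is the infimum of $J_{t,T}^{\tilde g^k,g^{-k,o}}(\delta_t,\lambda_t^k)$ over all strategies $\tilde g^k$ that agree with $g^k$ before time $t$. As conditional expectations are defined up to null sets, this is the essential infimum with respect to the law of $(\Delta_t,\Lambda_t^k)$, and equalities of such functions hold for almost all $(\delta_t,\lambda_t^k)$. The integral $d\lambda_t^{-k}$ over values of $\Lambda_t^{-k}$ uses the reference measures for observations and the counting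 measure for actions, so that the delta function at an action is the indicator of that action. A density means a nonnegative measurable $\xi(x_t,\lambda_t^{-k})$ of total integral $1$. The private a posteriori density $\Xi_t^k=\xi_t^k[\Delta_t,\Lambda_t^k]$ is the conditional density of $(X_t,\Lambda_t^{-k})$ given $(\Delta_t,\Lambda_t^k)$. Fix $k$ and the strategies $g^{-k,o}$ of the other players. For a density $\xi$ define $$\overline{\mathbf T}(x_{t+1},\lambda_{t+1}^{-k})=\prod_{j=1}^KQ_{t+1}^j(y_{t+1}^j|x_{t+1})\int S_{t+1}\big(x_{t+1}|x_t,u_t^k,g_t^{-k,o}(\delta_t,\lambda_t^{-k})\big)\prod_{j\neq k}\mathbf 1\{u_t^j=g_t^{j,o}(\delta_t,\lambda_t^j)\}\,\xi(x_t,\lambda_t^{-k})\,dx_t$$ (the indicators are omitted if $n=1$), and $\mathbf T_{t+1}^k=\overline{\mathbf T}\big/\!\int\overline{\mathbf T}\,dx_{t+1}d\lambda_{t+1}^{-k}$, taken to be $0$ if the denominator is $0$. The operator depends on $y^k_{t+1}$, $u_t^k$, $g_t^{-k,o}(\delta_t,\cdot)$, $\xi$, and on the newly shared data $y_{t-n+1}^{-k},u_{t-n+1}^{-k}$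 (the entries of $\lambda_t^{-k}$ that are not entries of $\lambda_{t+1}^{-k}$), which are held fixed. Functions $V_t(\xi,\delta_t,\lambda_t^k)$, $0\le t\le T$, with values in $[-\infty,\infty]$ solve the **DP recursions** if for all densities $\xi$ and all $(\delta_t,\lambda_t^k)$ $$V_T(\xi,\delta_T,\lambda_T^k)=\int c_T(x_T)\,\xi(x_T,\lambda_T^{-k})\,dx_Td\lambda_T^{-k},\qquad V_t(\xi,\delta_t,\lambda_t^k)=\inf_{u\in\mathbb U_t^k}H_t(\xi,\delta_t,\lambda_t^k,u)\quad(t<T),$$ $$H_t(\xi,\delta_t,\lambda_t^k,u)=\int c_t\big(x_t,u,g_t^{-k,o}(\delta_t,\lambda_t^{-k})\big)\xi(x_t,\lambda_t^{-k})\,dx_td\lambda_t^{-k}+\int V_{t+1}\big(\mathbf T_{t+1}^k,\delta_{t+1},\lambda_{t+1}^k\big)\,p(y_{t+1}^k,\lambda_t^{-k},x_t,x_{t+1})\,dy_{t+1}^kd\lambda_t^{-k}dx_tdx_{t+1},$$ $$p(y_{t+1}^k,\lambda_t^{-k},x_t,x_{t+1})=Q_{t+1}^k(y_{t+1}^k|x_{t+1})\,S_{t+1}\big(x_{t+1}|x_t,u,g_t^{-k,o}(\delta_t,\lambda_t^{-k})\big)\,\xi(x_t,\lambda_t^{-k}),$$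 where $(\delta_{t+1},\lambda_{t+1}^k)$ consists of $\delta_t,\lambda_t^k,y_{t+1}^k,u,y_{t-n+1}^{-k},u_{t-n+1}^{-k}$ (for $n=1$, $u_t^{-k}=g_t^{-k,o}(\delta_t,\lambda_t^{-k})$; for $t+1<n$ nothing is newly shared). **Theorem.** Let $g^{o}$ be a profile and let $k$ be a player. The a posteriori densities $\Xi_t^k$ exist under $(g^k,g^{-k,o})$ for every $g^k$ and all $t\le T$, and the DP recursions have a solution. Let $V$ be any solution. (0) The integrals in the recursions are the conditional expectations that they stand for: under $(g^k,g^{-k,o})$, for every $g^k$, $$\int c_T\,\Xi_T^k\,dx_Td\lambda_T^{-k}=\mathbb E[c_T(X_T)|\Delta_T,\Lambda_T^k],\qquad H_t(\Xi_t^k,\Delta_t,\Lambda_t^k,U_t^k)=\mathbb E\big[c_t(X_t,U_t)+V_{t+1}(\Xi_{t+1}^k,\Delta_{t+1},\Lambda_{t+1}^k)\,\big|\,\Delta_t,\Lambda_t^k\big]\quad(t<T)$$ almost surely, and for $t<T$ the function $p$, at $\xi=\Xi_t^k$, $\delta_t=\Delta_t$, $u=U_t^k$, is the conditional density of $(Y_{t+1}^k,\Lambda_t^{-k},X_t,X_{t+1})$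 given $(\Delta_t,\Lambda_t^k)$. (1) (Necessary conditions) Suppose that $g^{o}$ is PbP optimal. (1.1) For every $t\le T$, $\mathcal V_t^{g^{k},g^{-k,o}}(\delta_t,\lambda_t^k)=V_t(\xi_t^k[\delta_t,\lambda_t^k],\delta_t,\lambda_t^k)$ for almost all $(\delta_t,\lambda_t^k)$, for $g^k=g^{k,o}$ and in fact for every strategy $g^k$ used before time $t$. (1.2) If $g^k$ is such that under $(g^k,g^{-k,o})$, for all $t<T$, the action $g_t^k(\Delta_t,\Lambda_t^k)$ almost surely attains $\inf_uH_t(\Xi_t^k,\Delta_t,\Lambda_t^k,u)$, then $J_T(g^k,g^{-k,o})=J_T(g^{o})$, that is, $g^k$ is optimal against $g^{-k,o}$. If the infima are attained (under $(g^k,g^{-k,o})$, for every $g^k$ and all $t<T$, almost surely at $(\Xi_t^k,\Delta_t,\Lambda_t^k)$), then there is an optimal strategy that is semi-separated: there are functions $\gamma_t(\xi,\delta_t,\lambda_t^k)$, $t<T$, that attain the infimum of $H_t(\xi,\delta_t,\lambda_t^k,\cdot)$ wherever it is attained, and an admissible $g^k$ with $J_T(g^k,g^{-k,o})=J_T(g^{o})$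 and, under $(g^k,g^{-k,o})$, $U_t^k=\gamma_t(\Xi_t^k,\Delta_t,\Lambda_t^k)$ almost surely for all $t<T$. (2) (Verification) Whether or not $g^{o}$ is PbP optimal, for every strategy $g^k$ and every $t\le T$, under $(g^k,g^{-k,o})$, $$V_t(\Xi_t^k,\Delta_t,\Lambda_t^k)\le J_{t,T}^{g^k,g^{-k,o}}(\Delta_t,\Lambda_t^k)\quad\text{almost surely.}$$ -/

import Mathlib

open MeasureTheory ProbabilityTheory
open scoped ENNReal

namespace DelayedSharing

/-! ### Extended-real expectations -/

/-- The integral `I(φ⁺) - I(φ⁻)` of an extended-real function, built from an integral `I` of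
nonnegative functions. -/
noncomputable def extInt {α : Type*} (I : (α → ℝ≥0∞) → ℝ≥0∞) (φ : α → EReal) : EReal :=
  ((I fun a => (φ a).toENNReal : ℝ≥0∞) : EReal) - ((I fun a => (-φ a).toENNReal : ℝ≥0∞) : EReal)

/-- Expectation of an extended-real random variable. -/
noncomputable def expect {Ω : Type*} [MeasurableSpace Ω] (P : Measure Ω) (φ : Ω → EReal) : EReal :=
  extInt (fun F => ∫⁻ ω, F ω ∂P) φ

/-- `j` is a version of `i ↦ E[Z | ι = i]`, for an extended-real `Z`. -/
def IsCondExp {Ω β : Type*} [MeasurableSpace Ω] [MeasurableSpace β] (P : Measure Ω)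
    (ι : Ω → β) (Z : Ω → EReal) (j : β → EReal) : Prop :=
  AEMeasurable j (P.map ι) ∧ ∀ A : Set β, MeasurableSet A →
    expect P ((ι ⁻¹' A).indicator Z) = expect P ((ι ⁻¹' A).indicator fun ω => j (ι ω))

/-! ### The system -/

/-- Times `s` with `0 ≤ s ≤ t - n`: the data of these times are common knowledge at time `t`. -/
abbrev ComWin (n t : ℕ) := {s : ℕ // s ∈ (Finset.range (t + 1)).filter fun s => s + n ≤ t}

/-- Times `s` with `max (t - n + 1) 0 ≤ s ≤ t`: the observations of these times are private. -/
abbrev ObsWin (n t : ℕ) := {s : ℕ // s ∈ (Finset.range (t + 1)).filter fun s => t < s + n}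

/-- Times `s` with `max (t - n + 1) 0 ≤ s ≤ t - 1`: the actions of these times are private. -/
abbrev ActWin (n t : ℕ) := {s : ℕ // s ∈ (Finset.range t).filter fun s => t < s + n}

/-- A decentralized partially observed control system with `K` players, horizon `T`, sharing
delay `n`, and transition and observation densities. What happens after time `T` is irrelevant;
it may be taken to be trivial. -/
structure Model (K : ℕ) where
  /-- horizon -/
  T : ℕ
  /-- delay of the sharing of information -/
  n : ℕ
  one_le_n : 1 ≤ n
  /-- state spaces -/
  X : ℕ → Type*
  /-- observation spaces -/
  Y : ℕ → Fin K → Type*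
  /-- action spaces -/
  U : ℕ → Fin K → Type*
  /-- spaces of the noise of the dynamics -/
  W : ℕ → Type*
  /-- spaces of the observation noises -/
  Z : ℕ → Fin K → Type*
  /-- sample space -/
  Ω : Type*
  [mX : ∀ t, MeasurableSpace (X t)]
  [sX : ∀ t, StandardBorelSpace (X t)]
  [mY : ∀ t k, MeasurableSpace (Y t k)]
  [sY : ∀ t k, StandardBorelSpace (Y t k)]
  [mU : ∀ t k, MeasurableSpace (U t k)]
  [sU : ∀ t k, StandardBorelSpace (U t k)]
  [mW : ∀ t, MeasurableSpace (W t)]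
  [mZ : ∀ t k, MeasurableSpace (Z t k)]
  [mΩ : MeasurableSpace Ω]
  /-- the probability measure -/
  P : Measure Ω
  [probP : IsProbabilityMeasure P]
  /-- initial state -/
  X0 : Ω → X 0
  /-- noise of the dynamics -/
  w : ∀ t, Ω → W t
  /-- observation noises -/
  z : ∀ t k, Ω → Z t k
  measurable_X0 : Measurable X0
  measurable_w : ∀ t, Measurable (w t)
  measurable_z : ∀ t k, Measurable (z t k)
  /-- the initial state and all the noises are mutually independent -/
  indep : iIndep (Sum.elim (fun _ : Unit => MeasurableSpace.comap X0 inferInstance)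
    (Sum.elim (fun t : ℕ => MeasurableSpace.comap (w t) inferInstance)
      (fun p : ℕ × Fin K => MeasurableSpace.comap (z p.1 p.2) inferInstance))) P
  /-- dynamics `X_{t+1} = f_t(X_t, U_t, W_t)` -/
  f : ∀ t, X t → (∀ j, U t j) → W t → X (t + 1)
  /-- observations `Y_t^k = h_t^k(X_t, Z_t^k)` -/
  h : ∀ t k, X t → Z t k → Y t k
  measurable_f : ∀ t, Measurable fun p : X t × (∀ j, U t j) × W t => f t p.1 p.2.1 p.2.2
  measurable_h : ∀ t k, Measurable fun p : X t × Z t k => h t k p.1 p.2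
  /-- reference measures `dx_t` -/
  νX : ∀ t, Measure (X t)
  /-- reference measures `dy_t^k` -/
  νY : ∀ t k, Measure (Y t k)
  [sigmaFinite_νX : ∀ t, SigmaFinite (νX t)]
  [sigmaFinite_νY : ∀ t k, SigmaFinite (νY t k)]
  /-- density of the initial state -/
  p0 : X 0 → ℝ≥0∞
  /-- `S t x u x'` is the density of `X_{t+1}` at `x'` given `X_t = x`, `U_t = u` -/
  S : ∀ t, X t → (∀ j, U t j) → X (t + 1) → ℝ≥0∞
  /-- `Q t k x y` is the density of `Y_t^k` at `y` given `X_t = x` -/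
  Q : ∀ t k, X t → Y t k → ℝ≥0∞
  measurable_p0 : Measurable p0
  measurable_S : ∀ t, Measurable fun p : X t × (∀ j, U t j) × X (t + 1) => S t p.1 p.2.1 p.2.2
  measurable_Q : ∀ t k, Measurable fun p : X t × Y t k => Q t k p.1 p.2
  law_X0 : P.map X0 = (νX 0).withDensity p0
  law_S : ∀ t x u, P.map (fun ω => f t x u (w t ω)) = (νX (t + 1)).withDensity (S t x u)
  law_Q : ∀ t k x, P.map (fun ω => h t k x (z t k ω)) = (νY t k).withDensity (Q t k x)
  /-- running costs -/
  c : ∀ t, X t → (∀ j, U t j) → EReal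
  /-- terminal cost -/
  cT : X T → EReal
  measurable_c : ∀ t, Measurable fun p : X t × (∀ j, U t j) => c t p.1 p.2
  measurable_cT : Measurable cT
  bddBelow_c : ∀ t, ∃ m : ℝ, ∀ x u, (m : EReal) ≤ c t x u
  bddBelow_cT : ∃ m : ℝ, ∀ x, (m : EReal) ≤ cT x

attribute [instance] Model.mX Model.sX Model.mY Model.sY Model.mU Model.sU Model.mW Model.mZ
  Model.mΩ Model.probP Model.sigmaFinite_νX Model.sigmaFinite_νY

namespace Model

section

variable {K : ℕ} (M : Model K)

/-! ### Information -/

/-- Values `δ_t` of the common information `Δ_t = {Y_{0,t-n}^j, U_{0,t-n}^j : all j}`. -/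
abbrev Com (t : ℕ) := ∀ s : ComWin M.n t, ∀ j, M.Y s j × M.U s j

/-- Values `λ_t^j` of the private information `Λ_t^j = {Y_{t-n+1,t}^j, U_{t-n+1,t-1}^j}`. -/
abbrev Priv (t : ℕ) (j : Fin K) :=
  (∀ s : ObsWin M.n t, M.Y s j) × (∀ s : ActWin M.n t, M.U s j)

/-- Values `λ_t^{-k}` of the private information of all the players but `k`. -/
abbrev Oth (k : Fin K) (t : ℕ) := ∀ j : {j : Fin K // j ≠ k}, M.Priv t j

/-- Admissible strategies of player `k`: measurable functions `g_t^k` of `(Δ_t, Λ_t^k)`. -/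
abbrev Strat (k : Fin K) :=
  {g : ∀ t, M.Com t × M.Priv t k → M.U t k // ∀ t, Measurable (g t)}

/-- Profiles of strategies. -/
abbrev Profile := ∀ k, M.Strat k

variable {M}

/-- The common information `δ_{t+1}`: it contains `δ_t`, and the data of time `t + 1 - n` (if this
is not negative) of all the players. -/
def nextCom {t : ℕ} (δ : M.Com t) (l : ∀ j, M.Priv t j) (u : ∀ j, M.U t j) : M.Com (t + 1) :=
  fun s j =>
    have hs := (Finset.mem_filter.mp s.2).2
    have hn := M.one_le_n
    if h : s.1 + M.n ≤ t then
      δ ⟨s.1, Finset.mem_filter.mpr ⟨Finset.mem_range.mpr (by omega), h⟩⟩ j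
    else
      ((l j).1 ⟨s.1, Finset.mem_filter.mpr ⟨Finset.mem_range.mpr (by omega), by omega⟩⟩,
        if h' : s.1 < t then
          (l j).2 ⟨s.1, Finset.mem_filter.mpr ⟨Finset.mem_range.mpr h', by omega⟩⟩
        else
          (show t = s.1 by omega) ▸ u j)

/-- The private information `λ_{t+1}^j`, obtained from `λ_t^j`, `u_t^j`, `y_{t+1}^j`. -/
def nextPriv {t : ℕ} {j : Fin K} (l : M.Priv t j) (u : M.U t j) (y : M.Y (t + 1) j) :
    M.Priv (t + 1) j :=
  (fun s =>
    have hs := (Finset.mem_filter.mp s.2).2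
    have hs' := Finset.mem_range.mp (Finset.mem_filter.mp s.2).1
    if h : s.1 ≤ t then
      l.1 ⟨s.1, Finset.mem_filter.mpr ⟨Finset.mem_range.mpr (by omega), by omega⟩⟩
    else
      (show t + 1 = s.1 by omega) ▸ y,
  fun s =>
    have hs := (Finset.mem_filter.mp s.2).2
    have hs' := Finset.mem_range.mp (Finset.mem_filter.mp s.2).1
    if h : s.1 < t then
      l.2 ⟨s.1, Finset.mem_filter.mpr ⟨Finset.mem_range.mpr h, by omega⟩⟩
    else
      (show t = s.1 by omega) ▸ u)

/-- The common information at time `0` is empty. -/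
def com0 : M.Com 0 := fun s =>
  absurd (Finset.mem_filter.mp s.2).2 (by have := M.one_le_n; omega)

/-- The private information at time `0` is the first observation. -/
def priv0 {j : Fin K} (y : M.Y 0 j) : M.Priv 0 j :=
  (fun s => (show 0 = s.1 by
      have := Finset.mem_range.mp (Finset.mem_filter.mp s.2).1; omega) ▸ y,
    fun s => absurd (Finset.mem_filter.mp s.2).1 (by simp))

/-- `λ_t^{-k}` and `λ_t^k` put together. -/
def allPriv {k : Fin K} {t : ℕ} (l : M.Priv t k) (lo : M.Oth k t) : ∀ j, M.Priv t j :=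
  fun j => if h : j = k then h.symm ▸ l else lo ⟨j, h⟩

/-- The actions `(u, g_t^{-k}(δ_t, λ_t^{-k}))`: player `k` acts `u`, the others follow `g`. -/
def jointAct (g : M.Profile) {k : Fin K} {t : ℕ} (δ : M.Com t) (lo : M.Oth k t) (u : M.U t k) :
    ∀ j, M.U t j :=
  fun j => if h : j = k then h.symm ▸ u else (g j).1 t (δ, lo ⟨j, h⟩)

/-! ### The controlled processes and the costs -/

/-- `(X_t, Δ_t, (Λ_t^j)_j)` under the profile `g`. -/
def run (g : M.Profile) (ω : M.Ω) : ∀ t, M.X t × M.Com t × (∀ j, M.Priv t j)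
  | 0 => (M.X0 ω, com0, fun j => priv0 (M.h 0 j (M.X0 ω) (M.z 0 j ω)))
  | t + 1 =>
    let s := run g ω t
    let u : ∀ j, M.U t j := fun j => (g j).1 t (s.2.1, s.2.2 j)
    let x := M.f t s.1 u (M.w t ω)
    (x, nextCom s.2.1 s.2.2 u, fun j => nextPriv (s.2.2 j) (u j) (M.h (t + 1) j x (M.z (t + 1) j ω)))

/-- The state `X_t`. -/
def state (g : M.Profile) (t : ℕ) (ω : M.Ω) : M.X t := (run g ω t).1

/-- The information `I_t^k = (Δ_t, Λ_t^k)` of player `k`. -/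
def info (g : M.Profile) (k : Fin K) (t : ℕ) (ω : M.Ω) : M.Com t × M.Priv t k :=
  ((run g ω t).2.1, (run g ω t).2.2 k)

/-- The private information `Λ_t^{-k}` of the players other than `k`. -/
def oth (g : M.Profile) (k : Fin K) (t : ℕ) (ω : M.Ω) : M.Oth k t := fun j => (run g ω t).2.2 j

/-- The observation `Y_t^k`. -/
def obs (g : M.Profile) (k : Fin K) (t : ℕ) (ω : M.Ω) : M.Y t k :=
  M.h t k (state g t ω) (M.z t k ω)

/-- The actions `U_t`. -/
def act (g : M.Profile) (t : ℕ) (ω : M.Ω) : ∀ j, M.U t j := fun j => (g j).1 t (info g j t ω)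

/-- The random cost over `{t, …, T}`. -/
noncomputable def costFrom (g : M.Profile) (t : ℕ) (ω : M.Ω) : EReal :=
  (∑ s ∈ Finset.Ico t M.T, M.c s (state g s ω) (act g s ω)) + M.cT (state g M.T ω)

/-- The cost `J_T(g)`. -/
noncomputable def cost (g : M.Profile) : EReal := expect M.P (costFrom g 0)

/-- Person-by-person optimality. -/
def IsPbPOptimal (g : M.Profile) : Prop :=
  ∀ (k : Fin K) (gk : M.Strat k), cost g ≤ cost (Function.update g k gk)

/-- `J` is (a version of) the conditional cost `J_{t,T}^g(δ, λ)` over `{t, …, T}` given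
`Δ_t = δ`, `Λ_t^k = λ`. -/
def IsCondCost (g : M.Profile) (k : Fin K) (t : ℕ) (J : M.Com t × M.Priv t k → EReal) : Prop :=
  IsCondExp M.P (info g k t) (costFrom g t) J

/-- `v` is the cost-to-go of player `k` at time `t` when `g` is used before time `t`: the
(essential) infimum of the conditional costs `J_{t,T}` over all the strategies of player `k`
that agree with `g^k` before time `t`, the other players following `g`. -/
def IsCostToGo (g : M.Profile) (k : Fin K) (t : ℕ) (v : M.Com t × M.Priv t k → EReal) : Prop :=
  let μ := M.P.map (info g k t)
  let IsLower := fun v' : M.Com t × M.Priv t k → EReal =>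
    AEMeasurable v' μ ∧ ∀ gk : M.Strat k, (∀ s < t, gk.1 s = (g k).1 s) →
      ∀ J, IsCondCost (Function.update g k gk) k t J → ∀ᵐ i ∂μ, v' i ≤ J i
  IsLower v ∧ ∀ v', IsLower v' → ∀ᵐ i ∂μ, v' i ≤ v i

/-! ### Private a posteriori densities -/

/-- The integral `∫ F(λ) dλ` over the private information `λ = λ_t^{-k}` of the other players, with
the reference measures for the observations and the counting measure for the actions. (The density
of a Dirac mass with respect to the counting measure is the indicator of the point.) -/
noncomputable def intOth (k : Fin K) (t : ℕ) (F : M.Oth k t → ℝ≥0∞) : ℝ≥0∞ :=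
  ∫⁻ y : (∀ j : {j : Fin K // j ≠ k}, ∀ s : ObsWin M.n t, M.Y s j),
    ∑' u : (∀ j : {j : Fin K // j ≠ k}, ∀ s : ActWin M.n t, M.U s j), F fun j => (y j, u j)
    ∂(Measure.pi fun j : {j : Fin K // j ≠ k} => Measure.pi fun s : ObsWin M.n t => M.νY s j)

variable (M) in
/-- Densities `ξ(x_t, λ_t^{-k})`. -/
abbrev Bel (k : Fin K) (t : ℕ) := M.X t × M.Oth k t → ℝ≥0∞

/-- The integral `∫ F(x, λ) ξ(x, λ) dx dλ`. -/
noncomputable def intBel {k : Fin K} {t : ℕ} (ξ : M.Bel k t) (F : M.X t × M.Oth k t → ℝ≥0∞) :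
    ℝ≥0∞ :=
  ∫⁻ x, intOth k t (fun lo => F (x, lo) * ξ (x, lo)) ∂M.νX t

/-- `ξ` is a probability density. -/
def IsPDF {k : Fin K} {t : ℕ} (ξ : M.Bel k t) : Prop :=
  Measurable ξ ∧ intBel ξ (fun _ => 1) = 1

/-- `ξ` is (a version of) the private a posteriori density `ξ_t^k[δ_t, λ_t^k]` of
`(X_t, Λ_t^{-k})` given `(Δ_t, Λ_t^k)`. -/
def IsPosterior (g : M.Profile) (k : Fin K) (t : ℕ) (ξ : M.Com t × M.Priv t k → M.Bel k t) :
    Prop :=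
  Measurable (fun p : (M.Com t × M.Priv t k) × (M.X t × M.Oth k t) => ξ p.1 p.2) ∧
  ∀ φ : (M.Com t × M.Priv t k) × (M.X t × M.Oth k t) → ℝ≥0∞, Measurable φ →
    ∫⁻ ω, φ (info g k t ω, (state g t ω, oth g k t ω)) ∂M.P =
      ∫⁻ ω, intBel (ξ (info g k t ω)) (fun p => φ (info g k t ω, p)) ∂M.P

/-! ### The operator `T^k` -/

/-- `λ_t^j` recovered from `λ_{t+1}^j` and from the entry of time `t + 1 - n` of `old`, which is
the only entry of `old` that is used, and which is no longer private at time `t + 1`. -/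
def prevPriv {t : ℕ} {j : Fin K} (old : M.Priv t j) (l : M.Priv (t + 1) j) : M.Priv t j :=
  (fun s =>
    have hs' := Finset.mem_range.mp (Finset.mem_filter.mp s.2).1
    if h : t + 1 < s.1 + M.n then
      l.1 ⟨s.1, Finset.mem_filter.mpr ⟨Finset.mem_range.mpr (by omega), h⟩⟩
    else old.1 s,
  fun s =>
    have hs' := Finset.mem_range.mp (Finset.mem_filter.mp s.2).1
    if h : t + 1 < s.1 + M.n then
      l.2 ⟨s.1, Finset.mem_filter.mpr ⟨Finset.mem_range.mpr (by omega), h⟩⟩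
    else old.2 s)

/-- The newest observation `y_{t+1}^j` in `λ_{t+1}^j`. -/
def newObs {t : ℕ} {j : Fin K} (l : M.Priv (t + 1) j) : M.Y (t + 1) j :=
  l.1 ⟨t + 1, Finset.mem_filter.mpr ⟨Finset.mem_range.mpr (by omega), by
    have := M.one_le_n; omega⟩⟩

open Classical in
/-- The delta function at `u_t^j = v`, where `u_t^j` is the newest action in `λ_{t+1}^j`; it is
absent if `n = 1`, since `λ_{t+1}^j` contains no action then. -/
noncomputable def delta {t : ℕ} {j : Fin K} (l : M.Priv (t + 1) j) (v : M.U t j) : ℝ≥0∞ :=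
  if h : 1 < M.n then
    if l.2 ⟨t, Finset.mem_filter.mpr ⟨Finset.mem_range.mpr (by omega), by omega⟩⟩ = v then 1 else 0
  else 1

/-- The numerator of the operator `T_{t+1}^k(y_{t+1}^k, u_t^k, g_t^{-k}(δ_t, ·), ξ)`, evaluated at
`(x_{t+1}, λ_{t+1}^{-k})`. The data `(y_{t-n+1}^{-k}, u_{t-n+1}^{-k})`, which are shared at time
`t + 1`, enter as the corresponding entries of `old`. -/
noncomputable def opNum (g : M.Profile) {k : Fin K} {t : ℕ} (δ : M.Com t) (old : M.Oth k t)
    (y : M.Y (t + 1) k) (u : M.U t k) (ξ : M.Bel k t) : M.Bel k (t + 1) := fun p =>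
  let lo : M.Oth k t := fun j => prevPriv (old j) (p.2 j)
  M.Q (t + 1) k p.1 y * (∏ j : {j : Fin K // j ≠ k}, M.Q (t + 1) j p.1 (newObs (p.2 j))) *
    ∫⁻ x, M.S t x (jointAct g δ lo u) p.1 *
      (∏ j : {j : Fin K // j ≠ k}, delta (p.2 j) ((g j).1 t (δ, lo j))) * ξ (x, lo) ∂M.νX t

open Classical in
/-- The operator `T_{t+1}^k(y_{t+1}^k, u_t^k, g_t^{-k}(δ_t, ·), ξ)`. -/
noncomputable def op (g : M.Profile) {k : Fin K} {t : ℕ} (δ : M.Com t) (old : M.Oth k t)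
    (y : M.Y (t + 1) k) (u : M.U t k) (ξ : M.Bel k t) : M.Bel k (t + 1) := fun p =>
  let D := intBel (opNum g δ old y u ξ) (fun _ => 1)
  if D = 0 then 0 else opNum g δ old y u ξ p / D

/-! ### The dynamic programming equations -/

/-- The joint predictive density of `(Y_{t+1}^k, Λ_t^{-k}, X_t, X_{t+1})`. -/
noncomputable def pred (g : M.Profile) {k : Fin K} {t : ℕ} (ξ : M.Bel k t) (δ : M.Com t)
    (u : M.U t k) (q : M.Y (t + 1) k × M.Oth k t × M.X t × M.X (t + 1)) : ℝ≥0∞ :=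
  M.Q (t + 1) k q.2.2.2 q.1 * M.S t q.2.2.1 (jointAct g δ q.2.1 u) q.2.2.2 * ξ (q.2.2.1, q.2.1)

/-- The integral of `F` against the joint predictive density. -/
noncomputable def intPred (g : M.Profile) {k : Fin K} {t : ℕ} (ξ : M.Bel k t) (δ : M.Com t)
    (u : M.U t k) (F : M.Y (t + 1) k × M.Oth k t × M.X t × M.X (t + 1) → ℝ≥0∞) : ℝ≥0∞ :=
  ∫⁻ y, ∫⁻ x, intOth k t (fun lo => ∫⁻ x', F (y, lo, x, x') * pred g ξ δ u (y, lo, x, x')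
    ∂M.νX (t + 1)) ∂M.νX t ∂M.νY (t + 1) k

/-- The terminal condition of the recursion. -/
noncomputable def dpTerm {k : Fin K} (ξ : M.Bel k M.T) : EReal :=
  extInt (intBel ξ) fun p => M.cT p.1

/-- The expression under the infimum in the recursion, `V'` being the value function at time
`t + 1`. -/
noncomputable def dpStep (g : M.Profile) {k : Fin K} {t : ℕ}
    (V' : M.Bel k (t + 1) → M.Com (t + 1) × M.Priv (t + 1) k → EReal)
    (ξ : M.Bel k t) (i : M.Com t × M.Priv t k) (u : M.U t k) : EReal :=
  extInt (intBel ξ) (fun p => M.c t p.1 (jointAct g i.1 p.2 u)) +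
  extInt (intPred g ξ i.1 u) (fun q =>
    V' (op g i.1 q.2.1 q.1 u ξ)
      (nextCom i.1 (allPriv i.2 q.2.1) (jointAct g i.1 q.2.1 u), nextPriv i.2 u q.1))

/-- The value functions `V_t(ξ, δ, λ)` solve the dynamic programming recursions of player `k`, the
other players following `g`. -/
def IsDPSolution (g : M.Profile) (k : Fin K)
    (V : ∀ t, M.Bel k t → M.Com t × M.Priv t k → EReal) : Prop :=
  (∀ (ξ : M.Bel k M.T) (i : M.Com M.T × M.Priv M.T k), IsPDF ξ → V M.T ξ i = dpTerm ξ) ∧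
  ∀ t < M.T, ∀ (ξ : M.Bel k t) (i : M.Com t × M.Priv t k), IsPDF ξ →
    V t ξ i = ⨅ u : M.U t k, dpStep g (V (t + 1)) ξ i u

/-- The action `u` attains the infimum in the dynamic programming equation at `(ξ, i)`. -/
def IsMinimizer (g : M.Profile) (k : Fin K)
    (V : ∀ t, M.Bel k t → M.Com t × M.Priv t k → EReal) (t : ℕ) (ξ : M.Bel k t)
    (i : M.Com t × M.Priv t k) (u : M.U t k) : Prop :=
  ∀ u', dpStep g (V (t + 1)) ξ i u ≤ dpStep g (V (t + 1)) ξ i u'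

end

end Model

end DelayedSharing

open DelayedSharing DelayedSharing.Model

namespace DelayedSharing

/-! ### Measurable selection up to null sets -/

section Selection

open Set Filter Topology

-- Against fixed strategies of the others, player `k` faces a partially observed control problem,
-- and the theorem is dynamic programming for the conditional law of the state and of the others'
-- private information. Two obstacles have to be removed before the usual argument applies.
--
-- The first is the counting measure on action spaces that may be uncountable: it is not σ-finite,
-- so Tonelli's theorem is not available. Given the information of player `k`, however, the private
-- actions of the others are a deterministic function `G` of their private observations. Hence an a
-- posteriori density is a density `ζ` of the state and of these observations, times the indicator
-- of the graph of `G` (`Rep`, `Good`), and every sum over actions collapses to one term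
-- (`Rep.intBel`). The update operator keeps this form (`opNum_of_rep`, `Good.next`). The reason is
-- causality: an action that becomes shared depends only on observations that are shared by then, so
-- the shared observations determine the shared actions. With the change of variables
-- `lintegral_νO_νN`, Bayes' formula becomes the recursion `filt`, which is the conditional law by
-- induction on time (`lintegral_filt`). Every version of the a posteriori density is almost surely
-- represented by it (`ae_good`).
--
-- The second is measurability, since value functions are only defined through infima. As costs are
-- bounded below, they are shifted into `[0, ∞]`. The recursion in terms of `(ζ, G)` then has values
-- that, along measurable families, are partial infima of jointly measurable functions (`LSA`,
-- `lsa_value`). This class is stable under infima, and under integrals because measurable selectors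
-- are, up to null sets, parametrized by the Baire space. Its members are universally measurable and
-- have almost minimizing selectors, and minimizing ones where minima exist. All of this rests on
-- `exists_measurable_ae_selection`. Any solution `V` agrees with the shifted reduced values at
-- represented densities (`Good.value_eq`).
--
-- What remains is classical. Along the filter, the expression under the infimum is the conditional
-- expectation of the running cost plus the next value (`setLIntegral_stepVal`). Backward induction
-- makes the value a lower bound of every conditional cost (`ae_curVal_le`). Following
-- `ε`-minimizers from `t` on loses at most `(T - t) ε`, and following exact minimizers loses
-- nothing. This gives the cost-to-go and the optimality of minimizing strategies. Person-by-person
-- optimality serves only to turn an inequality of costs into an equality.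

noncomputable local instance : MetricSpace (ℕ → ℕ) := PiNat.metricSpaceNatNat

/-- The measure of a continuous image of the Baire space is approximated from within by images of
compact sets. -/
theorem exists_isCompact_le_measure_image {B : Type*} [TopologicalSpace B] [PolishSpace B]
    [MeasurableSpace B] [BorelSpace B] (μ : Measure B) [IsFiniteMeasure μ] {π : (ℕ → ℕ) → B}
    (hπ : Continuous π) {r : ℝ≥0∞} (hr : r < μ (range π)) :
    ∃ C : Set (ℕ → ℕ), IsCompact C ∧ r ≤ μ (π '' C) := by
  have step : ∀ (m : ℕ) (S : {S : Set (ℕ → ℕ) // r < μ (π '' S)}),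
      ∃ j : ℕ, r < μ (π '' (S.1 ∩ {z | z m ≤ j})) := by
    intro m S
    have hu : π '' S.1 = ⋃ j : ℕ, π '' (S.1 ∩ {z | z m ≤ j}) := by
      rw [← image_iUnion, ← inter_iUnion]
      congr 1
      ext z
      simp only [mem_inter_iff, mem_iUnion, mem_ofPred_eq]
      exact ⟨fun h => ⟨h, z m, le_rfl⟩, fun h => h.1⟩
    have hmono : Monotone fun j : ℕ => π '' (S.1 ∩ {z | z m ≤ j}) := by
      intro a b hab
      exact image_mono (inter_subset_inter_right _ fun z (hz : z m ≤ a) => hz.trans hab)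
    have h2 := S.2
    -- Continuity from below holds for increasing sequences of arbitrary sets; the images need not
    -- be measurable.
    rw [hu, hmono.measure_iUnion, lt_iSup_iff] at h2
    exact h2
  choose j hj using step
  let S : ℕ → {S : Set (ℕ → ℕ) // r < μ (π '' S)} := fun m =>
    Nat.rec ⟨univ, by rwa [image_univ]⟩ (fun m S => ⟨S.1 ∩ {z | z m ≤ j m S}, hj m S⟩) m
  have hS : ∀ m, (S m).1 = {z | ∀ i < m, z i ≤ j i (S i)} := by
    intro m
    induction m with
    | zero => ext z; simp [S]
    | succ m ih =>
      have : (S (m + 1)).1 = (S m).1 ∩ {z | z m ≤ j m (S m)} := rfl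
      rw [this, ih]
      ext z
      simp only [mem_inter_iff, mem_ofPred_eq, Nat.lt_succ_iff_lt_or_eq]
      constructor
      · rintro ⟨h1, h2⟩ i (hi | rfl)
        · exact h1 i hi
        · exact h2
      · intro h
        exact ⟨fun i hi => h i (Or.inl hi), h m (Or.inr rfl)⟩
  -- `C` is the intersection of the sets `S m`. Images do not commute with it a priori, so the
  -- estimate goes through an open neighbourhood of `π '' C`, which contains `π '' S m` for large
  -- `m`.
  let C : Set (ℕ → ℕ) := univ.pi fun i => Iic (j i (S i))
  have hC : IsCompact C := isCompact_univ_pi fun i => (finite_Iic _).isCompact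
  refine ⟨C, hC, ?_⟩
  by_contra hlt
  push Not at hlt
  let := TopologicalSpace.upgradeIsCompletelyMetrizable B
  obtain ⟨O, hO, hOo, hOr⟩ := Set.exists_isOpen_lt_of_lt _ _ hlt
  obtain ⟨δ, hδ, hδO⟩ := hC.exists_thickening_subset_open (hOo.preimage hπ)
    (image_subset_iff.mp hO)
  obtain ⟨m, hm⟩ := exists_pow_lt_of_lt_one hδ (by norm_num : (1 / 2 : ℝ) < 1)
  have hsub : π '' (S m).1 ⊆ O := by
    rw [image_subset_iff]
    refine subset_trans ?_ hδO
    intro z hz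
    rw [hS] at hz
    -- Replacing the coordinates from `m` on by `0` gives a point of `C` at distance at most
    -- `(1/2)^m` from `z`.
    refine Metric.mem_thickening_iff.mpr ⟨fun i => if i < m then z i else 0, ?_, ?_⟩
    · intro i _
      by_cases h : i < m
      · simpa [h] using hz i h
      · simp [h]
    · refine lt_of_le_of_lt (PiNat.mem_cylinder_iff_dist_le.mp ?_) hm
      intro i hi
      simp [hi]
  exact absurd ((S m).2.trans_le (measure_mono hsub)) hOr.not_gt

/-- A continuous map on a compact subset of the Baire space has a measurable section. -/
theorem exists_measurable_section_of_isCompact {B : Type*} [TopologicalSpace B] [PolishSpace B]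
    [MeasurableSpace B] [BorelSpace B] {π : (ℕ → ℕ) → B} (hπ : Continuous π)
    {C : Set (ℕ → ℕ)} (hC : IsCompact C) :
    ∃ s : B → (ℕ → ℕ), Measurable s ∧ ∀ b ∈ π '' C, π (s b) = b := by
  -- The first components of `R m` are the points that another point of their fibre beats at
  -- coordinate `m` after agreeing before `m`. Projections of compact sets are compact, so the set
  -- `L` below, of the lexicographically least points of the fibres, is Borel.
  let R : ℕ → Set ((ℕ → ℕ) × (ℕ → ℕ)) := fun m =>
    (C ×ˢ C) ∩ {p | π p.1 = π p.2 ∧ (∀ i < m, p.2 i = p.1 i) ∧ p.2 m < p.1 m}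
  have hclosed : ∀ m, IsClosed {p : (ℕ → ℕ) × (ℕ → ℕ) |
      π p.1 = π p.2 ∧ (∀ i < m, p.2 i = p.1 i) ∧ p.2 m < p.1 m} := by
    intro m
    have : {p : (ℕ → ℕ) × (ℕ → ℕ) | π p.1 = π p.2 ∧ (∀ i < m, p.2 i = p.1 i) ∧ p.2 m < p.1 m} =
        {p | π p.1 = π p.2} ∩ ((⋂ i, ⋂ (_ : i < m), {p | p.2 i = p.1 i}) ∩
          {p | p.2 m + 1 ≤ p.1 m}) := by
      ext p
      simp
    rw [this]
    exact (isClosed_eq (by fun_prop) (by fun_prop)).inter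
      ((isClosed_iInter fun i => isClosed_iInter fun _ => isClosed_eq (by fun_prop)
        (by fun_prop)).inter (isClosed_le (by fun_prop) (by fun_prop)))
  have hR : ∀ m, IsCompact (Prod.fst '' R m) := fun m =>
    ((hC.prod hC).inter_right (hclosed m)).image continuous_fst
  let L : Set (ℕ → ℕ) := C \ ⋃ m, Prod.fst '' R m
  have hLmem : ∀ z, z ∈ L ↔ z ∈ C ∧
      ∀ m, ∀ z' ∈ C, π z = π z' → (∀ i < m, z' i = z i) → z m ≤ z' m := by
    intro z
    simp only [L, Set.mem_sdiff, mem_iUnion, not_exists, and_congr_right_iff]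
    intro hz
    constructor
    · intro h m z' hz' h1 h2
      by_contra hlt
      exact h m ⟨(z, z'), ⟨⟨hz, hz'⟩, h1, h2, not_le.mp hlt⟩, rfl⟩
    · rintro h m ⟨⟨z1, z'⟩, ⟨⟨h1, h2⟩, h3, h4, h5⟩, rfl⟩
      exact absurd (h m z' h2 h3 h4) h5.not_ge
  have hLm : MeasurableSet L :=
    hC.measurableSet.diff (MeasurableSet.iUnion fun m => (hR m).measurableSet)
  have hinj : InjOn π L := by
    intro z hz z' hz' he
    rw [hLmem] at hz hz'
    funext m
    induction m using Nat.strong_induction_on with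
    | _ m ih =>
      exact le_antisymm (hz.2 m z' hz'.1 he fun i hi => (ih i hi).symm)
        (hz'.2 m z hz.1 he.symm fun i hi => ih i hi)
  have hex : ∀ z0 ∈ C, ∃ z ∈ L, π z = π z0 := by
    intro z0 hz0
    -- Minimizing one coordinate after another gives decreasing nonempty compact sets; a common
    -- point is the lexicographic minimum of the fibre.
    let T : ℕ → Set (ℕ → ℕ) := fun m =>
      Nat.rec (C ∩ π ⁻¹' {π z0}) (fun m T => {z ∈ T | ∀ z' ∈ T, z m ≤ z' m}) m
    have hTs : ∀ m, T (m + 1) = {z ∈ T m | ∀ z' ∈ T m, z m ≤ z' m} := fun m => rfl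
    have hne : ∀ m, (T m).Nonempty := by
      intro m
      induction m with
      | zero => exact ⟨z0, hz0, rfl⟩
      | succ m ih =>
        obtain ⟨z, hz, hmin⟩ := WellFounded.has_min
          (InvImage.wf (fun z : ℕ → ℕ => z m) Nat.lt_wfRel.wf) (T m) ih
        exact ⟨z, hz, fun z' hz' => not_lt.mp (hmin z' hz')⟩
    have hcl : ∀ m, IsClosed (T m) := by
      intro m
      induction m with
      | zero => exact hC.isClosed.inter (isClosed_singleton.preimage hπ)
      | succ m ih =>
        rw [hTs]
        have : {z ∈ T m | ∀ z' ∈ T m, z m ≤ z' m} =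
            T m ∩ ⋂ z', ⋂ (_ : z' ∈ T m), {z | z m ≤ z' m} := by
          ext z
          simp
        rw [this]
        refine ih.inter ?_
        exact isClosed_iInter fun z' => isClosed_iInter fun _ =>
          isClosed_le (by fun_prop) (by fun_prop)
    obtain ⟨z, hz⟩ := IsCompact.nonempty_iInter_of_sequence_nonempty_isCompact_isClosed T
      (fun m => by rw [hTs]; exact sep_subset _ _) hne
      (hC.inter_right (isClosed_singleton.preimage hπ)) hcl
    rw [mem_iInter] at hz
    refine ⟨z, (hLmem z).mpr ⟨(hz 0).1, fun m z' hz' he hag => ?_⟩, (hz 0).2⟩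
    have hT : ∀ j ≤ m, z' ∈ T j := by
      intro j
      induction j with
      | zero => exact fun _ => ⟨hz', he.symm.trans (hz 0).2⟩
      | succ j ih =>
        intro hj
        refine ⟨ih (by omega), fun y hy => ?_⟩
        rw [hag j (by omega)]
        exact (hz (j + 1)).2 y hy
    exact (hz (m + 1)).2 z' (hT m le_rfl)
  have : StandardBorelSpace L := hLm.standardBorel
  -- By the Lusin–Souslin theorem, an injective Borel map on the Borel set `L` is a measurable
  -- embedding; its inverse, extended measurably, is the section.
  have hemb : MeasurableEmbedding (fun z : L => π z) :=
    Measurable.measurableEmbedding (hπ.measurable.comp measurable_subtype_coe)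
      fun z z' h => Subtype.ext (hinj z.2 z'.2 h)
  obtain ⟨s, hs, hse⟩ := hemb.exists_measurable_extend
    (measurable_subtype_coe : Measurable ((↑) : L → (ℕ → ℕ))) fun _ => ⟨fun _ => 0⟩
  refine ⟨s, hs, ?_⟩
  rintro b ⟨z0, hz0, rfl⟩
  obtain ⟨z, hz, hzz⟩ := hex z0 hz0
  rw [← hzz]
  have : s (π z) = z := congrFun hse ⟨z, hz⟩
  rw [this]

/-- Measurable selection, up to a null set. -/
theorem exists_measurable_ae_selection {B Z : Type*} [MeasurableSpace B] [StandardBorelSpace B]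
    [MeasurableSpace Z] [StandardBorelSpace Z] [Nonempty Z] (μ : Measure B) [SFinite μ]
    {A : Set (B × Z)} (hA : MeasurableSet A) :
    ∃ s : B → Z, Measurable s ∧ ∀ᵐ b ∂μ, (∃ z, (b, z) ∈ A) → (b, s b) ∈ A := by
  suffices H : ∀ ν : Measure B, IsFiniteMeasure ν →
      ∃ s : B → Z, Measurable s ∧ ∀ᵐ b ∂ν, (∃ z, (b, z) ∈ A) → (b, s b) ∈ A by
    obtain ⟨s, hs, h⟩ := H μ.toFinite inferInstance
    exact ⟨s, hs, by rwa [ae_toFinite] at h⟩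
  intro ν _
  let := upgradeStandardBorel B
  let := upgradeStandardBorel Z
  -- `A` is a continuous image of the Baire space under some `h`. A section of the first component
  -- `π` of `h`, followed by the second component of `h`, selects points of `A`.
  have hA' := hA.analyticSet
  rw [AnalyticSet] at hA'
  rcases hA' with rfl | ⟨h, hh, hrange⟩
  · exact ⟨fun _ => Classical.arbitrary Z, measurable_const, by simp⟩
  set π : (ℕ → ℕ) → B := fun z => (h z).1 with hπdef
  have hπ : Continuous π := continuous_fst.comp hh
  have hC : ∀ n : ℕ, ∃ C : Set (ℕ → ℕ), IsCompact C ∧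
      ν (range π) ≤ ν (π '' C) + ((n : ℝ≥0∞) + 1)⁻¹ := by
    intro n
    by_cases h0 : ν (range π) = 0
    · exact ⟨∅, isCompact_empty, by simp [h0]⟩
    obtain ⟨C, hC, hle⟩ := exists_isCompact_le_measure_image ν hπ
      (ENNReal.sub_lt_self (measure_ne_top ν _) h0
        (ENNReal.inv_ne_zero.mpr (by finiteness : (n : ℝ≥0∞) + 1 ≠ ∞)))
    exact ⟨C, hC, tsub_le_iff_right.mp hle⟩
  choose C hCc hCle using hC
  choose s hs hsec using fun n => exists_measurable_section_of_isCompact hπ (hCc n)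
  have hN : ∀ n, MeasurableSet (π '' C n) := fun n => ((hCc n).image hπ).measurableSet
  set N := ⋃ n, π '' C n with hNdef
  have hNm : MeasurableSet N := MeasurableSet.iUnion hN
  -- The projection `range π` of `A` need not be Borel, but its outer measure is attained by the
  -- Borel set `N`.
  have hnull : ν (range π \ N) = 0 := by
    refine le_antisymm (le_of_forall_gt fun ε hε => ?_) bot_le
    obtain ⟨n, hn⟩ := ENNReal.exists_inv_nat_lt hε.ne'
    refine lt_of_le_of_lt ?_ hn
    calc ν (range π \ N) ≤ ν (range π \ (π '' C n)) :=
          measure_mono (sdiff_subset_sdiff_right (subset_iUnion (fun n => π '' C n) n))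
      _ = ν (range π) - ν (π '' C n) :=
          measure_sdiff (image_subset_range _ _) (hN n).nullMeasurableSet (measure_ne_top _ _)
      _ ≤ ((n : ℝ≥0∞) + 1)⁻¹ := tsub_le_iff_left.mpr (hCle n)
      _ ≤ (n : ℝ≥0∞)⁻¹ := ENNReal.inv_le_inv.mpr le_self_add
  classical
  -- The least `n` with `b ∈ π '' C n` is used. The alternative `b ∉ N` makes the search succeed at
  -- every `b`.
  have hp : ∀ b, ∃ n, b ∈ π '' C n ∨ b ∉ N := by
    intro b
    by_cases hb : b ∈ N
    · obtain ⟨n, hn⟩ := mem_iUnion.mp hb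
      exact ⟨n, Or.inl hn⟩
    · exact ⟨0, Or.inr hb⟩
  refine ⟨fun b => (h (s (Nat.find (hp b)) b)).2, ?_, ?_⟩
  · refine (measurable_snd.comp hh.measurable).comp
      (Measurable.find (p := fun n b => b ∈ π '' C n ∨ b ∉ N) hs (fun n => ?_) hp)
    exact (hN n).union hNm.compl
  · have hae : ∀ᵐ b ∂ν, b ∉ range π \ N := measure_eq_zero_iff_ae_notMem.mp hnull
    filter_upwards [hae] with b hb
    rintro ⟨z, hz⟩
    rw [← hrange] at hz
    obtain ⟨y, hy⟩ := hz
    have hbr : b ∈ range π := ⟨y, by simp [hπdef, hy]⟩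
    have hbN : b ∈ N := by
      by_contra hc
      exact hb ⟨hbr, hc⟩
    have h1 := (Nat.find_spec (hp b)).resolve_right (fun hc => hc hbN)
    have h2 := hsec _ b h1
    rw [← hrange]
    refine ⟨s (Nat.find (hp b)) b, Prod.ext h2 rfl⟩

/-- Every measurable map is, up to a null set, a member of a jointly measurable family of maps
that is parametrized by the Baire space. -/
theorem exists_measurable_parametrization {Q Z : Type*} [MeasurableSpace Q] [StandardBorelSpace Q]
    [MeasurableSpace Z] [StandardBorelSpace Z] [Nonempty Z] (ν : Measure Q) [SFinite ν] :
    ∃ Ψ : (ℕ → ℕ) × Q → Z, Measurable Ψ ∧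
      ∀ φ : Q → Z, Measurable φ → ∃ θ, ∀ᵐ q ∂ν, Ψ (θ, q) = φ q := by
  suffices H : ∀ ν : Measure Q, IsFiniteMeasure ν → ∃ Ψ : (ℕ → ℕ) × Q → Z, Measurable Ψ ∧
      ∀ φ : Q → Z, Measurable φ → ∃ θ, ∀ᵐ q ∂ν, Ψ (θ, q) = φ q by
    have := H ν.toFinite inferInstance
    rwa [ae_toFinite] at this
  intro ν _
  obtain ⟨e0, he0⟩ := exists_measurableEmbedding_real Z
  -- The arctangent makes the embedding bounded, so that `e ∘ φ` is integrable for every measurable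
  -- `φ`.
  set e : Z → ℝ := fun z => Real.arctan (e0 z)
  have hem : Measurable e := Real.measurable_arctan.comp he0.measurable
  have he : MeasurableEmbedding e :=
    Measurable.measurableEmbedding hem (Real.arctan_injective.comp he0.injective)
  obtain ⟨d, hd, hde⟩ := he.exists_measurable_extend (measurable_id (α := Z))
    fun _ => inferInstance
  have : Fact ((1 : ℝ≥0∞) ≠ ∞) := ⟨ENNReal.one_ne_top⟩
  let D : ℕ → Lp ℝ 1 ν := TopologicalSpace.denseSeq (Lp ℝ 1 ν)
  have hDm : ∀ n, Measurable (D n : Q → ℝ) := fun n => (Lp.stronglyMeasurable (D n)).measurable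
  -- A parameter is a sequence of indices into a dense sequence of `L¹`; it encodes the limit of the
  -- corresponding functions. The upper limit is measurable whether or not the sequence converges.
  refine ⟨fun p => d (limsup (fun m => (D (p.1 m) : Q → ℝ) p.2) atTop), ?_, fun φ hφ => ?_⟩
  · refine hd.comp (Measurable.limsup fun m => ?_)
    have h1 : Measurable fun p : ℕ × Q => (D p.1 : Q → ℝ) p.2 :=
      measurable_from_prod_countable_right fun n => hDm n
    exact h1.comp (f := fun p : (ℕ → ℕ) × Q => (p.1 m, p.2))
      (((measurable_pi_apply m).comp measurable_fst).prodMk measurable_snd)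
  · have hL : MemLp (fun q => e (φ q)) 1 ν :=
      MemLp.of_bound (hem.comp hφ).aestronglyMeasurable (Real.pi / 2)
        (Eventually.of_forall fun q => by
          rw [Real.norm_eq_abs, abs_le]
          exact ⟨(Real.neg_pi_div_two_lt_arctan _).le, (Real.arctan_lt_pi_div_two _).le⟩)
    have hdense := TopologicalSpace.denseRange_denseSeq (Lp ℝ 1 ν)
    have : ∀ m : ℕ, ∃ n, dist (hL.toLp _) (D n) < 1 / ((m : ℝ) + 1) := fun m =>
      hdense.exists_dist_lt _ Nat.one_div_pos_of_nat
    choose n hn using this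
    have hlim : Tendsto (fun m => D (n m)) atTop (𝓝 (hL.toLp _)) := by
      rw [tendsto_iff_dist_tendsto_zero]
      refine squeeze_zero (fun _ => dist_nonneg) (fun m => ?_)
        tendsto_one_div_add_atTop_nhds_zero_nat
      rw [dist_comm]
      exact (hn m).le
    obtain ⟨ns, -, hns⟩ := (tendstoInMeasure_of_tendsto_Lp hlim).exists_seq_tendsto_ae
    refine ⟨fun m => n (ns m), ?_⟩
    filter_upwards [hns, hL.coeFn_toLp] with q hq hq2
    rw [hq.limsup_eq, hq2]
    exact congrFun hde (φ q)

end Selection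

end DelayedSharing

namespace DelayedSharing

/-! ### Lower semianalytic functions -/

/-- Lower semianalytic functions: partial infima of jointly measurable functions. -/
def LSA {B : Type*} [MeasurableSpace B] (f : B → ℝ≥0∞) : Prop :=
  ∃ F : B × (ℕ → ℕ) → ℝ≥0∞, Measurable F ∧ ∀ b, f b = ⨅ z, F (b, z)

namespace LSA

variable {B B' Z Q : Type*} [MeasurableSpace B] [MeasurableSpace B'] [MeasurableSpace Z]
  [MeasurableSpace Q]

/-- A nonempty Polish space is a continuous image of the Baire space, so any nonempty standard Borel
space may index the infimum. -/
theorem of_measurable_iInf [StandardBorelSpace Z] [Nonempty Z] {F : B × Z → ℝ≥0∞}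
    (hF : Measurable F) : LSA fun b => ⨅ z, F (b, z) := by
  let := upgradeStandardBorel Z
  obtain ⟨h, hh, hs⟩ := PolishSpace.exists_nat_nat_continuous_surjective Z
  refine ⟨fun p => F (p.1, h p.2), hF.comp (measurable_fst.prodMk (hh.measurable.comp
    measurable_snd)), fun b => ?_⟩
  exact (hs.iInf_comp fun z => F (b, z)).symm

theorem of_measurable {f : B → ℝ≥0∞} (hf : Measurable f) : LSA f :=
  ⟨fun p => f p.1, hf.comp measurable_fst, fun b => by simp⟩

theorem comp {f : B → ℝ≥0∞} (hf : LSA f) {g : B' → B} (hg : Measurable g) :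
    LSA fun b => f (g b) := by
  obtain ⟨F, hF, h⟩ := hf
  exact ⟨fun p => F (g p.1, p.2), hF.comp ((hg.comp measurable_fst).prodMk measurable_snd),
    fun b => h (g b)⟩

theorem iInf [StandardBorelSpace Z] [Nonempty Z] {f : B × Z → ℝ≥0∞} (hf : LSA f) :
    LSA fun b => ⨅ z, f (b, z) := by
  obtain ⟨F, hF, h⟩ := hf
  have := of_measurable_iInf (B := B) (Z := Z × (ℕ → ℕ)) (F := fun p => F ((p.1, p.2.1), p.2.2))
    (hF.comp (by fun_prop))
  simpa only [h, iInf_prod] using this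

theorem measurable_add {f g : B → ℝ≥0∞} (hg : Measurable g) (hf : LSA f) :
    LSA fun b => g b + f b := by
  obtain ⟨F, hF, h⟩ := hf
  refine ⟨fun p => g p.1 + F p, (hg.comp measurable_fst).add hF, fun b => ?_⟩
  simp only [h, ENNReal.add_iInf]

/-- Multiplication by `∞` does not commute with an infimum that is `0` but not attained. This is why
the factor is finite here and why densities enter `redStep` through `toNNReal`. -/
theorem measurable_mul {f g : B → ℝ≥0∞} (hg : Measurable g) (hgt : ∀ b, g b ≠ ∞) (hf : LSA f) :
    LSA fun b => g b * f b := by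
  obtain ⟨F, hF, h⟩ := hf
  refine ⟨fun p => g p.1 * F p, (hg.comp measurable_fst).mul hF, fun b => ?_⟩
  simp only [h]
  rw [ENNReal.mul_iInf fun hc => absurd hc (hgt b)]

/-- Measurable selection of almost minimizing parameters. -/
theorem exists_measurable_le_add [StandardBorelSpace B] [StandardBorelSpace Z] [Nonempty Z]
    (μ : Measure B) [SFinite μ] {F : B × Z → ℝ≥0∞} (hF : Measurable F) {ε : B → ℝ≥0∞}
    (hε : Measurable ε) (hε0 : ∀ b, 0 < ε b) :
    ∃ s : B → Z, Measurable s ∧ ∀ᵐ b ∂μ, F (b, s b) ≤ (⨅ z, F (b, z)) + ε b := by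
  -- For each rational level `q`, a parameter with value below `q` is selected where one exists. The
  -- infimum `f'` over the countably many selections is measurable and almost everywhere at most the
  -- true infimum; a good level is then selected measurably.
  have key : ∀ q : ℚ, ∃ s : B → Z, Measurable s ∧ ∀ᵐ b ∂μ,
      (∃ z, F (b, z) < ENNReal.ofReal q) → F (b, s b) < ENNReal.ofReal q := fun q =>
    exists_measurable_ae_selection μ (A := {p | F p < ENNReal.ofReal q})
      (measurableSet_lt hF measurable_const)
  choose s hs hsae using key
  let f' : B → ℝ≥0∞ := fun b => ⨅ q : ℚ, F (b, s q b)
  have hf' : Measurable f' := Measurable.iInf fun q => hF.comp (measurable_id.prodMk (hs q))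
  obtain ⟨σ, hσ, hσae⟩ := exists_measurable_ae_selection μ
    (A := {p : B × ℚ | F (p.1, s p.2 p.1) ≤ f' p.1 + ε p.1}) (by
      refine measurableSet_le (measurable_from_prod_countable_left fun q => ?_)
        ((hf'.comp measurable_fst).add (hε.comp measurable_fst))
      exact hF.comp (measurable_id.prodMk (hs q)))
  refine ⟨fun b => s (σ b) b, ?_, ?_⟩
  · exact (measurable_from_prod_countable_left (f := fun p : B × ℚ => s p.2 p.1) hs).comp
      (measurable_id.prodMk hσ)
  have hall : ∀ᵐ b ∂μ, ∀ q : ℚ, (∃ z, F (b, z) < ENNReal.ofReal q) →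
      F (b, s q b) < ENNReal.ofReal q := ae_all_iff.mpr hsae
  filter_upwards [hall, hσae] with b hb hσb
  have hle : f' b ≤ ⨅ z, F (b, z) := by
    refine le_of_forall_gt fun c hc => ?_
    obtain ⟨q, hq0, h1, h2⟩ := ENNReal.lt_iff_exists_rat_btwn.mp hc
    obtain ⟨z, hz⟩ := iInf_lt_iff.mp h1
    refine lt_of_le_of_lt (iInf_le _ q) ((hb q ⟨z, ?_⟩).trans ?_)
    · simpa [ENNReal.ofReal] using hz
    · simpa [ENNReal.ofReal] using h2
  refine le_trans (hσb ?_) (by gcongr)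
  by_cases ht : f' b = ∞
  · exact ⟨0, by simp [ht]⟩
  · obtain ⟨q, hq⟩ := iInf_lt_iff.mp (ENNReal.lt_add_right ht (hε0 b).ne')
    exact ⟨q, hq.le⟩

/-- Lower semianalytic functions are universally measurable. -/
theorem aemeasurable [StandardBorelSpace B] {f : B → ℝ≥0∞} (hf : LSA f) (μ : Measure B)
    [SFinite μ] : AEMeasurable f μ := by
  obtain ⟨F, hF, h⟩ := hf
  -- The infimum over `n` of the values at `1/(n+1)`-optimal selections is measurable and almost
  -- everywhere equal to `f`.
  have key : ∀ n : ℕ, ∃ s : B → (ℕ → ℕ), Measurable s ∧ ∀ᵐ b ∂μ,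
      F (b, s b) ≤ (⨅ z, F (b, z)) + ((n : ℝ≥0∞) + 1)⁻¹ := fun n =>
    exists_measurable_le_add μ hF (ε := fun _ => ((n : ℝ≥0∞) + 1)⁻¹) measurable_const
      fun _ => ENNReal.inv_pos.mpr (by finiteness)
  choose s hs hsae using key
  refine ⟨fun b => ⨅ n : ℕ, F (b, s n b),
    Measurable.iInf fun n => hF.comp (measurable_id.prodMk (hs n)), ?_⟩
  filter_upwards [ae_all_iff.mpr hsae] with b hb
  rw [h]
  refine le_antisymm (le_iInf fun n => iInf_le _ _) ?_
  refine ENNReal.le_of_forall_pos_le_add fun ε hε _ => ?_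
  obtain ⟨n, hn⟩ := ENNReal.exists_inv_nat_lt (a := (ε : ℝ≥0∞)) (by simpa using hε.ne')
  refine (iInf_le _ n).trans ((hb n).trans ?_)
  gcongr
  exact (ENNReal.inv_le_inv.mpr le_self_add).trans hn.le

/-- Partial integrals of lower semianalytic functions are lower semianalytic. -/
theorem lintegral [StandardBorelSpace Q] {f : B × Q → ℝ≥0∞} (hf : LSA f) (ν : Measure Q)
    [SigmaFinite ν] : LSA fun b => ∫⁻ q, f (b, q) ∂ν := by
  obtain ⟨F, hF, h⟩ := hf
  -- The integral of the infimum is the infimum over measurable selectors of the integral. The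
  -- family `Ψ` of all selectors, up to null sets, turns this into an infimum over the Baire space.
  obtain ⟨Ψ, hΨ, hΨs⟩ := exists_measurable_parametrization (Z := ℕ → ℕ) ν
  refine ⟨fun p => ∫⁻ q, F ((p.1, q), Ψ (p.2, q)) ∂ν, ?_, fun b => ?_⟩
  · exact Measurable.lintegral_prod_right' (f := fun r : (B × (ℕ → ℕ)) × Q =>
      F ((r.1.1, r.2), Ψ (r.1.2, r.2))) (by fun_prop)
  refine le_antisymm (le_iInf fun θ => lintegral_mono fun q => ?_) ?_
  · rw [h]
    exact iInf_le _ _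
  refine ENNReal.le_of_forall_pos_le_add fun ε hε _ => ?_
  -- As `ν` is only σ-finite, the tolerance has to be a positive function of small integral instead
  -- of a constant.
  obtain ⟨g, hg0, hg, hgε⟩ := exists_pos_lintegral_lt_of_sigmaFinite ν
    (ε := (ε : ℝ≥0∞)) (by simpa using hε.ne')
  obtain ⟨φ, hφ, hφae⟩ := exists_measurable_le_add ν (F := fun p : Q × (ℕ → ℕ) => F ((b, p.1), p.2))
    (hF.comp (by fun_prop)) (ε := fun q => (g q : ℝ≥0∞)) (by fun_prop)
    (fun q => by simpa using hg0 q)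
  obtain ⟨θ, hθ⟩ := hΨs φ hφ
  refine (iInf_le _ θ).trans ?_
  calc ∫⁻ q, F ((b, q), Ψ (θ, q)) ∂ν ≤ ∫⁻ q, (f (b, q) + g q) ∂ν := by
        refine lintegral_mono_ae ?_
        filter_upwards [hφae, hθ] with q h1 h2
        rw [h2, h]
        exact h1
    _ = ∫⁻ q, f (b, q) ∂ν + ∫⁻ q, (g q : ℝ≥0∞) ∂ν :=
        lintegral_add_right _ (by fun_prop)
    _ ≤ ∫⁻ q, f (b, q) ∂ν + ε := by gcongr

/-- Measurable selection of minimizing parameters, where they exist. -/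
theorem exists_measurable_minimizer [StandardBorelSpace B] [StandardBorelSpace Z] [Nonempty Z]
    (μ : Measure B) [SFinite μ] {f : B × Z → ℝ≥0∞} (hf : LSA f) :
    ∃ s : B → Z, Measurable s ∧
      ∀ᵐ b ∂μ, (∃ z, ∀ z', f (b, z) ≤ f (b, z')) → ∀ z', f (b, s b) ≤ f (b, z') := by
  obtain ⟨w, hw, hwae⟩ := hf.iInf.aemeasurable μ
  obtain ⟨F, hF, h⟩ := hf
  -- The set where `f` is at most `w`, a measurable version of the infimum, need not be Borel. It is
  -- the projection of a Borel set when a sequence of parameters that certify `f ≤ w + 1/(n+1)` is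
  -- adjoined to `z`, and the pair is selected.
  obtain ⟨s, hs, hsae⟩ := exists_measurable_ae_selection μ
    (A := {p : B × (Z × (ℕ → ℕ → ℕ)) | ∀ n : ℕ,
      F ((p.1, p.2.1), p.2.2 n) ≤ w p.1 + ((n : ℝ≥0∞) + 1)⁻¹}) (by
        have : {p : B × (Z × (ℕ → ℕ → ℕ)) | ∀ n : ℕ,
            F ((p.1, p.2.1), p.2.2 n) ≤ w p.1 + ((n : ℝ≥0∞) + 1)⁻¹} =
            ⋂ n : ℕ, {p | F ((p.1, p.2.1), p.2.2 n) ≤ w p.1 + ((n : ℝ≥0∞) + 1)⁻¹} := by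
          ext p
          simp
        rw [this]
        exact MeasurableSet.iInter fun n => measurableSet_le (by fun_prop) (by fun_prop))
  refine ⟨fun b => (s b).1, measurable_fst.comp hs, ?_⟩
  filter_upwards [hwae, hsae] with b hb hsb
  rintro ⟨z, hz⟩ z'
  have hz0 : f (b, z) ≤ w b := hb ▸ le_iInf hz
  have : ∃ y, (b, y) ∈ {p : B × (Z × (ℕ → ℕ → ℕ)) | ∀ n : ℕ,
      F ((p.1, p.2.1), p.2.2 n) ≤ w p.1 + ((n : ℝ≥0∞) + 1)⁻¹} := by
    have hy : ∀ n : ℕ, ∃ y, F ((b, z), y) ≤ w b + ((n : ℝ≥0∞) + 1)⁻¹ := by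
      intro n
      by_cases ht : w b = ∞
      · exact ⟨fun _ => 0, by simp [ht]⟩
      rw [h] at hz0
      obtain ⟨y, hy⟩ := iInf_lt_iff.mp (lt_of_le_of_lt hz0 (ENNReal.lt_add_right ht
        (ENNReal.inv_ne_zero.mpr (by finiteness : (n : ℝ≥0∞) + 1 ≠ ∞))))
      exact ⟨y, hy.le⟩
    choose y hy using hy
    exact ⟨(z, y), hy⟩
  have h2 := hsb this
  have h3 : f (b, (s b).1) ≤ w b := by
    refine ENNReal.le_of_forall_pos_le_add fun ε hε _ => ?_
    obtain ⟨n, hn⟩ := ENNReal.exists_inv_nat_lt (a := (ε : ℝ≥0∞)) (by simpa using hε.ne')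
    rw [h]
    refine (iInf_le _ _).trans ((h2 n).trans ?_)
    gcongr
    exact (ENNReal.inv_le_inv.mpr le_self_add).trans hn.le
  exact h3.trans (hb ▸ iInf_le _ z')

/-- Measurable selection of almost minimizing parameters. -/
theorem exists_measurable_le_iInf_add [StandardBorelSpace B] [StandardBorelSpace Z] [Nonempty Z]
    (μ : Measure B) [SFinite μ] {f : B × Z → ℝ≥0∞} (hf : LSA f) {ε : ℝ≥0∞} (hε : 0 < ε) :
    ∃ s : B → Z, Measurable s ∧ ∀ᵐ b ∂μ, f (b, s b) ≤ (⨅ z, f (b, z)) + ε := by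
  obtain ⟨F, hF, h⟩ := hf
  obtain ⟨s, hs, hsae⟩ := exists_measurable_le_add (Z := Z × (ℕ → ℕ)) μ
    (F := fun p => F ((p.1, p.2.1), p.2.2)) (hF.comp (by fun_prop)) (ε := fun _ => ε)
    measurable_const fun _ => hε
  refine ⟨fun b => (s b).1, measurable_fst.comp hs, ?_⟩
  filter_upwards [hsae] with b hb
  simp only [h]
  rw [iInf_prod] at hb
  exact (iInf_le _ _).trans hb

/-- It is enough to consider families that are parametrized by the real line. -/
theorem exists_measurable_leftInverse_real (B : Type*) [MeasurableSpace B] [StandardBorelSpace B]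
    [Nonempty B] : ∃ (e : B → ℝ) (d : ℝ → B), Measurable e ∧ Measurable d ∧ ∀ b, d (e b) = b := by
  obtain ⟨e, he⟩ := exists_measurableEmbedding_real B
  obtain ⟨d, hd, hde⟩ := he.exists_measurable_extend (measurable_id (α := B)) fun _ => inferInstance
  exact ⟨e, d, he.measurable, hd, fun b => congrFun hde b⟩

end LSA

end DelayedSharing

namespace DelayedSharing

open scoped NNReal

/-! ### Extended-real expectations of functions that are bounded below -/

/-- The extended real number `x - C`. -/
noncomputable def shift (C : ℝ≥0) (x : ℝ≥0∞) : EReal := (x : EReal) - ((C : ℝ≥0∞) : EReal)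

theorem shift_coe (C x : ℝ≥0) : shift C x = (((x : ℝ) - (C : ℝ) : ℝ) : EReal) := rfl

theorem shift_top (C : ℝ≥0) : shift C ∞ = ⊤ := rfl

theorem toENNReal_shift (C : ℝ≥0) (x : ℝ≥0∞) : (shift C x).toENNReal = x - C := by
  induction x with
  | top => simp [shift_top]
  | coe x =>
    rw [shift_coe, EReal.toENNReal_of_ne_top (EReal.coe_ne_top _), EReal.toReal_coe,
      ENNReal.ofReal_sub _ C.coe_nonneg]
    simp

theorem toENNReal_neg_shift (C : ℝ≥0) (x : ℝ≥0∞) : (-shift C x).toENNReal = C - x := by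
  induction x with
  | top => simp [shift_top]
  | coe x =>
    rw [shift_coe, ← EReal.coe_neg, EReal.toENNReal_of_ne_top (EReal.coe_ne_top _),
      EReal.toReal_coe, neg_sub, ENNReal.ofReal_sub _ x.coe_nonneg]
    simp

theorem measurable_shift (C : ℝ≥0) : Measurable (shift C) :=
  (measurable_coe_ennreal_ereal).sub measurable_const

/-- The additive form suits positive and negative parts, of which only the subtracted ones are known
to be finite. -/
theorem coe_sub_coe_eq {a b x c : ℝ≥0∞} (hb : b ≠ ∞) (hc : c ≠ ∞) (h : x + b = a + c) :
    (a : EReal) - (b : EReal) = (x : EReal) - (c : EReal) := by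
  lift b to ℝ≥0 using hb
  lift c to ℝ≥0 using hc
  induction a with
  | top =>
    have : x = ∞ := by simpa using h
    subst this
    rfl
  | coe a =>
    induction x with
    | top =>
      rw [top_add, ← ENNReal.coe_add] at h
      exact absurd h.symm ENNReal.coe_ne_top
    | coe x =>
      have h' : (x : ℝ) + b = a + c := by exact_mod_cast h
      change (((a : ℝ) - (b : ℝ) : ℝ) : EReal) = (((x : ℝ) - (c : ℝ) : ℝ) : EReal)
      rw [show (a : ℝ) - b = x - c by linarith]

theorem shift_le_shift {C : ℝ≥0} {x y : ℝ≥0∞} : shift C x ≤ shift C y ↔ x ≤ y := by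
  induction y with
  | top => simp [shift_top]
  | coe y =>
    induction x with
    | top =>
      rw [shift_top, shift_coe]
      exact ⟨fun h => absurd (top_le_iff.mp h) (EReal.coe_ne_top _),
        fun h => absurd (top_le_iff.mp h) ENNReal.coe_ne_top⟩
    | coe x =>
      rw [shift_coe, shift_coe, EReal.coe_le_coe_iff, ENNReal.coe_le_coe, sub_le_sub_iff_right,
        NNReal.coe_le_coe]

theorem shift_injective (C : ℝ≥0) : Function.Injective (shift C) := fun _ _ h =>
  le_antisymm (shift_le_shift.mp h.le) (shift_le_shift.mp h.ge)

theorem shift_add_shift (C C' : ℝ≥0) (x y : ℝ≥0∞) :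
    shift C x + shift C' y = shift (C + C') (x + y) := by
  induction x with
  | top =>
    rw [shift_top, top_add, shift_top]
    induction y with
    | top => rfl
    | coe y => rw [shift_coe]; rfl
  | coe x =>
    induction y with
    | top => rw [shift_top, add_top, shift_top, shift_coe]; rfl
    | coe y =>
      rw [shift_coe, shift_coe, ← ENNReal.coe_add, shift_coe, ← EReal.coe_add]
      congr 1
      push_cast
      ring

/-- The entrance from costs that are bounded below to functions with values in `[0, ∞]`. -/
theorem exists_shift_of_le {C : ℝ≥0} {a : EReal} (h : ((-(C : ℝ) : ℝ) : EReal) ≤ a) :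
    shift C (a + (C : ℝ)).toENNReal = a := by
  induction a with
  | bot => simp at h
  | top => simp [shift_top]
  | coe a =>
    have h' : -(C : ℝ) ≤ a := by exact_mod_cast h
    rw [← EReal.coe_add, EReal.toENNReal_of_ne_top (EReal.coe_ne_top _), EReal.toReal_coe,
      ENNReal.ofReal_eq_coe_nnreal (by linarith), shift_coe]
    simp

/-- An order embedding need not preserve infima. Here the infimum of the shifted values is still at
least `-C`, hence itself a shifted value. -/
theorem shift_iInf {ι : Type*} [Nonempty ι] (C : ℝ≥0) (f : ι → ℝ≥0∞) :
    shift C (⨅ i, f i) = ⨅ i, shift C (f i) := by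
  refine le_antisymm (le_iInf fun i => shift_le_shift.mpr (iInf_le _ i)) ?_
  have hb : ((-(C : ℝ) : ℝ) : EReal) ≤ ⨅ i, shift C (f i) := by
    refine le_iInf fun i => ?_
    have : shift C 0 ≤ shift C (f i) := shift_le_shift.mpr bot_le
    refine le_trans (le_of_eq ?_) this
    change _ = shift C ((0 : ℝ≥0) : ℝ≥0∞)
    rw [shift_coe]
    simp
  rw [← exists_shift_of_le hb, shift_le_shift]
  refine le_iInf fun i => ?_
  rw [← shift_le_shift (C := C), exists_shift_of_le hb]
  exact iInf_le _ i

variable {Ω β : Type*} [MeasurableSpace Ω] [MeasurableSpace β]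

theorem expect_congr {μ : Measure Ω} {φ ψ : Ω → EReal} (h : φ =ᵐ[μ] ψ) :
    expect μ φ = expect μ ψ := by
  unfold expect extInt
  congr 2
  · exact lintegral_congr_ae (h.mono fun ω hω => by simp only [hω])
  · exact lintegral_congr_ae (h.mono fun ω hω => by simp only [hω])

/-- With truncated subtraction, `f + (C - f) = (f - C) + C`, both sides being `max f C`. The
negative part `C - f` is at most `C`, hence of finite integral, so integrating and subtracting is
legitimate even if `f` is not integrable. -/
theorem expect_shift (μ : Measure Ω) [IsFiniteMeasure μ] (C : ℝ≥0) {f : Ω → ℝ≥0∞}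
    (hf : AEMeasurable f μ) : expect μ (fun ω => shift C (f ω)) =
      ((∫⁻ ω, f ω ∂μ : ℝ≥0∞) : EReal) - ((C * μ Set.univ : ℝ≥0∞) : EReal) := by
  unfold expect extInt
  simp only [toENNReal_shift, toENNReal_neg_shift]
  refine coe_sub_coe_eq ?_ (by finiteness) ?_
  · refine ne_top_of_le_ne_top (b := ∫⁻ _, C ∂μ) ?_ (lintegral_mono fun ω => tsub_le_self)
    rw [lintegral_const]
    finiteness
  · rw [← lintegral_const, ← lintegral_add_left' hf, ← lintegral_add_right _ measurable_const]
    refine lintegral_congr fun ω => ?_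
    rw [add_tsub_eq_max, tsub_add_eq_max]

theorem expect_shift_of_isProbabilityMeasure (μ : Measure Ω) [IsProbabilityMeasure μ] (C : ℝ≥0)
    {f : Ω → ℝ≥0∞} (hf : AEMeasurable f μ) :
    expect μ (fun ω => shift C (f ω)) = shift C (∫⁻ ω, f ω ∂μ) := by
  rw [expect_shift μ C hf]
  simp [shift]

theorem expect_indicator (P : Measure Ω) {S : Set Ω} (hS : MeasurableSet S) (Z : Ω → EReal) :
    expect P (S.indicator Z) = expect (P.restrict S) Z := by
  unfold expect extInt
  beta_reduce
  rw [← lintegral_indicator hS, ← lintegral_indicator hS]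
  congr 3 <;>
  · funext ω
    by_cases h : ω ∈ S <;> simp [h]

theorem isCondExp_of_shift {P : Measure Ω} [IsFiniteMeasure P] {ι : Ω → β} (hι : Measurable ι)
    {C : ℝ≥0} {Z : Ω → EReal} {j : β → EReal} {Z' : Ω → ℝ≥0∞} {j' : β → ℝ≥0∞}
    (hZ' : AEMeasurable Z' P) (hj' : AEMeasurable j' (P.map ι))
    (hZ : Z =ᵐ[P] fun ω => shift C (Z' ω)) (hj : ∀ᵐ ω ∂P, j (ι ω) = shift C (j' (ι ω)))
    (hjm : AEMeasurable j (P.map ι))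
    (h : ∀ A, MeasurableSet A → ∫⁻ ω in ι ⁻¹' A, Z' ω ∂P = ∫⁻ ω in ι ⁻¹' A, j' (ι ω) ∂P) :
    IsCondExp P ι Z j := by
  refine ⟨hjm, fun A hA => ?_⟩
  rw [expect_indicator P (hι hA), expect_indicator P (hι hA),
    expect_congr (ae_restrict_of_ae hZ), expect_congr (ae_restrict_of_ae hj),
    expect_shift _ _ hZ'.restrict, h A hA]
  exact (expect_shift _ _ (hj'.comp_measurable hι).restrict).symm

/-- A version `j` of the conditional expectation of a variable that is at least `-C` is itself
almost surely at least `-C`. Otherwise its negative part would integrate to more than `C` times the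
probability of the event `j < -C`, while the expectation of `Z` over this event is at least the
negative of that number. Then `j` is a shift, and finite constants cancel. -/
theorem IsCondExp.exists_shift {P : Measure Ω} [IsFiniteMeasure P] {ι : Ω → β}
    (hι : Measurable ι) {C : ℝ≥0} {Z : Ω → EReal} {j : β → EReal} {Z' : Ω → ℝ≥0∞}
    (hZ' : AEMeasurable Z' P) (hZ : Z =ᵐ[P] fun ω => shift C (Z' ω)) (h : IsCondExp P ι Z j) :
    ∃ j' : β → ℝ≥0∞, Measurable j' ∧ (∀ᵐ ω ∂P, j (ι ω) = shift C (j' (ι ω))) ∧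
      ∀ A, MeasurableSet A → ∫⁻ ω in ι ⁻¹' A, Z' ω ∂P = ∫⁻ ω in ι ⁻¹' A, j' (ι ω) ∂P := by
  obtain ⟨⟨j0, hj0, hjj0⟩, h⟩ := h
  have hjj : ∀ᵐ ω ∂P, j (ι ω) = j0 (ι ω) := ae_of_ae_map hι.aemeasurable hjj0
  have hE : ∀ A, MeasurableSet A → expect (P.restrict (ι ⁻¹' A)) (fun ω => j0 (ι ω)) =
      ((∫⁻ ω in ι ⁻¹' A, Z' ω ∂P : ℝ≥0∞) : EReal) - ((C * P (ι ⁻¹' A) : ℝ≥0∞) : EReal) := by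
    intro A hA
    have h1 := h A hA
    rw [expect_indicator P (hι hA), expect_indicator P (hι hA),
      expect_congr (ae_restrict_of_ae hZ), expect_congr (ae_restrict_of_ae hjj),
      expect_shift _ _ hZ'.restrict] at h1
    rw [← h1]
    simp
  let N : Set β := {b | j0 b < ((-(C : ℝ) : ℝ) : EReal)}
  have hN : MeasurableSet N := measurableSet_lt hj0 measurable_const
  have hlow : ∀ᵐ ω ∂P, ((-(C : ℝ) : ℝ) : EReal) ≤ j0 (ι ω) := by
    suffices hP : P (ι ⁻¹' N) = 0 by
      filter_upwards [measure_eq_zero_iff_ae_notMem.mp hP] with ω hω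
      exact not_lt.mp hω
    by_contra hP
    have h1 := hE N hN
    unfold expect extInt at h1
    beta_reduce at h1
    have hneg : ∀ᵐ ω ∂P.restrict (ι ⁻¹' N), (j0 (ι ω)).toENNReal = 0 := by
      filter_upwards [ae_restrict_mem (hι hN)] with ω hω
      refine EReal.toENNReal_of_nonpos (le_of_lt (lt_of_lt_of_le hω ?_))
      exact_mod_cast neg_nonpos.mpr C.2
    have hposs : ∀ᵐ ω ∂P.restrict (ι ⁻¹' N), (C : ℝ≥0∞) < (-j0 (ι ω)).toENNReal := by
      filter_upwards [ae_restrict_mem (hι hN)] with ω hω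
      have hω' : j0 (ι ω) < ((-(C : ℝ) : ℝ) : EReal) := hω
      have : ((C : ℝ) : EReal) < -j0 (ι ω) := by
        rw [EReal.lt_neg_comm]
        exact_mod_cast hω'
      by_cases ht : -j0 (ι ω) = ⊤
      · simp [ht]
      rw [EReal.toENNReal_of_ne_top ht]
      have hb : -j0 (ι ω) ≠ ⊥ := ne_bot_of_gt this
      lift -j0 (ι ω) to ℝ using ⟨ht, hb⟩ with r
      rw [EReal.toReal_coe]
      have h' : (C : ℝ) < r := by exact_mod_cast this
      rw [← ENNReal.ofReal_coe_nnreal]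
      exact (ENNReal.ofReal_lt_ofReal_iff (lt_of_le_of_lt C.2 h')).mpr h'
    rw [lintegral_congr_ae hneg, lintegral_zero] at h1
    have hlt : ∫⁻ ω, (C : ℝ≥0∞) ∂P.restrict (ι ⁻¹' N) <
        ∫⁻ ω, (-j0 (ι ω)).toENNReal ∂P.restrict (ι ⁻¹' N) := by
      refine lintegral_strict_mono ?_ ?_ ?_ hposs
      · rwa [ne_eq, Measure.restrict_eq_zero]
      · exact (measurable_ereal_toENNReal.comp (hj0.comp hι).neg).aemeasurable
      · rw [lintegral_const]
        finiteness
    rw [lintegral_const, Measure.restrict_apply_univ] at hlt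
    set y := ∫⁻ ω, (-j0 (ι ω)).toENNReal ∂P.restrict (ι ⁻¹' N)
    set x := ∫⁻ ω in ι ⁻¹' N, Z' ω ∂P
    have h2 : -((C * P (ι ⁻¹' N) : ℝ≥0∞) : EReal) ≤ -(y : EReal) := by
      have : -(y : EReal) = (x : EReal) - ((C * P (ι ⁻¹' N) : ℝ≥0∞) : EReal) := by
        rw [← h1]
        simp
      rw [this, sub_eq_add_neg]
      exact le_add_of_nonneg_left (EReal.coe_ennreal_nonneg x)
    rw [EReal.neg_le_neg_iff, EReal.coe_ennreal_le_coe_ennreal_iff] at h2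
    exact absurd h2 hlt.not_ge
  refine ⟨fun b => (j0 b + (C : ℝ)).toENNReal,
    measurable_ereal_toENNReal.comp (hj0.add measurable_const), ?_, ?_⟩
  · filter_upwards [hjj, hlow] with ω h1 h2
    rw [h1, exists_shift_of_le h2]
  · intro A hA
    have hj' : Measurable fun ω => (j0 (ι ω) + (C : ℝ)).toENNReal :=
      measurable_ereal_toENNReal.comp ((hj0.comp hι).add measurable_const)
    have h1 := hE A hA
    have h2 : (fun ω => j0 (ι ω)) =ᵐ[P.restrict (ι ⁻¹' A)]
        fun ω => shift C (j0 (ι ω) + (C : ℝ)).toENNReal :=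
      ae_restrict_of_ae (hlow.mono fun ω hω => (exists_shift_of_le hω).symm)
    rw [expect_congr h2, expect_shift _ _ hj'.aemeasurable, Measure.restrict_apply_univ] at h1
    have hfin : (C * P (ι ⁻¹' A) : ℝ≥0∞) ≠ ∞ := by finiteness
    lift (C * P (ι ⁻¹' A) : ℝ≥0∞) to ℝ≥0 using hfin with D
    exact (shift_injective D h1).symm

/-- Conditional expectations of nonnegative functions exist. -/
theorem exists_setLIntegral_comp_eq {P : Measure Ω} [IsFiniteMeasure P] {ι : Ω → β}
    (hι : Measurable ι) {Z' : Ω → ℝ≥0∞} (hZ' : Measurable Z') :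
    ∃ j' : β → ℝ≥0∞, Measurable j' ∧
      ∀ A, MeasurableSet A → ∫⁻ ω in ι ⁻¹' A, Z' ω ∂P = ∫⁻ ω in ι ⁻¹' A, j' (ι ω) ∂P := by
  -- The mean of the regular conditional distribution; no integrability of `Z'` is needed.
  refine ⟨fun b => ∫⁻ z, z ∂(condDistrib Z' ι P b), ?_, fun A hA => ?_⟩
  · exact Measurable.lintegral_kernel measurable_id
  · have h1 : P.map (fun ω => (ι ω, Z' ω)) = P.map ι ⊗ₘ condDistrib Z' ι P :=
      (compProd_map_condDistrib hZ'.aemeasurable).symm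
    have hF : Measurable fun p : β × ℝ≥0∞ => A.indicator (fun _ => (1 : ℝ≥0∞)) p.1 * p.2 :=
      ((measurable_one.indicator hA).comp measurable_fst).mul measurable_snd
    have h2 : ∫⁻ p, A.indicator (fun _ => (1 : ℝ≥0∞)) p.1 * p.2 ∂(P.map fun ω => (ι ω, Z' ω)) =
        ∫⁻ ω in ι ⁻¹' A, Z' ω ∂P := by
      rw [lintegral_map hF (hι.prodMk hZ'), ← lintegral_indicator (hι hA)]
      refine lintegral_congr fun ω => ?_
      by_cases h : ι ω ∈ A <;> simp [h, Set.indicator, Set.mem_preimage]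
    rw [← h2, h1, Measure.lintegral_compProd hF, lintegral_map (by
      exact Measurable.lintegral_kernel_prod_right' hF) hι, ← lintegral_indicator (hι hA)]
    refine lintegral_congr fun ω => ?_
    by_cases h : ι ω ∈ A
    · simp [h]
    · simp [h]

end DelayedSharing

namespace DelayedSharing

namespace Model

open scoped NNReal

variable {K : ℕ} (M : Model K) (k : Fin K) (t : ℕ)

/-! ### Observations and actions of the other players -/

/-- The observations in `λ_t^{-k}`. -/
abbrev OObs := ∀ j : {j : Fin K // j ≠ k}, ∀ s : ObsWin M.n t, M.Y s j

/-- The actions in `λ_t^{-k}`. -/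
abbrev OAct := ∀ j : {j : Fin K // j ≠ k}, ∀ s : ActWin M.n t, M.U s j

/-- The observations of time `t` of the players other than `k`. -/
abbrev NObs := ∀ j : {j : Fin K // j ≠ k}, M.Y t j

/-- The times whose data are shared at time `t + 1`: there is at most one. -/
abbrev OldWin (n t : ℕ) := {s : ℕ // s ∈ (Finset.range (t + 1)).filter fun s => s + n = t + 1}

/-- The observations of the other players that are shared at time `t + 1`. -/
abbrev Old := ∀ j : {j : Fin K // j ≠ k}, ∀ s : OldWin M.n t, M.Y s j

/-- The reference measure on `OObs`. -/
noncomputable abbrev νO : Measure (M.OObs k t) :=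
  Measure.pi fun j : {j : Fin K // j ≠ k} => Measure.pi fun s : ObsWin M.n t => M.νY s j

/-- The reference measure on `NObs`. -/
noncomputable abbrev νN : Measure (M.NObs k t) :=
  Measure.pi fun j : {j : Fin K // j ≠ k} => M.νY t j

/-- The reference measure on `Old`. -/
noncomputable abbrev νOld : Measure (M.Old k t) :=
  Measure.pi fun j : {j : Fin K // j ≠ k} => Measure.pi fun s : OldWin M.n t => M.νY s j

variable {M k t}

/-- The data that are shared at time `t + 1`. -/
def oldObs (a : M.OObs k t) : M.Old k t := fun j s =>
  a j ⟨s.1, by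
    have h := Finset.mem_filter.mp s.2
    exact Finset.mem_filter.mpr ⟨h.1, by omega⟩⟩

/-- The observations of time `t` recovered from those of time `t + 1` and from the shared ones. -/
def merge (o : M.Old k t) (a : M.OObs k (t + 1)) : M.OObs k t := fun j s =>
  have hs := Finset.mem_range.mp (Finset.mem_filter.mp s.2).1
  have hs' := (Finset.mem_filter.mp s.2).2
  if h : t + 1 < s.1 + M.n then
    a j ⟨s.1, Finset.mem_filter.mpr ⟨Finset.mem_range.mpr (by omega), h⟩⟩
  else o j ⟨s.1, Finset.mem_filter.mpr ⟨Finset.mem_range.mpr hs, by omega⟩⟩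

/-- The newest observations. -/
def newest (a : M.OObs k (t + 1)) : M.NObs k (t + 1) := fun j =>
  a j ⟨t + 1, Finset.mem_filter.mpr ⟨Finset.mem_range.mpr (by omega), by
    have := M.one_le_n; omega⟩⟩

theorem measurable_cast_family {ι : Type*} {β : ι → Type*} [∀ i, MeasurableSpace (β i)] {i j : ι}
    (h : i = j) : Measurable fun y : β i => (h ▸ y : β j) := by
  subst h
  exact measurable_id

theorem measurable_oldObs : Measurable (oldObs : M.OObs k t → M.Old k t) := by
  unfold oldObs
  fun_prop

theorem measurable_newest : Measurable (newest : M.OObs k (t + 1) → M.NObs k (t + 1)) := by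
  unfold newest
  fun_prop

theorem measurable_merge :
    Measurable fun p : M.Old k t × M.OObs k (t + 1) => merge p.1 p.2 := by
  refine measurable_pi_iff.mpr fun j => measurable_pi_iff.mpr fun s => ?_
  unfold merge
  by_cases h : t + 1 < s.1 + M.n
  · simp only [h, dite_true]
    fun_prop
  · simp only [h, dite_false]
    fun_prop

/-! ### Splitting the reference measures -/

theorem prod_window {S S₁ S₂ : Finset ℕ} (h₁ : S₁ ⊆ S) (h₂ : S₂ ⊆ S) (hd : Disjoint S₁ S₂)
    (hu : ∀ s ∈ S, s ∈ S₁ ∨ s ∈ S₂) (r : {s // s ∈ S} → ℝ≥0∞) :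
    ∏ s : {s // s ∈ S}, r s =
      (∏ s : {s // s ∈ S₁}, r ⟨s.1, h₁ s.2⟩) * ∏ s : {s // s ∈ S₂}, r ⟨s.1, h₂ s.2⟩ := by
  classical
  let r' : ℕ → ℝ≥0∞ := fun s => if h : s ∈ S then r ⟨s, h⟩ else 1
  have e : ∀ (S' : Finset ℕ) (h' : S' ⊆ S), ∏ s : {s // s ∈ S'}, r ⟨s.1, h' s.2⟩ = ∏ s ∈ S', r' s := by
    intro S' h'
    rw [← Finset.prod_coe_sort S' r']
    refine Finset.prod_congr rfl fun s _ => ?_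
    simp [r', h' s.2]
  have hS : S = S₁.disjUnion S₂ hd := by
    ext s
    rw [Finset.mem_disjUnion]
    exact ⟨hu s, fun h => h.elim (fun h => h₁ h) fun h => h₂ h⟩
  have h0 := e S (Finset.Subset.refl S)
  rw [e S₁ h₁, e S₂ h₂, ← Finset.prod_disjUnion hd, ← hS]
  exact h0

variable (M t) in
/-- The times of `ObsWin M.n t` and `t + 1`. -/
abbrev BigWin := {s : ℕ // s ∈ (Finset.range (t + 2)).filter fun s => t < s + M.n}

variable (M k t) in
/-- All the observations that are private at time `t` or become available at time `t + 1`. -/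
abbrev Big := ∀ p : {j : Fin K // j ≠ k} × BigWin M t, M.Y p.2 p.1

/-- Joining the private observations of time `t` and those of time `t + 1`. -/
def joinNew (p : M.OObs k t × M.NObs k (t + 1)) : Big M k t := fun q =>
  have hs := Finset.mem_range.mp (Finset.mem_filter.mp q.2.2).1
  if h : q.2.1 ≤ t then
    p.1 q.1 ⟨q.2.1, Finset.mem_filter.mpr ⟨Finset.mem_range.mpr (by omega),
      (Finset.mem_filter.mp q.2.2).2⟩⟩
  else (show t + 1 = q.2.1 by omega) ▸ p.2 q.1

/-- Joining the observations that are shared at time `t + 1` and those that remain private. -/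
def joinOld (p : M.Old k t × M.OObs k (t + 1)) : Big M k t := fun q =>
  have hs := Finset.mem_range.mp (Finset.mem_filter.mp q.2.2).1
  have hs' := (Finset.mem_filter.mp q.2.2).2
  have hn := M.one_le_n
  if h : t + 1 < q.2.1 + M.n then
    p.2 q.1 ⟨q.2.1, Finset.mem_filter.mpr ⟨Finset.mem_range.mpr hs, h⟩⟩
  else p.1 q.1 ⟨q.2.1, Finset.mem_filter.mpr ⟨Finset.mem_range.mpr (by omega), by omega⟩⟩

/-- The inverse of `joinNew`. -/
def splitNew (b : Big M k t) : M.OObs k t × M.NObs k (t + 1) :=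
  (fun j s => b (j, ⟨s.1, by
    have h := Finset.mem_filter.mp s.2
    have h' := Finset.mem_range.mp h.1
    exact Finset.mem_filter.mpr ⟨Finset.mem_range.mpr (by omega), h.2⟩⟩),
  fun j => b (j, ⟨t + 1, Finset.mem_filter.mpr ⟨Finset.mem_range.mpr (by omega), by omega⟩⟩))

theorem splitNew_joinNew (p : M.OObs k t × M.NObs k (t + 1)) : splitNew (joinNew p) = p := by
  refine Prod.ext ?_ ?_
  · funext j s
    have hs := Finset.mem_range.mp (Finset.mem_filter.mp s.2).1
    have h : s.1 ≤ t := by omega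
    simp only [splitNew, joinNew, h, dite_true]
  · funext j
    have h : ¬ t + 1 ≤ t := by omega
    simp only [splitNew, joinNew, h, dite_false]

theorem splitNew_joinOld (p : M.Old k t × M.OObs k (t + 1)) :
    splitNew (joinOld p) = (merge p.1 p.2, newest p.2) := by
  refine Prod.ext rfl ?_
  funext j
  have h : t + 1 < t + 1 + M.n := by
    have := M.one_le_n
    omega
  simp only [splitNew, joinOld, h, dite_true]
  rfl

theorem measurable_splitNew :
    Measurable (splitNew : Big M k t → M.OObs k t × M.NObs k (t + 1)) := by
  unfold splitNew
  fun_prop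

theorem measurable_joinNew :
    Measurable (joinNew : M.OObs k t × M.NObs k (t + 1) → Big M k t) := by
  refine measurable_pi_iff.mpr fun q => ?_
  unfold joinNew
  by_cases h : q.2.1 ≤ t
  · simp only [h, dite_true]
    fun_prop
  · simp only [h, dite_false]
    exact (measurable_cast_family (β := fun s => M.Y s q.1) _).comp
      ((measurable_pi_apply _).comp measurable_snd)

theorem measurable_joinOld :
    Measurable (joinOld : M.Old k t × M.OObs k (t + 1) → Big M k t) := by
  refine measurable_pi_iff.mpr fun q => ?_
  unfold joinOld
  by_cases h : t + 1 < q.2.1 + M.n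
  · simp only [h, dite_true]
    fun_prop
  · simp only [h, dite_false]
    fun_prop

theorem joinNew_preimage (R : ∀ q : {j : Fin K // j ≠ k} × BigWin M t, Set (M.Y q.2 q.1)) :
    joinNew ⁻¹' Set.univ.pi R =
      (Set.univ.pi fun j => Set.univ.pi fun s : ObsWin M.n t => R (j, ⟨s.1, by
        have h := Finset.mem_filter.mp s.2
        have h' := Finset.mem_range.mp h.1
        exact Finset.mem_filter.mpr ⟨Finset.mem_range.mpr (by omega), h.2⟩⟩)) ×ˢ
      (Set.univ.pi fun j => R (j, ⟨t + 1, Finset.mem_filter.mpr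
        ⟨Finset.mem_range.mpr (by omega), by omega⟩⟩)) := by
  ext ⟨a, y⟩
  simp only [Set.mem_preimage, Set.mem_univ_pi, Set.mem_prod]
  constructor
  · intro H
    constructor
    · intro j s
      have hs := Finset.mem_range.mp (Finset.mem_filter.mp s.2).1
      have h : s.1 ≤ t := by omega
      have := H (j, ⟨s.1, Finset.mem_filter.mpr ⟨Finset.mem_range.mpr (by omega),
        (Finset.mem_filter.mp s.2).2⟩⟩)
      simpa only [joinNew, h, dite_true] using this
    · intro j
      have h : ¬ t + 1 ≤ t := by omega
      have := H (j, ⟨t + 1, Finset.mem_filter.mpr ⟨Finset.mem_range.mpr (by omega), by omega⟩⟩)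
      simpa only [joinNew, h, dite_false] using this
  · rintro ⟨h1, h2⟩ ⟨j, s, hs⟩
    by_cases h : s ≤ t
    · simp only [joinNew, h, dite_true]
      exact h1 j ⟨s, _⟩
    · have hs' := Finset.mem_range.mp (Finset.mem_filter.mp hs).1
      obtain rfl : t + 1 = s := by omega
      simp only [joinNew, h, dite_false]
      exact h2 j

theorem joinOld_preimage (R : ∀ q : {j : Fin K // j ≠ k} × BigWin M t, Set (M.Y q.2 q.1)) :
    joinOld ⁻¹' Set.univ.pi R =
      (Set.univ.pi fun j => Set.univ.pi fun s : OldWin M.n t => R (j, ⟨s.1, by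
        have h := Finset.mem_filter.mp s.2
        have h' := Finset.mem_range.mp h.1
        exact Finset.mem_filter.mpr ⟨Finset.mem_range.mpr (by omega), by omega⟩⟩)) ×ˢ
      (Set.univ.pi fun j => Set.univ.pi fun s : ObsWin M.n (t + 1) => R (j, ⟨s.1, by
        have h := Finset.mem_filter.mp s.2
        exact Finset.mem_filter.mpr ⟨h.1, by omega⟩⟩)) := by
  ext ⟨o, a⟩
  simp only [Set.mem_preimage, Set.mem_univ_pi, Set.mem_prod]
  constructor
  · intro H
    constructor
    · intro j s
      have hs := Finset.mem_range.mp (Finset.mem_filter.mp s.2).1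
      have hs' := (Finset.mem_filter.mp s.2).2
      have h : ¬ t + 1 < s.1 + M.n := by omega
      have := H (j, ⟨s.1, Finset.mem_filter.mpr ⟨Finset.mem_range.mpr (by omega), by omega⟩⟩)
      simpa only [joinOld, h, dite_false] using this
    · intro j s
      have hs := Finset.mem_filter.mp s.2
      have := H (j, ⟨s.1, Finset.mem_filter.mpr ⟨hs.1, by omega⟩⟩)
      simpa only [joinOld, hs.2, dite_true] using this
  · rintro ⟨h1, h2⟩ ⟨j, s, hs⟩
    by_cases h : t + 1 < s + M.n
    · simp only [joinOld, h, dite_true]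
      exact h2 j ⟨s, _⟩
    · simp only [joinOld, h, dite_false]
      exact h1 j ⟨s, _⟩

/-- Each observation of a time `s ≤ t + 1` with `t < s + n` occurs exactly once in either joining.
Both images are the same product measure, as is checked on boxes; comparing them gives the change of
variables. -/
theorem map_joinNew : ((M.νO k t).prod (M.νN k (t + 1))).map joinNew =
    Measure.pi fun q : {j : Fin K // j ≠ k} × BigWin M t => M.νY q.2 q.1 := by
  symm
  refine Measure.pi_eq fun R hR => ?_
  rw [Measure.map_apply measurable_joinNew (MeasurableSet.univ_pi hR), joinNew_preimage,
    Measure.prod_prod, Measure.pi_pi, Measure.pi_pi, Fintype.prod_prod_type,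
    ← Finset.prod_mul_distrib]
  refine Finset.prod_congr rfl fun j _ => ?_
  rw [Measure.pi_pi, prod_window (S := (Finset.range (t + 2)).filter fun s => t < s + M.n)
    (S₁ := (Finset.range (t + 1)).filter fun s => t < s + M.n)
    (S₂ := {t + 1})]
  rotate_left
  · intro s hs
    have h := Finset.mem_filter.mp hs
    have h' := Finset.mem_range.mp h.1
    exact Finset.mem_filter.mpr ⟨Finset.mem_range.mpr (by omega), h.2⟩
  · intro s hs
    rw [Finset.mem_singleton] at hs
    exact Finset.mem_filter.mpr ⟨Finset.mem_range.mpr (by omega), by omega⟩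
  · rw [Finset.disjoint_singleton_right]
    intro h
    have h' := Finset.mem_range.mp (Finset.mem_filter.mp h).1
    omega
  · intro s hs
    have h := Finset.mem_filter.mp hs
    have h' := Finset.mem_range.mp h.1
    by_cases hst : s = t + 1
    · exact Or.inr (Finset.mem_singleton.mpr hst)
    · exact Or.inl (Finset.mem_filter.mpr ⟨Finset.mem_range.mpr (by omega), h.2⟩)
  · congr 1
    symm
    have : Subsingleton {s // s ∈ ({t + 1} : Finset ℕ)} :=
      ⟨fun a b => Subtype.ext ((Finset.mem_singleton.mp a.2).trans
        (Finset.mem_singleton.mp b.2).symm)⟩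
    exact Fintype.prod_subsingleton _ (⟨t + 1, Finset.mem_singleton_self _⟩ :
      {s // s ∈ ({t + 1} : Finset ℕ)})

/-- Only the time `t + 1 - n` becomes shared. If it is negative, the factor of the shared
observations is a unit mass on a one-point space. -/
theorem map_joinOld : ((M.νOld k t).prod (M.νO k (t + 1))).map joinOld =
    Measure.pi fun q : {j : Fin K // j ≠ k} × BigWin M t => M.νY q.2 q.1 := by
  have hn := M.one_le_n
  symm
  refine Measure.pi_eq fun R hR => ?_
  rw [Measure.map_apply measurable_joinOld (MeasurableSet.univ_pi hR), joinOld_preimage,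
    Measure.prod_prod, Measure.pi_pi, Measure.pi_pi, Fintype.prod_prod_type,
    ← Finset.prod_mul_distrib]
  refine Finset.prod_congr rfl fun j _ => ?_
  rw [Measure.pi_pi, Measure.pi_pi,
    prod_window (S := (Finset.range (t + 2)).filter fun s => t < s + M.n)
    (S₁ := (Finset.range (t + 1)).filter fun s => s + M.n = t + 1)
    (S₂ := (Finset.range (t + 1 + 1)).filter fun s => t + 1 < s + M.n)]
  · intro s hs
    have h := Finset.mem_filter.mp hs
    have h' := Finset.mem_range.mp h.1
    exact Finset.mem_filter.mpr ⟨Finset.mem_range.mpr (by omega), by omega⟩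
  · intro s hs
    have h := Finset.mem_filter.mp hs
    exact Finset.mem_filter.mpr ⟨h.1, by omega⟩
  · rw [Finset.disjoint_left]
    intro s h1 h2
    have h1' := (Finset.mem_filter.mp h1).2
    have h2' := (Finset.mem_filter.mp h2).2
    omega
  · intro s hs
    have h := Finset.mem_filter.mp hs
    have h' := Finset.mem_range.mp h.1
    by_cases hst : t + 1 < s + M.n
    · exact Or.inr (Finset.mem_filter.mpr ⟨h.1, hst⟩)
    · exact Or.inl (Finset.mem_filter.mpr ⟨Finset.mem_range.mpr (by omega), by omega⟩)

/-- Change of variables: the private observations of time `t` together with the new ones are the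
observations that are shared at time `t + 1` together with those that are private then. -/
theorem lintegral_νO_νN {F : M.OObs k t × M.NObs k (t + 1) → ℝ≥0∞} (hF : Measurable F) :
    ∫⁻ a, ∫⁻ y, F (a, y) ∂M.νN k (t + 1) ∂M.νO k t =
      ∫⁻ o, ∫⁻ a, F (merge o a, newest a) ∂M.νO k (t + 1) ∂M.νOld k t := by
  have h1 := lintegral_map (hF.comp measurable_splitNew) (measurable_joinNew (M := M) (k := k)
    (t := t)) (μ := (M.νO k t).prod (M.νN k (t + 1)))
  have h2 := lintegral_map (hF.comp measurable_splitNew) (measurable_joinOld (M := M) (k := k)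
    (t := t)) (μ := (M.νOld k t).prod (M.νO k (t + 1)))
  rw [map_joinNew] at h1
  rw [map_joinOld, h1] at h2
  simp only [Function.comp_apply, splitNew_joinNew, splitNew_joinOld] at h2
  rw [← lintegral_prod _ hF.aemeasurable, h2, lintegral_prod]
  exact (hF.comp (measurable_merge.prodMk (measurable_newest.comp measurable_snd))).aemeasurable

end Model

end DelayedSharing

namespace DelayedSharing

namespace Model

variable {K : ℕ} {M : Model K} {k : Fin K} {t : ℕ}

/-! ### The evolution of the information -/

/-- Private information from observations and actions. -/
def mkOth (a : M.OObs k t) (v : M.OAct k t) : M.Oth k t := fun j => (a j, v j)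

/-- The observations in the private information of the others. -/
def othObs (lo : M.Oth k t) : M.OObs k t := fun j => (lo j).1

/-- The actions in the private information of the others. -/
def othAct (lo : M.Oth k t) : M.OAct k t := fun j => (lo j).2

theorem mkOth_othObs_othAct (lo : M.Oth k t) : mkOth (othObs lo) (othAct lo) = lo := rfl

/-- The information of player `k` at time `t + 1`. -/
def nextInfo (g : M.Profile) (i : M.Com t × M.Priv t k) (u : M.U t k) (y : M.Y (t + 1) k)
    (lo : M.Oth k t) : M.Com (t + 1) × M.Priv (t + 1) k :=
  (nextCom i.1 (allPriv i.2 lo) (jointAct g i.1 lo u), nextPriv i.2 u y)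

/-- The private information of the others at time `t + 1`. -/
def nextOth (g : M.Profile) (δ : M.Com t) (lo : M.Oth k t) (y : M.NObs k (t + 1)) :
    M.Oth k (t + 1) := fun j => nextPriv (lo j) ((g j).1 t (δ, lo j)) (y j)

/-- If at time `t` the actions of the others are a function `G` of their observations, so they are
at time `t + 1`. -/
def nextRule (g : M.Profile) (δ : M.Com t) (G : M.OObs k t → M.OAct k t) (o : M.Old k t)
    (a : M.OObs k (t + 1)) : M.OAct k (t + 1) :=
  othAct (nextOth g δ (mkOth (merge o a) (G (merge o a))) (newest a))

/-- The information of player `k` at time `t`, recovered from that at time `t + 1`. -/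
def prevInfo (i : M.Com (t + 1) × M.Priv (t + 1) k) : M.Com t × M.Priv t k :=
  (fun s j => i.1 ⟨s.1, by
      have h := Finset.mem_filter.mp s.2
      have h' := Finset.mem_range.mp h.1
      exact Finset.mem_filter.mpr ⟨Finset.mem_range.mpr (by omega), by omega⟩⟩ j,
    (fun s =>
      have hs := Finset.mem_range.mp (Finset.mem_filter.mp s.2).1
      have hs' := (Finset.mem_filter.mp s.2).2
      if h : t + 1 < s.1 + M.n then
        i.2.1 ⟨s.1, Finset.mem_filter.mpr ⟨Finset.mem_range.mpr (by omega), h⟩⟩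
      else (i.1 ⟨s.1, Finset.mem_filter.mpr ⟨Finset.mem_range.mpr (by omega), by omega⟩⟩ k).1,
    fun s =>
      have hs := Finset.mem_range.mp (Finset.mem_filter.mp s.2).1
      have hs' := (Finset.mem_filter.mp s.2).2
      if h : t + 1 < s.1 + M.n then
        i.2.2 ⟨s.1, Finset.mem_filter.mpr ⟨Finset.mem_range.mpr (by omega), h⟩⟩
      else (i.1 ⟨s.1, Finset.mem_filter.mpr ⟨Finset.mem_range.mpr (by omega), by omega⟩⟩ k).2))

/-- The observations of the others that are shared at time `t + 1`. -/
def sharedObs (i : M.Com (t + 1) × M.Priv (t + 1) k) : M.Old k t := fun j s =>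
  (i.1 ⟨s.1, by
    have h := Finset.mem_filter.mp s.2
    have h' := Finset.mem_range.mp h.1
    exact Finset.mem_filter.mpr ⟨Finset.mem_range.mpr (by omega), by omega⟩⟩ j).1

/-- Actions depend on no later observation. -/
def Causal (G : M.OObs k t → M.OAct k t) : Prop :=
  ∀ (a₁ a₂ : M.OObs k t) (s : ActWin M.n t),
    (∀ j (r : ObsWin M.n t), r.1 ≤ s.1 → a₁ j r = a₂ j r) → ∀ j, G a₁ j s = G a₂ j s

theorem obsWin_le (s : ObsWin M.n t) : s.1 ≤ t := by
  have := Finset.mem_range.mp (Finset.mem_filter.mp s.2).1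
  omega

theorem obsWin_lt (s : ObsWin M.n t) : t < s.1 + M.n := (Finset.mem_filter.mp s.2).2

theorem actWin_lt (s : ActWin M.n t) : s.1 < t :=
  Finset.mem_range.mp (Finset.mem_filter.mp s.2).1

theorem actWin_lt' (s : ActWin M.n t) : t < s.1 + M.n := (Finset.mem_filter.mp s.2).2

theorem othObs_nextOth_of_merge (g : M.Profile) (δ : M.Com t) {lo : M.Oth k t} {o : M.Old k t}
    {a : M.OObs k (t + 1)} (h : othObs lo = merge o a) :
    othObs (nextOth g δ lo (newest a)) = a := by
  funext j ⟨s, hs⟩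
  have h1 := obsWin_le ⟨s, hs⟩
  have h2 := obsWin_lt ⟨s, hs⟩
  simp only at h1 h2
  by_cases hst : s ≤ t
  · simp only [othObs, nextOth, nextPriv, hst, dite_true]
    change othObs lo j _ = _
    rw [h]
    simp only [merge, h2, dite_true]
  · obtain rfl : t + 1 = s := by omega
    simp only [othObs, nextOth, nextPriv, hst, dite_false]
    rfl

/-- Determinism propagates: once the actions at time `t` are a function of the observations, so are
those at time `t + 1`, with `merge` supplying the observations that have become shared. -/
theorem nextOth_eq_mkOth (g : M.Profile) (δ : M.Com t) (G : M.OObs k t → M.OAct k t)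
    (o : M.Old k t) (a : M.OObs k (t + 1)) :
    nextOth g δ (mkOth (merge o a) (G (merge o a))) (newest a) = mkOth a (nextRule g δ G o a) := by
  rw [← mkOth_othObs_othAct (nextOth g δ (mkOth (merge o a) (G (merge o a))) (newest a)),
    othObs_nextOth_of_merge (o := o) (a := a) g δ rfl]
  rfl

theorem newest_othObs_nextOth (g : M.Profile) (δ : M.Com t) (lo : M.Oth k t)
    (y : M.NObs k (t + 1)) : newest (othObs (nextOth g δ lo y)) = y := by
  funext j
  have h : ¬ t + 1 ≤ t := by omega
  simp only [newest, othObs, nextOth, nextPriv, h, dite_false]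

theorem merge_oldObs_nextOth (g : M.Profile) (δ : M.Com t) (lo : M.Oth k t)
    (y : M.NObs k (t + 1)) :
    merge (oldObs (othObs lo)) (othObs (nextOth g δ lo y)) = othObs lo := by
  funext j s
  have h1 := obsWin_le s
  by_cases h : t + 1 < s.1 + M.n
  · simp only [merge, h, dite_true, othObs, nextOth, nextPriv, h1]
  · simp only [merge, h, dite_false, oldObs]

theorem oldObs_merge (o : M.Old k t) (a : M.OObs k (t + 1)) : oldObs (merge o a) = o := by
  funext j s
  have h : ¬ t + 1 < s.1 + M.n := by
    have := (Finset.mem_filter.mp s.2).2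
    omega
  simp only [oldObs, merge, h, dite_false]

theorem allPriv_self (l : M.Priv t k) (lo : M.Oth k t) : allPriv l lo k = l := by
  simp [allPriv]

theorem allPriv_of_ne (l : M.Priv t k) (lo : M.Oth k t) (j : {j : Fin K // j ≠ k}) :
    allPriv l lo j = lo j := by
  simp [allPriv, j.2]

theorem jointAct_self (g : M.Profile) (δ : M.Com t) (lo : M.Oth k t) (u : M.U t k) :
    jointAct g δ lo u k = u := by
  simp [jointAct]

theorem jointAct_of_ne (g : M.Profile) (δ : M.Com t) (lo : M.Oth k t) (u : M.U t k)
    (j : {j : Fin K // j ≠ k}) : jointAct g δ lo u j = (g j).1 t (δ, lo j) := by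
  simp [jointAct, j.2]

theorem newObs_nextPriv {j : Fin K} (l : M.Priv t j) (u : M.U t j) (y : M.Y (t + 1) j) :
    newObs (nextPriv l u y) = y := by
  have h : ¬ t + 1 ≤ t := by omega
  simp only [newObs, nextPriv, h, dite_false]

/-- Perfect recall: whatever leaves the private information of player `k` enters the common
information. -/
theorem prevInfo_nextInfo (g : M.Profile) (i : M.Com t × M.Priv t k) (u : M.U t k)
    (y : M.Y (t + 1) k) (lo : M.Oth k t) : prevInfo (nextInfo g i u y lo) = i := by
  refine Prod.ext ?_ (Prod.ext ?_ ?_)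
  · funext s j
    have h := (Finset.mem_filter.mp s.2).2
    simp only [prevInfo, nextInfo, nextCom, h, dite_true]
  · funext s
    have h1 := obsWin_le s
    have h2 : ¬ s.1 + M.n ≤ t := by
      have := obsWin_lt s
      omega
    by_cases h : t + 1 < s.1 + M.n
    · simp only [prevInfo, nextInfo, h, dite_true, nextPriv, h1]
    · simp only [prevInfo, nextInfo, h, dite_false, nextCom, h2, allPriv_self]
  · funext s
    have h1 := actWin_lt s
    have h2 : ¬ s.1 + M.n ≤ t := by
      have := actWin_lt' s
      omega
    by_cases h : t + 1 < s.1 + M.n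
    · simp only [prevInfo, nextInfo, h, dite_true, nextPriv, h1]
    · simp only [prevInfo, nextInfo, h, dite_false, nextCom, h2, allPriv_self, h1, dite_true]

theorem sharedObs_nextInfo (g : M.Profile) (i : M.Com t × M.Priv t k) (u : M.U t k)
    (y : M.Y (t + 1) k) (lo : M.Oth k t) :
    sharedObs (nextInfo g i u y lo) = oldObs (othObs lo) := by
  funext j s
  have h2 : ¬ s.1 + M.n ≤ t := by
    have := (Finset.mem_filter.mp s.2).2
    omega
  simp only [sharedObs, nextInfo, nextCom, h2, dite_false, allPriv_of_ne]
  rfl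

theorem oldObs_eq_iff {a₁ a₂ : M.OObs k t} (h : oldObs a₁ = oldObs a₂) (j : {j : Fin K // j ≠ k})
    (s : ObsWin M.n t) (hs : ¬ t + 1 < s.1 + M.n) : a₁ j s = a₂ j s :=
  congrFun (congrFun h j) ⟨s.1, Finset.mem_filter.mpr ⟨(Finset.mem_filter.mp s.2).1, by
    have := obsWin_lt s
    omega⟩⟩

/-- The action that is about to be shared was taken at time `t + 1 - n`. Of the private
observations, it can depend only on those of this time, which are shared as well. -/
theorem Causal.eq_of_oldObs_eq {G : M.OObs k t → M.OAct k t} (hG : Causal G) {a₁ a₂ : M.OObs k t}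
    (h : oldObs a₁ = oldObs a₂) (j : {j : Fin K // j ≠ k}) (s : ActWin M.n t)
    (hs : ¬ t + 1 < s.1 + M.n) : G a₁ j s = G a₂ j s := by
  refine hG a₁ a₂ s (fun j r hr => oldObs_eq_iff h j r ?_) j
  omega

/-- The others' private data reach the next information of player `k` only through the shared
observations. Hence the normalizing constant and the next density are functions of that information.
-/
theorem Causal.nextInfo_eq {G : M.OObs k t → M.OAct k t} (hG : Causal G) (g : M.Profile)
    (i : M.Com t × M.Priv t k) (u : M.U t k) (y : M.Y (t + 1) k) {a₁ a₂ : M.OObs k t}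
    (h : oldObs a₁ = oldObs a₂) :
    nextInfo g i u y (mkOth a₁ (G a₁)) = nextInfo g i u y (mkOth a₂ (G a₂)) := by
  refine Prod.ext ?_ rfl
  funext s j
  by_cases hs : s.1 + M.n ≤ t
  · simp only [nextInfo, nextCom, hs, dite_true]
  have hsn := (Finset.mem_filter.mp s.2).2
  have hn := M.one_le_n
  simp only [nextInfo, nextCom, hs, dite_false]
  by_cases hj : j = k
  · subst hj
    simp only [allPriv_self, jointAct_self]
  · have e1 : ∀ lo : M.Oth k t, allPriv i.2 lo j = lo ⟨j, hj⟩ := fun lo =>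
      allPriv_of_ne i.2 lo ⟨j, hj⟩
    have e2 : ∀ lo : M.Oth k t, jointAct g i.1 lo u j = (g j).1 t (i.1, lo ⟨j, hj⟩) := fun lo =>
      jointAct_of_ne g i.1 lo u ⟨j, hj⟩
    simp only [e1, e2]
    refine Prod.ext ?_ ?_
    · exact oldObs_eq_iff h ⟨j, hj⟩ _ (by simp only; omega)
    · by_cases hst : s.1 < t
      · simp only [hst, dite_true]
        exact hG.eq_of_oldObs_eq h ⟨j, hj⟩ _ (by simp only; omega)
      -- This case forces `n = 1`: all private observations of time `t` are then shared at `t + 1`,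
      -- together with the action just taken.
      · have ha : a₁ = a₂ := by
          funext j' r
          refine oldObs_eq_iff h j' r ?_
          have := obsWin_le r
          omega
        subst ha
        rfl

/-- An action of time `s < t` is given by `G`, and an action of time `t` may use all observations up
to `t`. In both cases only merged observations up to the time of the action enter. -/
theorem Causal.nextRule {G : M.OObs k t → M.OAct k t} (hG : Causal G) (g : M.Profile)
    (δ : M.Com t) (o : M.Old k t) : Causal (nextRule g δ G o) := by
  intro a₁ a₂ s hs j
  have hmerge : ∀ j (r : ObsWin M.n t), r.1 ≤ s.1 → merge o a₁ j r = merge o a₂ j r := by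
    intro j r hr
    by_cases h : t + 1 < r.1 + M.n
    · simp only [merge, h, dite_true]
      exact hs j _ hr
    · simp only [merge, h, dite_false]
  by_cases hst : s.1 < t
  · simp only [Model.nextRule, othAct, nextOth, nextPriv, hst, dite_true]
    exact hG _ _ ⟨s.1, _⟩ hmerge j
  · have ha : merge o a₁ = merge o a₂ := by
      funext j r
      refine hmerge j r ?_
      have := obsWin_le r
      omega
    simp only [Model.nextRule, othAct, nextOth, nextPriv, hst, dite_false, ha]

/-! ### Measurability -/

theorem measurable_mkOth : Measurable fun p : M.OObs k t × M.OAct k t => mkOth p.1 p.2 := by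
  unfold mkOth
  fun_prop

theorem measurable_othObs : Measurable (othObs : M.Oth k t → M.OObs k t) := by
  unfold othObs
  fun_prop

theorem measurable_othAct : Measurable (othAct : M.Oth k t → M.OAct k t) := by
  unfold othAct
  fun_prop

theorem measurable_allPriv :
    Measurable fun p : M.Priv t k × M.Oth k t => allPriv p.1 p.2 := by
  refine measurable_pi_iff.mpr fun j => ?_
  by_cases h : j = k
  · subst h
    simp only [allPriv_self]
    exact measurable_fst
  · have e : ∀ p : M.Priv t k × M.Oth k t, allPriv p.1 p.2 j = p.2 ⟨j, h⟩ := fun p =>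
      allPriv_of_ne p.1 p.2 ⟨j, h⟩
    simp only [e]
    exact (measurable_pi_apply _).comp measurable_snd

theorem measurable_jointAct (g : M.Profile) :
    Measurable fun p : M.Com t × M.Oth k t × M.U t k => jointAct g p.1 p.2.1 p.2.2 := by
  refine measurable_pi_iff.mpr fun j => ?_
  by_cases h : j = k
  · subst h
    simp only [jointAct_self]
    exact measurable_snd.comp measurable_snd
  · have e : ∀ p : M.Com t × M.Oth k t × M.U t k,
        jointAct g p.1 p.2.1 p.2.2 j = (g j).1 t (p.1, p.2.1 ⟨j, h⟩) := fun p =>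
      jointAct_of_ne g p.1 p.2.1 p.2.2 ⟨j, h⟩
    simp only [e]
    exact ((g j).2 t).comp (measurable_fst.prodMk
      ((measurable_pi_apply _).comp (measurable_fst.comp measurable_snd)))

theorem measurable_nextCom : Measurable
    fun p : M.Com t × (∀ j, M.Priv t j) × (∀ j, M.U t j) => nextCom p.1 p.2.1 p.2.2 := by
  refine measurable_pi_iff.mpr fun s => measurable_pi_iff.mpr fun j => ?_
  by_cases h : s.1 + M.n ≤ t
  · simp only [nextCom, h, dite_true]
    fun_prop
  · simp only [nextCom, h, dite_false]
    refine Measurable.prodMk (by fun_prop) ?_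
    by_cases h' : s.1 < t
    · simp only [h', dite_true]
      fun_prop
    · simp only [h', dite_false]
      exact (measurable_cast_family (β := fun s => M.U s j) _).comp
        ((measurable_pi_apply j).comp (measurable_snd.comp measurable_snd))

theorem measurable_nextPriv {j : Fin K} : Measurable
    fun p : M.Priv t j × M.U t j × M.Y (t + 1) j => nextPriv p.1 p.2.1 p.2.2 := by
  refine Measurable.prodMk (measurable_pi_iff.mpr fun s => ?_) (measurable_pi_iff.mpr fun s => ?_)
  · by_cases h : s.1 ≤ t
    · simp only [h, dite_true]
      fun_prop
    · simp only [h, dite_false]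
      exact (measurable_cast_family (β := fun s => M.Y s j) _).comp
        (measurable_snd.comp measurable_snd)
  · by_cases h : s.1 < t
    · simp only [h, dite_true]
      fun_prop
    · simp only [h, dite_false]
      exact (measurable_cast_family (β := fun s => M.U s j) _).comp
        (measurable_fst.comp measurable_snd)

theorem measurable_nextInfo (g : M.Profile) : Measurable
    fun p : (M.Com t × M.Priv t k) × M.U t k × M.Y (t + 1) k × M.Oth k t =>
      nextInfo g p.1 p.2.1 p.2.2.1 p.2.2.2 := by
  refine Measurable.prodMk ?_ ?_
  · refine measurable_nextCom.comp (Measurable.prodMk (by fun_prop) (Measurable.prodMk ?_ ?_))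
    · exact measurable_allPriv.comp (by fun_prop :
        Measurable fun p : (M.Com t × M.Priv t k) × M.U t k × M.Y (t + 1) k × M.Oth k t =>
          (p.1.2, p.2.2.2))
    · exact (measurable_jointAct g).comp (by fun_prop :
        Measurable fun p : (M.Com t × M.Priv t k) × M.U t k × M.Y (t + 1) k × M.Oth k t =>
          (p.1.1, p.2.2.2, p.2.1))
  · exact measurable_nextPriv.comp (by fun_prop :
        Measurable fun p : (M.Com t × M.Priv t k) × M.U t k × M.Y (t + 1) k × M.Oth k t =>
          (p.1.2, p.2.1, p.2.2.1))

theorem measurable_nextOth (g : M.Profile) : Measurable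
    fun p : M.Com t × M.Oth k t × M.NObs k (t + 1) => nextOth g p.1 p.2.1 p.2.2 := by
  refine measurable_pi_iff.mpr fun j => ?_
  refine measurable_nextPriv.comp (Measurable.prodMk (by fun_prop) (Measurable.prodMk ?_
    (by fun_prop)))
  exact ((g j).2 t).comp (by fun_prop)

theorem measurable_nextRule {B : Type*} [MeasurableSpace B] (g : M.Profile) {δ : B → M.Com t}
    (hδ : Measurable δ) {G : B → M.OObs k t → M.OAct k t}
    (hG : Measurable fun p : B × M.OObs k t => G p.1 p.2) {o : B → M.Old k t}
    (ho : Measurable o) :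
    Measurable fun p : B × M.OObs k (t + 1) => nextRule g (δ p.1) (G p.1) (o p.1) p.2 := by
  have hm : Measurable fun p : B × M.OObs k (t + 1) => merge (o p.1) p.2 :=
    measurable_merge.comp ((ho.comp measurable_fst).prodMk measurable_snd)
  refine measurable_othAct.comp ((measurable_nextOth g).comp ((hδ.comp measurable_fst).prodMk
    (Measurable.prodMk ?_ (measurable_newest.comp measurable_snd))))
  exact measurable_mkOth.comp (hm.prodMk (hG.comp (measurable_fst.prodMk hm)))

theorem measurable_prevInfo :
    Measurable (prevInfo : M.Com (t + 1) × M.Priv (t + 1) k → M.Com t × M.Priv t k) := by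
  refine Measurable.prodMk (by fun_prop) (Measurable.prodMk (measurable_pi_iff.mpr fun s => ?_)
    (measurable_pi_iff.mpr fun s => ?_))
  all_goals
    by_cases h : t + 1 < s.1 + M.n
    · simp only [h, dite_true]
      fun_prop
    · simp only [h, dite_false]
      fun_prop

theorem measurable_sharedObs :
    Measurable (sharedObs : M.Com (t + 1) × M.Priv (t + 1) k → M.Old k t) := by
  unfold sharedObs
  fun_prop

theorem measurable_newObs {j : Fin K} : Measurable (newObs : M.Priv (t + 1) j → M.Y (t + 1) j) := by
  unfold newObs
  fun_prop

/-- Stated for an arbitrary σ-algebra `m`, so that it can be applied to the one generated by the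
past noises; independence from the current noises follows. -/
theorem measurable_run_of {m : MeasurableSpace M.Ω} (g : M.Profile) {t : ℕ}
    (h0 : Measurable[m] M.X0) (hw : ∀ s < t, Measurable[m] (M.w s))
    (hz : ∀ s ≤ t, ∀ j, Measurable[m] (M.z s j)) : Measurable[m] fun ω => run g ω t := by
  induction t with
  | zero =>
    refine h0.prodMk (measurable_const.prodMk (measurable_pi_iff.mpr fun j => ?_))
    have h : Measurable[m] fun ω => M.h 0 j (M.X0 ω) (M.z 0 j ω) :=
      (M.measurable_h 0 j).comp (h0.prodMk (hz 0 le_rfl j))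
    refine Measurable.prodMk (measurable_pi_iff.mpr fun s => ?_)
      (measurable_pi_iff.mpr fun s => absurd (Finset.mem_filter.mp s.2).1 (by simp))
    exact (measurable_cast_family (β := fun s => M.Y s j) _).comp h
  | succ t ih =>
    have ih := ih (fun s hs => hw s (by omega)) fun s hs => hz s (by omega)
    have hu : Measurable[m] fun ω => (fun j => (g j).1 t ((run g ω t).2.1, (run g ω t).2.2 j) :
        ∀ j, M.U t j) :=
      measurable_pi_iff.mpr fun j => ((g j).2 t).comp (((measurable_fst.comp measurable_snd).comp
        ih).prodMk (((measurable_pi_apply j).comp (measurable_snd.comp measurable_snd)).comp ih))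
    have hx : Measurable[m] fun ω => M.f t (run g ω t).1
        (fun j => (g j).1 t ((run g ω t).2.1, (run g ω t).2.2 j)) (M.w t ω) :=
      (M.measurable_f t).comp ((measurable_fst.comp ih).prodMk (hu.prodMk (hw t (by omega))))
    refine hx.prodMk (Measurable.prodMk ?_ (measurable_pi_iff.mpr fun j => ?_))
    · exact measurable_nextCom.comp (((measurable_fst.comp measurable_snd).comp ih).prodMk
        (((measurable_snd.comp measurable_snd).comp ih).prodMk hu))
    · exact measurable_nextPriv.comp
        ((((measurable_pi_apply j).comp (measurable_snd.comp measurable_snd)).comp ih).prodMk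
          (((measurable_pi_apply j).comp hu).prodMk
            ((M.measurable_h (t + 1) j).comp (hx.prodMk (hz (t + 1) le_rfl j)))))

theorem measurable_run (g : M.Profile) (t : ℕ) : Measurable fun ω => run g ω t :=
  measurable_run_of g M.measurable_X0 (fun s _ => M.measurable_w s) fun s _ => M.measurable_z s

theorem measurable_state (g : M.Profile) (t : ℕ) : Measurable (state g t) :=
  measurable_fst.comp (measurable_run g t)

theorem measurable_info (g : M.Profile) (k : Fin K) (t : ℕ) : Measurable (info g k t) := by
  have := measurable_run g t
  unfold info
  fun_prop

theorem measurable_oth (g : M.Profile) (k : Fin K) (t : ℕ) : Measurable (oth g k t) := by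
  have := measurable_run g t
  unfold oth
  fun_prop

theorem measurable_obs (g : M.Profile) (k : Fin K) (t : ℕ) : Measurable (obs g k t) :=
  (M.measurable_h t k).comp ((measurable_state g t).prodMk (M.measurable_z t k))

theorem measurable_act (g : M.Profile) (t : ℕ) : Measurable (act g t) :=
  measurable_pi_iff.mpr fun j => ((g j).2 t).comp (measurable_info g j t)

/-! ### The recursion for the controlled processes -/

theorem act_update (g : M.Profile) (gk : M.Strat k) (t : ℕ) (ω : M.Ω) :
    act (Function.update g k gk) t ω =
      jointAct g (info (Function.update g k gk) k t ω).1 (oth (Function.update g k gk) k t ω)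
        (gk.1 t (info (Function.update g k gk) k t ω)) := by
  funext j
  by_cases h : j = k
  · subst h
    rw [jointAct_self]
    simp [act]
  · have := jointAct_of_ne g (info (Function.update g k gk) k t ω).1
      (oth (Function.update g k gk) k t ω) (gk.1 t (info (Function.update g k gk) k t ω)) ⟨j, h⟩
    rw [this]
    simp only [act, Function.update_of_ne h]
    rfl

theorem info_succ (g : M.Profile) (gk : M.Strat k) (t : ℕ) (ω : M.Ω) :
    info (Function.update g k gk) k (t + 1) ω =
      nextInfo g (info (Function.update g k gk) k t ω)
        (gk.1 t (info (Function.update g k gk) k t ω)) (obs (Function.update g k gk) k (t + 1) ω)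
        (oth (Function.update g k gk) k t ω) := by
  have h1 : allPriv (info (Function.update g k gk) k t ω).2 (oth (Function.update g k gk) k t ω) =
      (run (Function.update g k gk) ω t).2.2 := by
    funext j
    by_cases h : j = k
    · subst h
      rw [allPriv_self]
      rfl
    · exact allPriv_of_ne _ _ ⟨j, h⟩
  refine Prod.ext ?_ ?_
  · change nextCom _ _ (act (Function.update g k gk) t ω) = nextCom _ _ _
    rw [act_update, h1]
    rfl
  · change nextPriv _ (act (Function.update g k gk) t ω k) _ = nextPriv _ _ _
    rw [act_update, jointAct_self]
    rfl

theorem oth_succ (g : M.Profile) (gk : M.Strat k) (t : ℕ) (ω : M.Ω) :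
    oth (Function.update g k gk) k (t + 1) ω =
      nextOth g (info (Function.update g k gk) k t ω).1 (oth (Function.update g k gk) k t ω)
        (fun j => obs (Function.update g k gk) j (t + 1) ω) := by
  funext j
  change nextPriv _ (act (Function.update g k gk) t ω j) _ = nextPriv _ _ _
  rw [act_update, jointAct_of_ne]
  rfl

theorem run_congr (g : M.Profile) {gk gk' : M.Strat k} {t : ℕ}
    (h : ∀ s < t, gk.1 s = gk'.1 s) (ω : M.Ω) :
    run (Function.update g k gk) ω t = run (Function.update g k gk') ω t := by
  induction t with
  | zero => rfl
  | succ t ih =>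
    have ih := ih fun s hs => h s (by omega)
    have hu : ∀ j, ((Function.update g k gk) j).1 t = ((Function.update g k gk') j).1 t := by
      intro j
      by_cases hj : j = k
      · subst hj
        simpa using h t (by omega)
      · simp [Function.update_of_ne hj]
    simp only [run, ih, hu]

end Model

end DelayedSharing

namespace DelayedSharing

/-! ### Product measures with densities and independence -/

theorem lintegral_pi_prod {ι : Type*} [Fintype ι] {X : ι → Type*} [∀ i, MeasurableSpace (X i)]
    (μ : ∀ i, Measure (X i)) [∀ i, SigmaFinite (μ i)] {f : ∀ i, X i → ℝ≥0∞}
    (hf : ∀ i, Measurable (f i)) :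
    ∫⁻ x, ∏ i, f i (x i) ∂Measure.pi μ = ∏ i, ∫⁻ y, f i y ∂μ i := by
  classical
  have hm : ∀ s : Finset ι, Measurable fun x : ∀ i, X i => ∏ i ∈ s, f i (x i) := fun s =>
    Finset.measurable_fun_prod s fun i _ => (hf i).comp (measurable_pi_apply i)
  have key : ∀ s : Finset ι, ∀ x, lmarginal μ s (fun x => ∏ i ∈ s, f i (x i)) x =
      ∏ i ∈ s, ∫⁻ y, f i y ∂μ i := by
    intro s
    induction s using Finset.induction with
    | empty => simp
    | insert i s hi ih =>
      intro x
      rw [lmarginal_insert' _ (hm _) hi]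
      have h1 : (fun x : ∀ i, X i => ∫⁻ y, ∏ j ∈ insert i s, f j (Function.update x i y j) ∂μ i) =
          fun x => (∫⁻ y, f i y ∂μ i) * ∏ j ∈ s, f j (x j) := by
        funext x
        rw [← lintegral_mul_const _ (hf i)]
        refine lintegral_congr fun y => ?_
        rw [Finset.prod_insert hi, Function.update_self]
        congr 1
        refine Finset.prod_congr rfl fun j hj => ?_
        rw [Function.update_of_ne]
        rintro rfl
        exact hi hj
      rw [h1, Finset.prod_insert hi, ← ih x]
      unfold lmarginal
      rw [lintegral_const_mul]
      exact (hm s).comp measurable_updateFinset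
  -- Marginal integrals need a base point. If the product is empty, some factor is, and both sides
  -- vanish.
  by_cases hne : Nonempty (∀ i, X i)
  · obtain ⟨x⟩ := hne
    rw [lintegral_eq_lmarginal_univ x]
    exact key Finset.univ x
  · rw [not_nonempty_iff] at hne
    obtain ⟨i, hi⟩ := isEmpty_pi.mp hne
    rw [Measure.eq_zero_of_isEmpty (Measure.pi μ), lintegral_zero_measure]
    refine (Finset.prod_eq_zero (Finset.mem_univ i) ?_).symm
    rw [Measure.eq_zero_of_isEmpty (μ i), lintegral_zero_measure]

theorem pi_withDensity {ι : Type*} [Fintype ι] {X : ι → Type*} [∀ i, MeasurableSpace (X i)]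
    (μ : ∀ i, Measure (X i)) [∀ i, SigmaFinite (μ i)] {f : ∀ i, X i → ℝ≥0∞}
    (hf : ∀ i, Measurable (f i)) [∀ i, SigmaFinite ((μ i).withDensity (f i))] :
    Measure.pi (fun i => (μ i).withDensity (f i)) =
      (Measure.pi μ).withDensity fun x => ∏ i, f i (x i) := by
  refine Measure.pi_eq fun R hR => ?_
  rw [withDensity_apply _ (MeasurableSet.univ_pi hR), ← lintegral_indicator
    (MeasurableSet.univ_pi hR)]
  have : ((Set.univ.pi R).indicator fun x => ∏ i, f i (x i)) =
      fun x => ∏ i, (R i).indicator (f i) (x i) := by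
    funext x
    by_cases h : x ∈ Set.univ.pi R
    · rw [Set.indicator_of_mem h]
      refine Finset.prod_congr rfl fun i _ => ?_
      rw [Set.indicator_of_mem (h i (Set.mem_univ i))]
    · rw [Set.indicator_of_notMem h]
      simp only [Set.mem_univ_pi, not_forall] at h
      obtain ⟨i, hi⟩ := h
      exact (Finset.prod_eq_zero (Finset.mem_univ i) (Set.indicator_of_notMem hi _)).symm
  rw [this, lintegral_pi_prod μ fun i => (hf i).indicator (hR i)]
  refine Finset.prod_congr rfl fun i _ => ?_
  rw [lintegral_indicator (hR i), withDensity_apply _ (hR i)]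

theorem lintegral_of_indepFun {Ω α β : Type*} [MeasurableSpace Ω] [MeasurableSpace α]
    [MeasurableSpace β] {P : Measure Ω} [IsProbabilityMeasure P] {f : Ω → α} {h : Ω → β}
    (hf : Measurable f) (hh : Measurable h) (hi : IndepFun f h P) {F : α × β → ℝ≥0∞}
    (hF : Measurable F) :
    ∫⁻ ω, F (f ω, h ω) ∂P = ∫⁻ ω, ∫⁻ ω', F (f ω, h ω') ∂P ∂P := by
  have := Measure.isProbabilityMeasure_map (μ := P) hf.aemeasurable
  have := Measure.isProbabilityMeasure_map (μ := P) hh.aemeasurable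
  rw [← lintegral_map hF (hf.prodMk hh),
    (indepFun_iff_map_prod_eq_prod_map_map hf.aemeasurable hh.aemeasurable).mp hi,
    lintegral_prod _ hF.aemeasurable, lintegral_map hF.lintegral_prod_right' hf]
  refine lintegral_congr fun ω => ?_
  exact lintegral_map (hF.comp measurable_prodMk_left) hh

/-! ### Independence of the noises and the one-step transition law -/

namespace Model

variable {K : ℕ} {M : Model K} {k : Fin K} {t : ℕ}

variable (M) in
/-- The σ-algebras of the initial state and of the noises. -/
@[reducible]
def noise : Unit ⊕ ℕ ⊕ (ℕ × Fin K) → MeasurableSpace M.Ω :=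
  Sum.elim (fun _ : Unit => MeasurableSpace.comap M.X0 inferInstance)
    (Sum.elim (fun t : ℕ => MeasurableSpace.comap (M.w t) inferInstance)
      (fun p : ℕ × Fin K => MeasurableSpace.comap (M.z p.1 p.2) inferInstance))

theorem noise_le (i : Unit ⊕ ℕ ⊕ (ℕ × Fin K)) : noise M i ≤ M.mΩ := by
  rcases i with _ | s | ⟨s, j⟩
  · exact M.measurable_X0.comap_le
  · exact (M.measurable_w s).comap_le
  · exact (M.measurable_z s j).comap_le

theorem measurable_w_noise {S : Set (Unit ⊕ ℕ ⊕ (ℕ × Fin K))} {s : ℕ} (h : Sum.inr (Sum.inl s) ∈ S) :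
    Measurable[⨆ i ∈ S, noise M i] (M.w s) :=
  (comap_measurable (M.w s)).mono (le_iSup₂_of_le _ h le_rfl) le_rfl

theorem measurable_z_noise {S : Set (Unit ⊕ ℕ ⊕ (ℕ × Fin K))} {s : ℕ} {j : Fin K}
    (h : Sum.inr (Sum.inr (s, j)) ∈ S) : Measurable[⨆ i ∈ S, noise M i] (M.z s j) :=
  (comap_measurable (M.z s j)).mono (le_iSup₂_of_le _ h le_rfl) le_rfl

theorem measurable_X0_noise {S : Set (Unit ⊕ ℕ ⊕ (ℕ × Fin K))} (h : Sum.inl () ∈ S) :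
    Measurable[⨆ i ∈ S, noise M i] M.X0 :=
  (comap_measurable M.X0).mono (le_iSup₂_of_le _ h le_rfl) le_rfl

theorem indepFun_of_noise {α β : Type*} [MeasurableSpace α] [MeasurableSpace β]
    {S S' : Set (Unit ⊕ ℕ ⊕ (ℕ × Fin K))} (hS : Disjoint S S') {f : M.Ω → α} {h : M.Ω → β}
    (hf : Measurable[⨆ i ∈ S, noise M i] f) (hh : Measurable[⨆ i ∈ S', noise M i] h) :
    IndepFun f h M.P := by
  rw [IndepFun_iff_Indep]
  have := indep_iSup_of_disjoint noise_le M.indep hS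
  exact indep_of_indep_of_le_left (indep_of_indep_of_le_right this hh.comap_le) hf.comap_le

variable (M k t) in
/-- The observation noises of the players other than `k`. -/
def noiseOth (ω : M.Ω) : ∀ j : {j : Fin K // j ≠ k}, M.Z t j := fun j => M.z t j ω

theorem measurable_noiseOth : Measurable (noiseOth M k t) :=
  measurable_pi_iff.mpr fun j => M.measurable_z t j

theorem lintegral_Q (x : M.X t) (j : Fin K) : ∫⁻ y, M.Q t j x y ∂M.νY t j = 1 := by
  have h1 : Measurable fun ω => M.h t j x (M.z t j ω) :=
    (M.measurable_h t j).comp (measurable_const.prodMk (M.measurable_z t j))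
  have h2 := M.law_Q t j x
  have h3 := congrArg (fun μ => μ Set.univ) h2
  simp only [withDensity_apply _ MeasurableSet.univ, Measure.map_apply h1 MeasurableSet.univ,
    Set.preimage_univ, measure_univ, Measure.restrict_univ] at h3
  exact h3.symm

theorem lintegral_S (x : M.X t) (u : ∀ j, M.U t j) : ∫⁻ y, M.S t x u y ∂M.νX (t + 1) = 1 := by
  have h1 : Measurable fun ω => M.f t x u (M.w t ω) :=
    (M.measurable_f t).comp (measurable_const.prodMk (measurable_const.prodMk (M.measurable_w t)))
  have h2 := M.law_S t x u
  have h3 := congrArg (fun μ => μ Set.univ) h2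
  simp only [withDensity_apply _ MeasurableSet.univ, Measure.map_apply h1 MeasurableSet.univ,
    Set.preimage_univ, measure_univ, Measure.restrict_univ] at h3
  exact h3.symm

theorem measurable_Q_right (x : M.X t) (j : Fin K) : Measurable (M.Q t j x) :=
  (M.measurable_Q t j).comp measurable_prodMk_left

theorem measurable_S_right (x : M.X t) (u : ∀ j, M.U t j) : Measurable (M.S t x u) :=
  (M.measurable_S t).comp (measurable_prodMk_left.comp measurable_prodMk_left)

variable (M k) in
/-- The joint density of the observations of the players other than `k`. -/
noncomputable def QO (x : M.X t) (n : M.NObs k t) : ℝ≥0∞ :=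
  ∏ j : {j : Fin K // j ≠ k}, M.Q t j x (n j)

theorem measurable_QO : Measurable fun p : M.X t × M.NObs k t => QO M k p.1 p.2 := by
  unfold QO
  refine Finset.measurable_fun_prod _ fun j _ => ?_
  exact (M.measurable_Q t j).comp
    (measurable_fst.prodMk ((measurable_pi_apply j).comp measurable_snd))

theorem lintegral_QO (x : M.X t) : ∫⁻ n, QO M k x n ∂M.νN k t = 1 := by
  unfold QO
  rw [lintegral_pi_prod (fun j : {j : Fin K // j ≠ k} => M.νY t j)
    (fun j => measurable_Q_right x j)]
  simp [lintegral_Q]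

theorem lintegral_noise_own (x : M.X t) {F : M.Y t k → ℝ≥0∞} (hF : Measurable F) :
    ∫⁻ ω, F (M.h t k x (M.z t k ω)) ∂M.P = ∫⁻ y, M.Q t k x y * F y ∂M.νY t k := by
  have h1 : Measurable fun ω => M.h t k x (M.z t k ω) :=
    (M.measurable_h t k).comp (measurable_const.prodMk (M.measurable_z t k))
  rw [← lintegral_map hF h1, M.law_Q t k x,
    lintegral_withDensity_eq_lintegral_mul _ (measurable_Q_right x k) hF]
  rfl

theorem lintegral_noise_state (x : M.X t) (u : ∀ j, M.U t j) {F : M.X (t + 1) → ℝ≥0∞}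
    (hF : Measurable F) :
    ∫⁻ ω, F (M.f t x u (M.w t ω)) ∂M.P = ∫⁻ y, M.S t x u y * F y ∂M.νX (t + 1) := by
  have h1 : Measurable fun ω => M.f t x u (M.w t ω) :=
    (M.measurable_f t).comp (measurable_const.prodMk (measurable_const.prodMk (M.measurable_w t)))
  rw [← lintegral_map hF h1, M.law_S t x u,
    lintegral_withDensity_eq_lintegral_mul _ (measurable_S_right x u) hF]
  rfl

/-- The noises of different players are independent, so the vector of the others' observations has
the product law; its density is the product of the densities. -/
theorem lintegral_noise_oth (x : M.X t) {F : M.NObs k t → ℝ≥0∞} (hF : Measurable F) :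
    ∫⁻ ω, F (fun j => M.h t j x (M.z t j ω)) ∂M.P = ∫⁻ n, QO M k x n * F n ∂M.νN k t := by
  have hj : ∀ j : {j : Fin K // j ≠ k}, Measurable fun z => M.h t j x z := fun j =>
    (M.measurable_h t j).comp measurable_prodMk_left
  have h1 : Measurable fun ω => (fun j => M.h t j x (M.z t j ω) : M.NObs k t) :=
    measurable_pi_iff.mpr fun j => (hj j).comp (M.measurable_z t j)
  have hind : iIndepFun (fun j : {j : Fin K // j ≠ k} => fun ω => M.h t j x (M.z t j ω)) M.P := by
    have h2 : iIndepFun (fun j : {j : Fin K // j ≠ k} => M.z t j) M.P := by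
      rw [iIndepFun_iff_iIndep]
      exact iIndep.precomp (m := noise M) (g := fun j : {j : Fin K // j ≠ k} =>
        Sum.inr (Sum.inr (t, j.1))) (fun a b h => by simpa [Subtype.ext_iff] using h) M.indep
    exact h2.comp _ hj
  have hp : ∀ j : {j : Fin K // j ≠ k}, IsProbabilityMeasure
      ((M.νY t j).withDensity (M.Q t j x)) := fun j => by
    rw [← M.law_Q t j x]
    exact Measure.isProbabilityMeasure_map ((hj j).comp (M.measurable_z t j)).aemeasurable
  have hlaw : M.P.map (fun ω => (fun j => M.h t j x (M.z t j ω) : M.NObs k t)) =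
      (M.νN k t).withDensity (QO M k x) := by
    have h2 := (iIndepFun_iff_map_fun_eq_pi_map fun j =>
      ((hj j).comp (M.measurable_z t j)).aemeasurable).mp hind
    simp only [Function.comp_apply] at h2
    rw [h2]
    have : (fun j : {j : Fin K // j ≠ k} => M.P.map ((fun z => M.h t j x z) ∘ M.z t j)) =
        fun j : {j : Fin K // j ≠ k} => (M.νY t j).withDensity (M.Q t j x) := funext fun j => M.law_Q t j.1 x
    rw [this]
    exact pi_withDensity (fun j : {j : Fin K // j ≠ k} => M.νY t j)
      (f := fun j => M.Q t j.1 x) fun j => measurable_Q_right x j.1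
  have hQ : Measurable (QO M k x) := measurable_QO.comp measurable_prodMk_left
  rw [← lintegral_map hF h1, hlaw, lintegral_withDensity_eq_lintegral_mul _ hQ hF]
  rfl

/-- The conditional law of the new state and of the new observations given the past. -/
theorem lintegral_step (g : M.Profile)
    {φ : (M.X t × M.Com t × (∀ j, M.Priv t j)) × M.X (t + 1) × M.Y (t + 1) k × M.NObs k (t + 1) →
      ℝ≥0∞} (hφ : Measurable φ) :
    ∫⁻ ω, φ (run g ω t, state g (t + 1) ω, obs g k (t + 1) ω, fun j => obs g j (t + 1) ω) ∂M.P =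
      ∫⁻ ω, ∫⁻ x, M.S t (state g t ω) (act g t ω) x * ∫⁻ y, M.Q (t + 1) k x y *
        ∫⁻ n, QO M k x n * φ (run g ω t, x, y, n) ∂M.νN k (t + 1) ∂M.νY (t + 1) k
        ∂M.νX (t + 1) ∂M.P := by
  let A : (M.X t × M.Com t × (∀ j, M.Priv t j)) → ∀ j, M.U t j :=
    fun r j => (g j).1 t (r.2.1, r.2.2 j)
  have hA : Measurable A := measurable_pi_iff.mpr fun j => ((g j).2 t).comp (by fun_prop)
  have hf : Measurable fun p : (M.X t × M.Com t × (∀ j, M.Priv t j)) × M.W t =>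
      M.f t p.1.1 (A p.1) p.2 := (M.measurable_f t).comp
    ((measurable_fst.comp measurable_fst).prodMk ((hA.comp measurable_fst).prodMk measurable_snd))
  have hn : Measurable fun p : M.X (t + 1) × (∀ j : {j : Fin K // j ≠ k}, M.Z (t + 1) j) =>
      (fun j => M.h (t + 1) j p.1 (p.2 j) : M.NObs k (t + 1)) :=
    measurable_pi_iff.mpr fun j => (M.measurable_h (t + 1) j).comp
      (measurable_fst.prodMk ((measurable_pi_apply j).comp measurable_snd))
  have hk := M.measurable_h (t + 1) k
  let Φ : ((M.X t × M.Com t × (∀ j, M.Priv t j)) × M.W t) × M.Z (t + 1) k ×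
      (∀ j : {j : Fin K // j ≠ k}, M.Z (t + 1) j) → ℝ≥0∞ := fun p =>
    φ (p.1.1, M.f t p.1.1.1 (A p.1.1) p.1.2,
      M.h (t + 1) k (M.f t p.1.1.1 (A p.1.1) p.1.2) p.2.1,
      fun j => M.h (t + 1) j (M.f t p.1.1.1 (A p.1.1) p.1.2) (p.2.2 j))
  have hΦ : Measurable Φ := by
    have h1 : Measurable fun p : ((M.X t × M.Com t × (∀ j, M.Priv t j)) × M.W t) ×
        M.Z (t + 1) k × (∀ j : {j : Fin K // j ≠ k}, M.Z (t + 1) j) =>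
        M.f t p.1.1.1 (A p.1.1) p.1.2 := hf.comp measurable_fst
    exact hφ.comp ((measurable_fst.comp measurable_fst).prodMk (h1.prodMk
      ((hk.comp (h1.prodMk (measurable_fst.comp measurable_snd))).prodMk
        (hn.comp (h1.prodMk (measurable_snd.comp measurable_snd))))))
  have hrun := measurable_run g t
  have hw := M.measurable_w t
  have hzk := M.measurable_z (t + 1) k
  have hzo := measurable_noiseOth (M := M) (k := k) (t := t + 1)
  -- Disjoint groups of noises: those that determine the run up to `t`, the noise of the dynamics,
  -- the own new observation noise, and those of the others. Three applications of independence peel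
  -- them off.
  let Past : Set (Unit ⊕ ℕ ⊕ (ℕ × Fin K)) :=
    {i | i = Sum.inl () ∨ (∃ s < t, i = Sum.inr (Sum.inl s)) ∨
      ∃ s ≤ t, ∃ j, i = Sum.inr (Sum.inr (s, j))}
  let Now : Set (Unit ⊕ ℕ ⊕ (ℕ × Fin K)) := {Sum.inr (Sum.inl t)}
  let Own : Set (Unit ⊕ ℕ ⊕ (ℕ × Fin K)) := {Sum.inr (Sum.inr (t + 1, k))}
  let Oths : Set (Unit ⊕ ℕ ⊕ (ℕ × Fin K)) := {i | ∃ j, j ≠ k ∧ i = Sum.inr (Sum.inr (t + 1, j))}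
  have mrun : ∀ S, Past ⊆ S → Measurable[⨆ i ∈ S, noise M i] fun ω => run g ω t := fun S hS =>
    measurable_run_of g (measurable_X0_noise (hS (Or.inl rfl)))
      (fun s hs => measurable_w_noise (hS (Or.inr (Or.inl ⟨s, hs, rfl⟩))))
      (fun s hs j => measurable_z_noise (hS (Or.inr (Or.inr ⟨s, hs, j, rfl⟩))))
  have mw : ∀ S, Now ⊆ S → Measurable[⨆ i ∈ S, noise M i] (M.w t) := fun S hS =>
    measurable_w_noise (hS rfl)
  have mz : ∀ S, Own ⊆ S → Measurable[⨆ i ∈ S, noise M i] (M.z (t + 1) k) := fun S hS =>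
    measurable_z_noise (hS rfl)
  have mo : ∀ S, Oths ⊆ S → Measurable[⨆ i ∈ S, noise M i] (noiseOth M k (t + 1)) := fun S hS =>
    (@measurable_pi_iff _ _ _ (⨆ i ∈ S, noise M i) _ _).mpr fun j =>
      measurable_z_noise (hS ⟨j.1, j.2, rfl⟩)
  have i1 : IndepFun (fun ω => (run g ω t, M.w t ω))
      (fun ω => (M.z (t + 1) k ω, noiseOth M k (t + 1) ω)) M.P := by
    refine indepFun_of_noise (S := Past ∪ Now) (S' := Own ∪ Oths) ?_
      ((mrun _ Set.subset_union_left).prodMk (mw _ Set.subset_union_right))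
      ((mz _ Set.subset_union_left).prodMk (mo _ Set.subset_union_right))
    rw [Set.disjoint_left]
    rintro i ((rfl | ⟨s, hs, rfl⟩ | ⟨s, hs, j, rfl⟩) | rfl) (h | ⟨j', hj', h⟩)
    all_goals (simp [Own] at h <;> omega)
  have i2 : IndepFun (fun ω => run g ω t) (M.w t) M.P := by
    refine indepFun_of_noise (S := Past) (S' := Now) ?_ (mrun _ le_rfl) (mw _ le_rfl)
    rw [Set.disjoint_left]
    rintro i (rfl | ⟨s, hs, rfl⟩ | ⟨s, hs, j, rfl⟩) h
    all_goals (simp [Now] at h <;> omega)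
  have i3 : IndepFun (M.z (t + 1) k) (noiseOth M k (t + 1)) M.P := by
    refine indepFun_of_noise (S := Own) (S' := Oths) ?_ (mz _ le_rfl) (mo _ le_rfl)
    rw [Set.disjoint_left]
    rintro i rfl ⟨j, hj, h⟩
    simp at h
    exact hj h.symm
  have e0 : ∀ ω, φ (run g ω t, state g (t + 1) ω, obs g k (t + 1) ω,
      fun j => obs g j (t + 1) ω) =
      Φ ((run g ω t, M.w t ω), (M.z (t + 1) k ω, noiseOth M k (t + 1) ω)) := fun ω => rfl
  simp only [e0]
  rw [lintegral_of_indepFun (hrun.prodMk hw) (hzk.prodMk hzo) i1 hΦ]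
  have hΦ1 : Measurable fun p : (M.X t × M.Com t × (∀ j, M.Priv t j)) × M.W t =>
      ∫⁻ ω', Φ (p, (M.z (t + 1) k ω', noiseOth M k (t + 1) ω')) ∂M.P :=
    Measurable.lintegral_prod_right' (f := fun q : ((M.X t × M.Com t × (∀ j, M.Priv t j)) × M.W t) ×
      M.Ω => Φ (q.1, (M.z (t + 1) k q.2, noiseOth M k (t + 1) q.2))) (by fun_prop)
  rw [lintegral_of_indepFun hrun hw i2 hΦ1]
  refine lintegral_congr fun ω => ?_
  let Ψ : M.X (t + 1) → ℝ≥0∞ := fun x => ∫⁻ y, M.Q (t + 1) k x y *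
    ∫⁻ n, QO M k x n * φ (run g ω t, x, y, n) ∂M.νN k (t + 1) ∂M.νY (t + 1) k
  have hΨ0 : Measurable fun p : M.X (t + 1) × M.Y (t + 1) k =>
      ∫⁻ n, QO M k p.1 n * φ (run g ω t, p.1, p.2, n) ∂M.νN k (t + 1) := by
    refine Measurable.lintegral_prod_right' (f := fun q : (M.X (t + 1) × M.Y (t + 1) k) ×
      M.NObs k (t + 1) => QO M k q.1.1 q.2 * φ (run g ω t, q.1.1, q.1.2, q.2)) ?_
    exact (measurable_QO.comp ((measurable_fst.comp measurable_fst).prodMk measurable_snd)).mul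
      (hφ.comp (measurable_const.prodMk ((measurable_fst.comp measurable_fst).prodMk
        ((measurable_snd.comp measurable_fst).prodMk measurable_snd))))
  have hΨ : Measurable Ψ := by
    refine Measurable.lintegral_prod_right' (f := fun q : M.X (t + 1) × M.Y (t + 1) k =>
      M.Q (t + 1) k q.1 q.2 * ∫⁻ n, QO M k q.1 n * φ (run g ω t, q.1, q.2, n)
        ∂M.νN k (t + 1)) ?_
    exact (M.measurable_Q (t + 1) k).mul hΨ0
  have e1 : ∀ ω', ∫⁻ ω'', Φ ((run g ω t, M.w t ω'), (M.z (t + 1) k ω'',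
      noiseOth M k (t + 1) ω'')) ∂M.P =
      Ψ (M.f t (state g t ω) (act g t ω) (M.w t ω')) := by
    intro ω'
    set x := M.f t (state g t ω) (act g t ω) (M.w t ω') with hx
    rw [lintegral_of_indepFun hzk hzo i3 (F := fun p => Φ ((run g ω t, M.w t ω'), p))
      (hΦ.comp measurable_prodMk_left)]
    have e2 : ∀ ω'', ∫⁻ ω₃, Φ ((run g ω t, M.w t ω'), (M.z (t + 1) k ω'',
        noiseOth M k (t + 1) ω₃)) ∂M.P =
        ∫⁻ n, QO M k x n * φ (run g ω t, x, M.h (t + 1) k x (M.z (t + 1) k ω''), n)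
          ∂M.νN k (t + 1) := fun ω'' =>
      lintegral_noise_oth x (F := fun n => φ (run g ω t, x,
        M.h (t + 1) k x (M.z (t + 1) k ω''), n)) (hφ.comp (by fun_prop))
    simp only [e2]
    exact lintegral_noise_own x (F := fun y => ∫⁻ n, QO M k x n * φ (run g ω t, x, y, n)
      ∂M.νN k (t + 1)) (hΨ0.comp measurable_prodMk_left)
  simp only [e1]
  exact lintegral_noise_state _ _ hΨ

end Model

end DelayedSharing

namespace DelayedSharing

namespace Model

open scoped NNReal

variable {K : ℕ} {M : Model K} {k : Fin K} {t : ℕ}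

/-! ### Shifted costs -/

variable (M) in
/-- A nonnegative number `m` with `-m ≤ c_t`. -/
noncomputable def slackC (t : ℕ) : ℝ≥0 := (-(M.bddBelow_c t).choose).toNNReal

variable (M) in
/-- A nonnegative number `m` with `-m ≤ c_T`. -/
noncomputable def slackT : ℝ≥0 := (-M.bddBelow_cT.choose).toNNReal

/-- The running cost, shifted so as to be nonnegative. -/
noncomputable def posC (t : ℕ) (x : M.X t) (u : ∀ j, M.U t j) : ℝ≥0∞ :=
  (M.c t x u + (slackC M t : ℝ)).toENNReal

/-- The terminal cost, shifted so as to be nonnegative. -/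
noncomputable def posT (x : M.X M.T) : ℝ≥0∞ := (M.cT x + (slackT M : ℝ)).toENNReal

theorem neg_toNNReal_neg_le (m : ℝ) : -(((-m).toNNReal : ℝ≥0) : ℝ) ≤ m := by
  have := Real.le_coe_toNNReal (-m)
  linarith

theorem shift_posC (t : ℕ) (x : M.X t) (u : ∀ j, M.U t j) :
    shift (slackC M t) (posC t x u) = M.c t x u :=
  exists_shift_of_le (le_trans (by exact_mod_cast neg_toNNReal_neg_le _)
    ((M.bddBelow_c t).choose_spec x u))

theorem shift_posT (x : M.X M.T) : shift (slackT M) (posT x) = M.cT x :=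
  exists_shift_of_le (le_trans (by exact_mod_cast neg_toNNReal_neg_le _)
    (M.bddBelow_cT.choose_spec x))

theorem measurable_posC (t : ℕ) : Measurable fun p : M.X t × (∀ j, M.U t j) => posC t p.1 p.2 :=
  measurable_ereal_toENNReal.comp ((M.measurable_c t).add measurable_const)

theorem measurable_posT : Measurable (posT : M.X M.T → ℝ≥0∞) :=
  measurable_ereal_toENNReal.comp (M.measurable_cT.add measurable_const)

variable (M) in
/-- The sum of the shifts of the costs over `{t, …, T}`. -/
noncomputable def slack (t : ℕ) : ℝ≥0 := (∑ s ∈ Finset.Ico t M.T, slackC M s) + slackT M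

theorem slack_T : slack M M.T = slackT M := by simp [slack]

theorem slack_of_lt (ht : t < M.T) : slack M t = slackC M t + slack M (t + 1) := by
  rw [slack, slack, Finset.sum_eq_sum_Ico_succ_bot ht, add_assoc]

/-! ### The filter in terms of the observations of the others

The actions of the others being a function `G` of their observations, a density of the state and of
the private information of the others is represented by a density of the state and of their
private observations. -/

variable (M k t) in
/-- Densities of the state and of the private observations of the others. -/
abbrev RBel := M.X t × M.OObs k t → ℝ≥0∞

/-- The joint density of the new state and of the old private observations of the others. -/
noncomputable def predDens (g : M.Profile) (δ : M.Com t) (ζ : M.RBel k t)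
    (G : M.OObs k t → M.OAct k t) (u : M.U t k) (p : M.X (t + 1) × M.OObs k t) : ℝ≥0∞ :=
  ∫⁻ x, M.S t x (jointAct g δ (mkOth p.2 (G p.2)) u) p.1 * ζ (x, p.2) ∂M.νX t

/-- The unnormalized new density, given the shared observations `o` and the observation `y`. -/
noncomputable def numDens (g : M.Profile) (δ : M.Com t) (ζ : M.RBel k t)
    (G : M.OObs k t → M.OAct k t) (u : M.U t k) (y : M.Y (t + 1) k) (o : M.Old k t) :
    M.RBel k (t + 1) := fun p =>
  M.Q (t + 1) k p.1 y * QO M k p.1 (newest p.2) * predDens g δ ζ G u (p.1, merge o p.2)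

/-- The normalizing constant. -/
noncomputable def totalDens (g : M.Profile) (δ : M.Com t) (ζ : M.RBel k t)
    (G : M.OObs k t → M.OAct k t) (u : M.U t k) (y : M.Y (t + 1) k) (o : M.Old k t) : ℝ≥0∞ :=
  ∫⁻ x, ∫⁻ a, numDens g δ ζ G u y o (x, a) ∂M.νO k (t + 1) ∂M.νX (t + 1)

/-- The new density. -/
noncomputable def newDens (g : M.Profile) (δ : M.Com t) (ζ : M.RBel k t)
    (G : M.OObs k t → M.OAct k t) (u : M.U t k) (y : M.Y (t + 1) k) (o : M.Old k t) :
    M.RBel k (t + 1) := fun p => numDens g δ ζ G u y o p / totalDens g δ ζ G u y o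

/-- The joint density of the new observation and of the old private observations of the others. -/
noncomputable def obsDens (g : M.Profile) (δ : M.Com t) (ζ : M.RBel k t)
    (G : M.OObs k t → M.OAct k t) (u : M.U t k) (p : M.Y (t + 1) k × M.OObs k t) : ℝ≥0∞ :=
  ∫⁻ x, M.Q (t + 1) k x p.1 * predDens g δ ζ G u (x, p.2) ∂M.νX (t + 1)

/-- Jointly measurable families of data of the recursion. -/
structure MFam {B : Type*} [MeasurableSpace B] (ζ : B → M.RBel k t)
    (G : B → M.OObs k t → M.OAct k t) (i : B → M.Com t × M.Priv t k) : Prop where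
  dens : Measurable fun p : B × (M.X t × M.OObs k t) => ζ p.1 p.2
  rule : Measurable fun p : B × M.OObs k t => G p.1 p.2
  info : Measurable i

namespace MFam

variable {B : Type*} [MeasurableSpace B] {ζ : B → M.RBel k t}
  {G : B → M.OObs k t → M.OAct k t} {i : B → M.Com t × M.Priv t k}

theorem comp (h : MFam ζ G i) {B' : Type*} [MeasurableSpace B'] {d : B' → B} (hd : Measurable d) :
    MFam (fun b => ζ (d b)) (fun b => G (d b)) (fun b => i (d b)) where
  dens := h.dens.comp ((hd.comp measurable_fst).prodMk measurable_snd)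
  rule := h.rule.comp ((hd.comp measurable_fst).prodMk measurable_snd)
  info := h.info.comp hd

theorem mkOth (h : MFam ζ G i) : Measurable fun p : B × M.OObs k t => mkOth p.2 (G p.1 p.2) :=
  measurable_mkOth.comp (measurable_snd.prodMk h.rule)

theorem jointAct (h : MFam ζ G i) (g : M.Profile) {u : B → M.U t k} (hu : Measurable u) :
    Measurable fun p : B × M.OObs k t =>
      jointAct g (i p.1).1 (Model.mkOth p.2 (G p.1 p.2)) (u p.1) :=
  (measurable_jointAct g).comp ((measurable_fst.comp (h.info.comp measurable_fst)).prodMk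
    (h.mkOth.prodMk (hu.comp measurable_fst)))

theorem predDens (h : MFam ζ G i) (g : M.Profile) {u : B → M.U t k} (hu : Measurable u) :
    Measurable fun p : B × (M.X (t + 1) × M.OObs k t) =>
      predDens g (i p.1).1 (ζ p.1) (G p.1) (u p.1) p.2 := by
  refine Measurable.lintegral_prod_right' (f := fun q : (B × (M.X (t + 1) × M.OObs k t)) × M.X t =>
    M.S t q.2 (Model.jointAct g (i q.1.1).1 (Model.mkOth q.1.2.2 (G q.1.1 q.1.2.2)) (u q.1.1))
      q.1.2.1 * ζ q.1.1 (q.2, q.1.2.2)) ?_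
  refine Measurable.mul ?_ ?_
  · exact (M.measurable_S t).comp (measurable_snd.prodMk (((h.jointAct g hu).comp
      ((measurable_fst.comp measurable_fst).prodMk
        (measurable_snd.comp (measurable_snd.comp measurable_fst)))).prodMk
      (measurable_fst.comp (measurable_snd.comp measurable_fst))))
  · exact h.dens.comp ((measurable_fst.comp measurable_fst).prodMk (measurable_snd.prodMk
      (measurable_snd.comp (measurable_snd.comp measurable_fst))))

theorem numDens (h : MFam ζ G i) (g : M.Profile) {u : B → M.U t k} (hu : Measurable u)
    {y : B → M.Y (t + 1) k} (hy : Measurable y) {o : B → M.Old k t} (ho : Measurable o) :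
    Measurable fun p : B × (M.X (t + 1) × M.OObs k (t + 1)) =>
      numDens g (i p.1).1 (ζ p.1) (G p.1) (u p.1) (y p.1) (o p.1) p.2 := by
  refine Measurable.mul (Measurable.mul ?_ ?_) ?_
  · exact (M.measurable_Q (t + 1) k).comp ((measurable_fst.comp measurable_snd).prodMk
      (hy.comp measurable_fst))
  · exact measurable_QO.comp ((measurable_fst.comp measurable_snd).prodMk
      (measurable_newest.comp (measurable_snd.comp measurable_snd)))
  · exact (h.predDens g hu).comp (measurable_fst.prodMk ((measurable_fst.comp measurable_snd).prodMk
      (measurable_merge.comp ((ho.comp measurable_fst).prodMk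
        (measurable_snd.comp measurable_snd)))))

theorem totalDens (h : MFam ζ G i) (g : M.Profile) {u : B → M.U t k} (hu : Measurable u)
    {y : B → M.Y (t + 1) k} (hy : Measurable y) {o : B → M.Old k t} (ho : Measurable o) :
    Measurable fun b : B => totalDens g (i b).1 (ζ b) (G b) (u b) (y b) (o b) := by
  have h1 : Measurable fun p : B × M.X (t + 1) => ∫⁻ a, Model.numDens g (i p.1).1 (ζ p.1) (G p.1)
      (u p.1) (y p.1) (o p.1) (p.2, a) ∂M.νO k (t + 1) :=
    Measurable.lintegral_prod_right' (f := fun q : (B × M.X (t + 1)) × M.OObs k (t + 1) =>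
      Model.numDens g (i q.1.1).1 (ζ q.1.1) (G q.1.1) (u q.1.1) (y q.1.1) (o q.1.1) (q.1.2, q.2))
      ((h.numDens g hu hy ho).comp ((measurable_fst.comp measurable_fst).prodMk
        ((measurable_snd.comp measurable_fst).prodMk measurable_snd)))
  exact Measurable.lintegral_prod_right' h1

theorem newDens (h : MFam ζ G i) (g : M.Profile) {u : B → M.U t k} (hu : Measurable u)
    {y : B → M.Y (t + 1) k} (hy : Measurable y) {o : B → M.Old k t} (ho : Measurable o) :
    Measurable fun p : B × (M.X (t + 1) × M.OObs k (t + 1)) =>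
      newDens g (i p.1).1 (ζ p.1) (G p.1) (u p.1) (y p.1) (o p.1) p.2 := by
  have h1 := h.numDens g hu hy ho
  have h2 := (h.totalDens g hu hy ho).comp
    (measurable_fst : Measurable fun p : B × (M.X (t + 1) × M.OObs k (t + 1)) => p.1)
  exact h1.div h2

theorem obsDens (h : MFam ζ G i) (g : M.Profile) {u : B → M.U t k} (hu : Measurable u) :
    Measurable fun p : B × (M.Y (t + 1) k × M.OObs k t) =>
      obsDens g (i p.1).1 (ζ p.1) (G p.1) (u p.1) p.2 := by
  refine Measurable.lintegral_prod_right' (f := fun q : (B × (M.Y (t + 1) k × M.OObs k t)) ×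
    M.X (t + 1) => M.Q (t + 1) k q.2 q.1.2.1 * Model.predDens g (i q.1.1).1 (ζ q.1.1) (G q.1.1)
      (u q.1.1) (q.2, q.1.2.2)) ?_
  refine Measurable.mul ?_ ?_
  · exact (M.measurable_Q (t + 1) k).comp (measurable_snd.prodMk
      (measurable_fst.comp (measurable_snd.comp measurable_fst)))
  · exact (h.predDens g hu).comp ((measurable_fst.comp measurable_fst).prodMk
      (measurable_snd.prodMk (measurable_snd.comp (measurable_snd.comp measurable_fst))))

/-- The family of the data at time `t + 1`. -/
theorem next (h : MFam ζ G i) (g : M.Profile) {u : B → M.U t k} (hu : Measurable u) :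
    MFam (B := B × (M.Y (t + 1) k × M.OObs k t))
      (fun b => Model.newDens g (i b.1).1 (ζ b.1) (G b.1) (u b.1) b.2.1 (oldObs b.2.2))
      (fun b => nextRule g (i b.1).1 (G b.1) (oldObs b.2.2))
      (fun b => nextInfo g (i b.1) (u b.1) b.2.1 (Model.mkOth b.2.2 (G b.1 b.2.2))) := by
  have hf : Measurable fun b : B × (M.Y (t + 1) k × M.OObs k t) => b.1 := measurable_fst
  have ho : Measurable fun b : B × (M.Y (t + 1) k × M.OObs k t) => oldObs b.2.2 :=
    measurable_oldObs.comp (measurable_snd.comp measurable_snd)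
  have hy : Measurable fun b : B × (M.Y (t + 1) k × M.OObs k t) => b.2.1 :=
    measurable_fst.comp measurable_snd
  have h' := h.comp hf
  have h1 := h.mkOth.comp (hf.prodMk (measurable_snd.comp measurable_snd :
    Measurable fun b : B × (M.Y (t + 1) k × M.OObs k t) => b.2.2))
  have hu' : Measurable fun b : B × (M.Y (t + 1) k × M.OObs k t) => u b.1 := hu.comp hf
  have h2 := h'.newDens g hu' hy ho
  refine ⟨?_, ?_, ?_⟩
  · exact h2
  · have hδ : Measurable fun b : B × (M.Y (t + 1) k × M.OObs k t) => (i b.1).1 :=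
      measurable_fst.comp h'.info
    have hG : Measurable fun p : (B × (M.Y (t + 1) k × M.OObs k t)) × M.OObs k t =>
      G p.1.1 p.2 := h'.rule
    exact measurable_nextRule g hδ (G := fun b => G b.1) hG ho
  · exact (measurable_nextInfo g).comp (h'.info.prodMk (hu'.prodMk (hy.prodMk h1)))

end MFam

/-! ### The recursion in terms of the observations of the others -/

/-- The expected running cost. -/
noncomputable def runCost (g : M.Profile) (ζ : M.RBel k t) (G : M.OObs k t → M.OAct k t)
    (i : M.Com t × M.Priv t k) (u : M.U t k) : ℝ≥0∞ :=
  ∫⁻ x, ∫⁻ a, posC t x (jointAct g i.1 (mkOth a (G a)) u) * ζ (x, a) ∂M.νO k t ∂M.νX t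

/-- The expected terminal cost. -/
noncomputable def termCost (ζ : M.RBel k M.T) : ℝ≥0∞ :=
  ∫⁻ x, ∫⁻ a, posT x * ζ (x, a) ∂M.νO k M.T ∂M.νX M.T

variable (M k) in
/-- Value functions of the reduced recursion. -/
abbrev RVal := ∀ t, M.RBel k t → (M.OObs k t → M.OAct k t) → M.Com t × M.Priv t k → ℝ≥0∞

/-- The value function at the data of time `t + 1`. -/
noncomputable def nextVal (g : M.Profile) (v : RVal M k) (ζ : M.RBel k t)
    (G : M.OObs k t → M.OAct k t) (i : M.Com t × M.Priv t k) (u : M.U t k)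
    (p : M.Y (t + 1) k × M.OObs k t) : ℝ≥0∞ :=
  v (t + 1) (newDens g i.1 ζ G u p.1 (oldObs p.2)) (nextRule g i.1 G (oldObs p.2))
    (nextInfo g i u p.1 (mkOth p.2 (G p.2)))

/-- The expression under the infimum in the reduced recursion. -/
noncomputable def redStep (g : M.Profile) (v : RVal M k) (ζ : M.RBel k t)
    (G : M.OObs k t → M.OAct k t) (i : M.Com t × M.Priv t k) (u : M.U t k) : ℝ≥0∞ :=
  runCost g ζ G i u + ∫⁻ y, ∫⁻ a, ((obsDens g i.1 ζ G u (y, a)).toNNReal : ℝ≥0∞) *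
    nextVal g v ζ G i u (y, a) ∂M.νO k t ∂M.νY (t + 1) k

/-- Solutions of the reduced recursion. -/
def IsRed (g : M.Profile) (v : RVal M k) : Prop :=
  (∀ ζ G i, v M.T ζ G i = termCost ζ) ∧
  ∀ t < M.T, ∀ ζ G i, v t ζ G i = ⨅ u : M.U t k, redStep g v ζ G i u

/-- Backward recursions have solutions. -/
theorem exists_backward {α : ℕ → Type*} [∀ t, Nonempty (α t)] (T : ℕ) (a : α T)
    (step : ∀ t, α (t + 1) → α t) :
    ∃ V : ∀ t, α t, V T = a ∧ ∀ t < T, V t = step t (V (t + 1)) := by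
  have key : ∀ m ≤ T, ∃ V : ∀ t, α t, V T = a ∧ ∀ t, T - m ≤ t → t < T → V t = step t (V (t + 1)) := by
    intro m
    induction m with
    | zero =>
      intro _
      exact ⟨Function.update (fun t => Classical.arbitrary (α t)) T a, by simp, fun t h1 h2 => by
        omega⟩
    | succ m ih =>
      intro hm
      obtain ⟨V, h1, h2⟩ := ih (by omega)
      -- The time `T - (m + 1)` is one step before those already settled, so changing the value
      -- there leaves the settled equations intact.
      refine ⟨Function.update V (T - (m + 1)) (step _ (V (T - (m + 1) + 1))), ?_, fun t h3 h4 => ?_⟩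
      · rw [Function.update_of_ne (by omega), h1]
      · rw [Function.update_of_ne (show t + 1 ≠ T - (m + 1) by omega)]
        by_cases ht : t = T - (m + 1)
        · subst ht
          rw [Function.update_self]
        · rw [Function.update_of_ne ht]
          exact h2 t (by omega) h4
  obtain ⟨V, h1, h2⟩ := key T le_rfl
  exact ⟨V, h1, fun t ht => h2 t (by omega) ht⟩

theorem exists_isRed (g : M.Profile) : ∃ v : RVal M k, IsRed g v := by
  obtain ⟨v, h1, h2⟩ := exists_backward
    (α := fun t => M.RBel k t → (M.OObs k t → M.OAct k t) → M.Com t × M.Priv t k → ℝ≥0∞) M.T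
    (fun ζ _ _ => termCost ζ) (fun t v' ζ G i => ⨅ u : M.U t k,
      (runCost g ζ G i u + ∫⁻ y, ∫⁻ a, ((obsDens g i.1 ζ G u (y, a)).toNNReal : ℝ≥0∞) *
        v' (newDens g i.1 ζ G u y (oldObs a)) (nextRule g i.1 G (oldObs a))
          (nextInfo g i u y (mkOth a (G a))) ∂M.νO k t ∂M.νY (t + 1) k))
  exact ⟨v, fun ζ G i => by rw [h1], fun t ht ζ G i => by rw [h2 t ht]; rfl⟩

theorem exists_isDPSolution (g : M.Profile) (k : Fin K) : ∃ V, IsDPSolution (M := M) g k V := by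
  obtain ⟨V, h1, h2⟩ := exists_backward (α := fun t => M.Bel k t → M.Com t × M.Priv t k → EReal) M.T
    (fun ξ _ => dpTerm ξ) (fun t V' ξ i => ⨅ u : M.U t k, dpStep g V' ξ i u)
  exact ⟨V, fun ξ i _ => by rw [h1], fun t ht ξ i _ => by rw [h2 t ht]⟩

section Family

variable {B : Type*} [MeasurableSpace B] {ζ : B → M.RBel k t}
  {G : B → M.OObs k t → M.OAct k t} {i : B → M.Com t × M.Priv t k}

theorem MFam.runCost (h : MFam ζ G i) (g : M.Profile) :
    Measurable fun p : B × M.U t k => runCost g (ζ p.1) (G p.1) (i p.1) p.2 := by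
  have h' := h.comp (measurable_fst : Measurable fun p : B × M.U t k => p.1)
  have h1 : Measurable fun q : (B × M.U t k) × M.X t => ∫⁻ a, posC t q.2
      (Model.jointAct g (i q.1.1).1 (Model.mkOth a (G q.1.1 a)) q.1.2) * ζ q.1.1 (q.2, a) ∂M.νO k t := by
    refine Measurable.lintegral_prod_right' (f := fun r : ((B × M.U t k) × M.X t) × M.OObs k t =>
      posC t r.1.2 (Model.jointAct g (i r.1.1.1).1 (Model.mkOth r.2 (G r.1.1.1 r.2)) r.1.1.2) *
        ζ r.1.1.1 (r.1.2, r.2)) ?_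
    refine Measurable.mul ?_ ?_
    · exact (measurable_posC t).comp ((measurable_snd.comp measurable_fst).prodMk
        ((h'.jointAct g measurable_snd).comp ((measurable_fst.comp measurable_fst).prodMk
          measurable_snd)))
    · exact h'.dens.comp ((measurable_fst.comp measurable_fst).prodMk
        ((measurable_snd.comp measurable_fst).prodMk measurable_snd))
  exact Measurable.lintegral_prod_right' h1

theorem measurable_termCost {ζ : B → M.RBel k M.T}
    (h : Measurable fun p : B × (M.X M.T × M.OObs k M.T) => ζ p.1 p.2) :
    Measurable fun b => termCost (ζ b) := by
  have h1 : Measurable fun q : B × M.X M.T => ∫⁻ a, posT q.2 * ζ q.1 (q.2, a) ∂M.νO k M.T := by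
    refine Measurable.lintegral_prod_right' (f := fun r : (B × M.X M.T) × M.OObs k M.T =>
      posT r.1.2 * ζ r.1.1 (r.1.2, r.2)) ?_
    exact (measurable_posT.comp (measurable_snd.comp measurable_fst)).mul
      (h.comp ((measurable_fst.comp measurable_fst).prodMk
        ((measurable_snd.comp measurable_fst).prodMk measurable_snd)))
  exact Measurable.lintegral_prod_right' h1

end Family

/-- It is enough to consider families that are parametrized by the real line. -/
theorem lsa_of_real {φ : M.RBel k t → (M.OObs k t → M.OAct k t) → M.Com t × M.Priv t k → ℝ≥0∞}
    (hφ : ∀ {ζ : ℝ → M.RBel k t} {G : ℝ → M.OObs k t → M.OAct k t}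
      {i : ℝ → M.Com t × M.Priv t k}, MFam ζ G i → LSA fun b => φ (ζ b) (G b) (i b))
    {B : Type*} [MeasurableSpace B] [StandardBorelSpace B] {ζ : B → M.RBel k t}
    {G : B → M.OObs k t → M.OAct k t} {i : B → M.Com t × M.Priv t k} (h : MFam ζ G i) :
    LSA fun b => φ (ζ b) (G b) (i b) := by
  by_cases hB : Nonempty B
  · obtain ⟨e, d, he, hd, hde⟩ := LSA.exists_measurable_leftInverse_real B
    have := (hφ (h.comp hd)).comp he
    simpa only [hde] using this
  · rw [not_nonempty_iff] at hB
    exact LSA.of_measurable (measurable_of_empty _)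

/-- The measurable running cost is added to an integral of a finite measurable density times the
next value. The data of time `t + 1` form a measurable family over a larger parameter space, so the
closure properties of `LSA` apply. -/
theorem lsa_redStep_of_next {g : M.Profile} {v : RVal M k}
    (hv : ∀ {ζ : ℝ → M.RBel k (t + 1)} {G : ℝ → M.OObs k (t + 1) → M.OAct k (t + 1)}
      {i : ℝ → M.Com (t + 1) × M.Priv (t + 1) k}, MFam ζ G i →
      LSA fun b => v (t + 1) (ζ b) (G b) (i b))
    {B : Type*} [MeasurableSpace B] [StandardBorelSpace B] {ζ : B → M.RBel k t}
    {G : B → M.OObs k t → M.OAct k t} {i : B → M.Com t × M.Priv t k} (h : MFam ζ G i) :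
    LSA fun p : B × M.U t k => redStep g v (ζ p.1) (G p.1) (i p.1) p.2 := by
  have h' := h.comp (measurable_fst : Measurable fun p : B × M.U t k => p.1)
  refine LSA.measurable_add (h.runCost g) ?_
  have h1 : LSA fun q : (B × M.U t k) × (M.Y (t + 1) k × M.OObs k t) =>
      ((Model.obsDens g (i q.1.1).1 (ζ q.1.1) (G q.1.1) q.1.2 q.2).toNNReal : ℝ≥0∞) *
        nextVal g v (ζ q.1.1) (G q.1.1) (i q.1.1) q.1.2 q.2 :=
    LSA.measurable_mul (h'.obsDens g measurable_snd).ennreal_toNNReal.coe_nnreal_ennreal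
      (fun _ => ENNReal.coe_ne_top) (lsa_of_real hv (h'.next g measurable_snd))
  have h2 : LSA fun q : (B × M.U t k) × M.Y (t + 1) k => ∫⁻ a,
      ((Model.obsDens g (i q.1.1).1 (ζ q.1.1) (G q.1.1) q.1.2 (q.2, a)).toNNReal : ℝ≥0∞) *
        nextVal g v (ζ q.1.1) (G q.1.1) (i q.1.1) q.1.2 (q.2, a) ∂M.νO k t :=
    LSA.lintegral (f := fun r : ((B × M.U t k) × M.Y (t + 1) k) × M.OObs k t =>
      ((Model.obsDens g (i r.1.1.1).1 (ζ r.1.1.1) (G r.1.1.1) r.1.1.2 (r.1.2, r.2)).toNNReal : ℝ≥0∞) *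
        nextVal g v (ζ r.1.1.1) (G r.1.1.1) (i r.1.1.1) r.1.1.2 (r.1.2, r.2))
      (h1.comp (g := fun r : ((B × M.U t k) × M.Y (t + 1) k) × M.OObs k t =>
        (r.1.1, (r.1.2, r.2))) (by fun_prop)) _
  exact LSA.lintegral h2 _

/-- Each backward step enlarges the parameter space by an action and by observations. Encoding
parameters as real numbers allows an induction hypothesis about one fixed type. -/
theorem lsa_value_real [∀ t, Nonempty (M.U t k)] {g : M.Profile} {v : RVal M k} (hv : IsRed g v) :
    ∀ (m t : ℕ), t + m = M.T → ∀ {ζ : ℝ → M.RBel k t} {G : ℝ → M.OObs k t → M.OAct k t}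
      {i : ℝ → M.Com t × M.Priv t k}, MFam ζ G i → LSA fun b => v t (ζ b) (G b) (i b) := by
  intro m
  induction m with
  | zero =>
    intro t ht ζ G i h
    obtain rfl : t = M.T := ht
    simp only [hv.1]
    exact LSA.of_measurable (measurable_termCost h.dens)
  | succ m ih =>
    intro t ht ζ G i h
    simp only [hv.2 t (by omega)]
    exact LSA.iInf (lsa_redStep_of_next (ih (t + 1) (by omega)) h)

/-- The value functions of the reduced recursion are lower semianalytic. -/
theorem lsa_value [∀ t, Nonempty (M.U t k)] {g : M.Profile} {v : RVal M k} (hv : IsRed g v)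
    (ht : t ≤ M.T) {B : Type*} [MeasurableSpace B] [StandardBorelSpace B] {ζ : B → M.RBel k t}
    {G : B → M.OObs k t → M.OAct k t} {i : B → M.Com t × M.Priv t k} (h : MFam ζ G i) :
    LSA fun b => v t (ζ b) (G b) (i b) :=
  lsa_of_real (lsa_value_real hv (M.T - t) t (by omega)) h

theorem lsa_redStep [∀ t, Nonempty (M.U t k)] {g : M.Profile} {v : RVal M k} (hv : IsRed g v)
    (ht : t < M.T) {B : Type*} [MeasurableSpace B] [StandardBorelSpace B] {ζ : B → M.RBel k t}
    {G : B → M.OObs k t → M.OAct k t} {i : B → M.Com t × M.Priv t k} (h : MFam ζ G i) :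
    LSA fun p : B × M.U t k => redStep g v (ζ p.1) (G p.1) (i p.1) p.2 :=
  lsa_redStep_of_next (lsa_value_real hv (M.T - (t + 1)) (t + 1) (by omega)) h

end Model

end DelayedSharing

namespace DelayedSharing

namespace Model

open scoped NNReal

variable {K : ℕ} {M : Model K} {k : Fin K} {t : ℕ}

/-! ### Densities that are represented by densities of the observations -/

open Classical in
/-- The density `ξ` is `ζ` times the indicator of the graph of `G`. -/
def Rep (ξ : M.Bel k t) (ζ : M.RBel k t) (G : M.OObs k t → M.OAct k t) : Prop :=
  ∀ᵐ p ∂((M.νX t).prod (M.νO k t)), ∀ v,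
    ξ (p.1, mkOth p.2 v) = if v = G p.2 then ζ p else 0

/-- A probability density that is represented by measurable causal data. -/
structure Good (ξ : M.Bel k t) (ζ : M.RBel k t) (G : M.OObs k t → M.OAct k t) : Prop where
  pdf : IsPDF ξ
  rep : Rep ξ ζ G
  dens : Measurable ζ
  rule : Measurable G
  causal : Causal G

variable {ξ : M.Bel k t} {ζ : M.RBel k t} {G : M.OObs k t → M.OAct k t}

/-- In the sum over actions only the term at `G a` survives. No measurability of `F` is required,
which matters for values of `V`. -/
theorem Rep.intBel (h : Rep ξ ζ G) (F : M.X t × M.Oth k t → ℝ≥0∞) :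
    intBel ξ F = ∫⁻ x, ∫⁻ a, F (x, mkOth a (G a)) * ζ (x, a) ∂M.νO k t ∂M.νX t := by
  refine lintegral_congr_ae ?_
  filter_upwards [Measure.ae_ae_of_ae_prod h] with x hx
  refine lintegral_congr_ae ?_
  filter_upwards [hx] with a ha
  change ∑' v, F (x, mkOth a v) * ξ (x, mkOth a v) = _
  rw [tsum_eq_single (G a), ha, if_pos rfl]
  intro v hv
  rw [ha, if_neg hv, mul_zero]

theorem Rep.intPred (h : Rep ξ ζ G) (g : M.Profile) (δ : M.Com t) (u : M.U t k)
    (F : M.Y (t + 1) k × M.Oth k t × M.X t × M.X (t + 1) → ℝ≥0∞) :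
    intPred g ξ δ u F = ∫⁻ y, ∫⁻ x, ∫⁻ a, ∫⁻ x', F (y, mkOth a (G a), x, x') *
      (M.Q (t + 1) k x' y * M.S t x (jointAct g δ (mkOth a (G a)) u) x' * ζ (x, a))
        ∂M.νX (t + 1) ∂M.νO k t ∂M.νX t ∂M.νY (t + 1) k := by
  refine lintegral_congr fun y => lintegral_congr_ae ?_
  filter_upwards [Measure.ae_ae_of_ae_prod h] with x hx
  refine lintegral_congr_ae ?_
  filter_upwards [hx] with a ha
  change ∑' v, ∫⁻ x', F (y, mkOth a v, x, x') * (M.Q (t + 1) k x' y *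
    M.S t x (jointAct g δ (mkOth a v) u) x' * ξ (x, mkOth a v)) ∂M.νX (t + 1) = _
  rw [tsum_eq_single (G a), ha, if_pos rfl]
  intro v hv
  rw [ha, if_neg hv]
  simp

/-- Tonelli's theorem for a function that need not be measurable where the density vanishes. -/
theorem lintegral_lintegral_mul_swap {X A : Type*} [MeasurableSpace X] [MeasurableSpace A]
    (μ : Measure X) [SFinite μ] (ν : Measure A) [SFinite ν] {e : X × A → ℝ≥0∞} (he : Measurable e)
    {f f' : A → ℝ≥0∞} (hf' : AEMeasurable f' ν)
    (h : ∀ᵐ a ∂ν, ∫⁻ x, e (x, a) ∂μ ≠ 0 → f a = f' a) :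
    ∫⁻ x, ∫⁻ a, f a * e (x, a) ∂ν ∂μ = ∫⁻ a, (∫⁻ x, e (x, a) ∂μ) * f' a ∂ν := by
  obtain ⟨f'', hf'', hff⟩ := hf'
  have hE : Measurable fun a => ∫⁻ x, e (x, a) ∂μ := he.lintegral_prod_left'
  -- Where the marginal of `e` vanishes, so does `e(·, a)` almost everywhere. There `f` may be
  -- replaced by a measurable version of `f'` without changing the integrand.
  have h1 : ∀ᵐ x ∂μ, ∀ᵐ a ∂ν, ∫⁻ x, e (x, a) ∂μ = 0 → e (x, a) = 0 := by
    have hm : MeasurableSet {p : A × X | ∫⁻ x, e (x, p.1) ∂μ = 0 → e (p.2, p.1) = 0} := by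
      refine MeasurableSet.imp ?_ ?_
      · exact (hE.comp measurable_fst) (measurableSet_singleton 0)
      · exact (he.comp measurable_swap) (measurableSet_singleton 0)
    have h2 : ∀ᵐ a ∂ν, ∀ᵐ x ∂μ, ∫⁻ x, e (x, a) ∂μ = 0 → e (x, a) = 0 := by
      refine Filter.Eventually.of_forall fun a => ?_
      by_cases ha : ∫⁻ x, e (x, a) ∂μ = 0
      · filter_upwards [(lintegral_eq_zero_iff (he.comp measurable_prodMk_right)).mp ha] with x hx
        exact fun _ => hx
      · exact Filter.Eventually.of_forall fun x hx => absurd hx ha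
    exact (Measure.ae_ae_comm hm).mp h2
  have h3 : ∫⁻ x, ∫⁻ a, f a * e (x, a) ∂ν ∂μ = ∫⁻ x, ∫⁻ a, f'' a * e (x, a) ∂ν ∂μ := by
    refine lintegral_congr_ae ?_
    filter_upwards [h1] with x hx
    refine lintegral_congr_ae ?_
    filter_upwards [hx, h, hff] with a h4 h5 h6
    by_cases ha : ∫⁻ x, e (x, a) ∂μ = 0
    · rw [h4 ha, mul_zero, mul_zero]
    · rw [h5 ha, h6]
  rw [h3, lintegral_lintegral_swap ((hf''.comp measurable_snd).mul he).aemeasurable]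
  refine lintegral_congr_ae ?_
  filter_upwards [hff] with a ha
  have hea : Measurable fun x => e (x, a) := he.comp measurable_prodMk_right
  rw [lintegral_const_mul _ hea, ha, mul_comm]

/-! ### Measurability of the filter densities for fixed data -/

section Measurability

theorem MFam.const (hζ : Measurable ζ) (hG : Measurable G) (i : M.Com t × M.Priv t k)
    (B : Type*) [MeasurableSpace B] : MFam (fun _ : B => ζ) (fun _ => G) (fun _ => i) :=
  ⟨hζ.comp measurable_snd, hG.comp measurable_snd, measurable_const⟩

variable (g : M.Profile) (i : M.Com t × M.Priv t k) (u : M.U t k)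

theorem measurable_predDens (hζ : Measurable ζ) (hG : Measurable G) :
    Measurable (predDens g i.1 ζ G u) := by
  have h := ((MFam.const hζ hG i Unit).predDens g (u := fun _ => u) measurable_const)
  exact h.comp (measurable_prodMk_left (x := ()))

theorem measurable_obsDens (hζ : Measurable ζ) (hG : Measurable G) :
    Measurable (obsDens g i.1 ζ G u) := by
  have h := ((MFam.const hζ hG i Unit).obsDens g (u := fun _ => u) measurable_const)
  exact h.comp (measurable_prodMk_left (x := ()))

theorem measurable_numDens (hζ : Measurable ζ) (hG : Measurable G) :
    Measurable fun p : (M.Y (t + 1) k × M.Old k t) × (M.X (t + 1) × M.OObs k (t + 1)) =>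
      numDens g i.1 ζ G u p.1.1 p.1.2 p.2 :=
  (MFam.const hζ hG i (M.Y (t + 1) k × M.Old k t)).numDens g (u := fun _ => u) measurable_const
    measurable_fst measurable_snd

theorem measurable_totalDens (hζ : Measurable ζ) (hG : Measurable G) :
    Measurable fun p : M.Y (t + 1) k × M.Old k t => totalDens g i.1 ζ G u p.1 p.2 :=
  (MFam.const hζ hG i (M.Y (t + 1) k × M.Old k t)).totalDens g (u := fun _ => u) measurable_const
    measurable_fst measurable_snd

theorem measurable_step_right (hG : Measurable G) :
    Measurable fun p : M.X t × M.OObs k t × M.X (t + 1) =>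
      M.S t p.1 (jointAct g i.1 (mkOth p.2.1 (G p.2.1)) u) p.2.2 := by
  refine (M.measurable_S t).comp (measurable_fst.prodMk (Measurable.prodMk ?_
    (measurable_snd.comp measurable_snd)))
  exact (measurable_jointAct g).comp (measurable_const.prodMk ((measurable_mkOth.comp
    ((measurable_fst.comp measurable_snd).prodMk
      (hG.comp (measurable_fst.comp measurable_snd)))).prodMk measurable_const))

end Measurability

/-! ### Mass and marginals of the predictive densities -/

section Total

variable (g : M.Profile) (i : M.Com t × M.Priv t k) (u : M.U t k)

theorem lintegral_predDens (hζ : Measurable ζ) (hG : Measurable G) (a : M.OObs k t) :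
    ∫⁻ x', predDens g i.1 ζ G u (x', a) ∂M.νX (t + 1) = ∫⁻ x, ζ (x, a) ∂M.νX t := by
  have hS := measurable_step_right g i u hG
  have hm : Measurable fun p : M.X (t + 1) × M.X t =>
      M.S t p.2 (jointAct g i.1 (mkOth a (G a)) u) p.1 * ζ (p.2, a) :=
    (hS.comp (measurable_snd.prodMk (measurable_const.prodMk measurable_fst))).mul
      (hζ.comp (measurable_snd.prodMk measurable_const))
  unfold predDens
  rw [lintegral_lintegral_swap hm.aemeasurable]
  refine lintegral_congr fun x => ?_
  dsimp only
  rw [lintegral_mul_const _ (measurable_S_right _ _), lintegral_S, one_mul]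

/-- Prediction preserves mass, since `S` and `Q` integrate to `1`. -/
theorem lintegral_obsDens (hζ : Measurable ζ) (hG : Measurable G) :
    ∫⁻ y, ∫⁻ a, obsDens g i.1 ζ G u (y, a) ∂M.νO k t ∂M.νY (t + 1) k =
      ∫⁻ x, ∫⁻ a, ζ (x, a) ∂M.νO k t ∂M.νX t := by
  have hp := measurable_predDens g i u hζ hG
  rw [lintegral_lintegral_swap (f := fun y a => obsDens g i.1 ζ G u (y, a))
      (measurable_obsDens g i u hζ hG).aemeasurable,
    lintegral_lintegral_swap (f := fun x a => ζ (x, a)) hζ.aemeasurable]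
  refine lintegral_congr fun a => ?_
  rw [← lintegral_predDens g i u hζ hG a]
  have hm : Measurable fun p : M.Y (t + 1) k × M.X (t + 1) =>
      M.Q (t + 1) k p.2 p.1 * predDens g i.1 ζ G u (p.2, a) :=
    ((M.measurable_Q _ _).comp measurable_swap).mul
      (hp.comp (measurable_snd.prodMk measurable_const))
  unfold obsDens
  rw [lintegral_lintegral_swap hm.aemeasurable]
  refine lintegral_congr fun x => ?_
  dsimp only
  rw [lintegral_mul_const _ (measurable_Q_right _ _), lintegral_Q, one_mul]

/-- The normalizing constant is the density of the new observation and of the shared ones. -/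
theorem lintegral_obsDens_mul (hζ : Measurable ζ) (hG : Measurable G) (y : M.Y (t + 1) k)
    {φ : M.Old k t → ℝ≥0∞} (hφ : Measurable φ) :
    ∫⁻ a, obsDens g i.1 ζ G u (y, a) * φ (oldObs a) ∂M.νO k t =
      ∫⁻ o, totalDens g i.1 ζ G u y o * φ o ∂M.νOld k t := by
  have hp := measurable_predDens g i u hζ hG
  have hQ : Measurable fun x => M.Q (t + 1) k x y :=
    (M.measurable_Q (t + 1) k).comp (measurable_id.prodMk measurable_const)
  have hm1 : Measurable fun p : M.OObs k t × M.X (t + 1) =>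
      M.Q (t + 1) k p.2 y * predDens g i.1 ζ G u (p.2, p.1) * φ (oldObs p.1) :=
    ((hQ.comp measurable_snd).mul (hp.comp measurable_swap)).mul
      (hφ.comp (measurable_oldObs.comp measurable_fst))
  have h1 : ∫⁻ a, obsDens g i.1 ζ G u (y, a) * φ (oldObs a) ∂M.νO k t =
      ∫⁻ x, ∫⁻ a, M.Q (t + 1) k x y * predDens g i.1 ζ G u (x, a) * φ (oldObs a)
        ∂M.νO k t ∂M.νX (t + 1) := by
    rw [← lintegral_lintegral_swap hm1.aemeasurable]
    refine lintegral_congr fun a => ?_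
    unfold obsDens
    dsimp only
    rw [lintegral_mul_const]
    exact hQ.mul (hp.comp (measurable_id.prodMk measurable_const))
  have hn : Measurable fun p : M.Old k t × (M.X (t + 1) × M.OObs k (t + 1)) =>
      numDens g i.1 ζ G u y p.1 p.2 :=
    (measurable_numDens g i u hζ hG).comp ((measurable_const.prodMk measurable_fst).prodMk
      measurable_snd)
  have h2 : ∀ x, ∫⁻ a, M.Q (t + 1) k x y * predDens g i.1 ζ G u (x, a) * φ (oldObs a) ∂M.νO k t =
      ∫⁻ o, (∫⁻ a, numDens g i.1 ζ G u y o (x, a) ∂M.νO k (t + 1)) * φ o ∂M.νOld k t := by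
    intro x
    have hF : Measurable fun p : M.OObs k t × M.NObs k (t + 1) =>
        M.Q (t + 1) k x y * predDens g i.1 ζ G u (x, p.1) * φ (oldObs p.1) * QO M k x p.2 :=
      ((measurable_const.mul (hp.comp (measurable_const.prodMk measurable_fst))).mul
        (hφ.comp (measurable_oldObs.comp measurable_fst))).mul
        (measurable_QO.comp (measurable_const.prodMk measurable_snd))
    have h3 := lintegral_νO_νN hF
    have h4 : ∀ a : M.OObs k t, ∫⁻ n, M.Q (t + 1) k x y * predDens g i.1 ζ G u (x, a) *
        φ (oldObs a) * QO M k x n ∂M.νN k (t + 1) =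
        M.Q (t + 1) k x y * predDens g i.1 ζ G u (x, a) * φ (oldObs a) := fun a => by
      have hQO : Measurable fun n => QO M k x n := measurable_QO.comp measurable_prodMk_left
      rw [lintegral_const_mul _ hQO, lintegral_QO, mul_one]
    simp only [h4] at h3
    rw [h3]
    refine lintegral_congr fun o => ?_
    rw [← lintegral_mul_const]
    · refine lintegral_congr fun a => ?_
      rw [oldObs_merge]
      simp only [numDens]
      ring
    · exact hn.comp (measurable_const.prodMk (measurable_const.prodMk measurable_id))
  rw [h1, lintegral_congr h2, lintegral_lintegral_swap]
  · refine lintegral_congr fun o => ?_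
    rw [lintegral_mul_const]
    · rfl
    · exact Measurable.lintegral_prod_right' (hn.comp measurable_prodMk_left)
  · refine (Measurable.mul ?_ (hφ.comp measurable_snd)).aemeasurable
    exact Measurable.lintegral_prod_right' (f := fun q : (M.X (t + 1) × M.Old k t) ×
      M.OObs k (t + 1) => numDens g i.1 ζ G u y q.1.2 (q.1.1, q.2))
      (hn.comp ((measurable_snd.comp measurable_fst).prodMk
        ((measurable_fst.comp measurable_fst).prodMk measurable_snd)))

/-- Properties that hold for almost all shared observations hold almost surely, and the normalizing
constant is almost surely positive and finite. -/
theorem ae_of_obsDens_ne_zero (hζ : Measurable ζ) (hG : Measurable G) {y : M.Y (t + 1) k}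
    (hy : ∫⁻ a, obsDens g i.1 ζ G u (y, a) ∂M.νO k t ≠ ∞) {R : M.Old k t → Prop}
    (hR : ∀ᵐ o ∂M.νOld k t, R o) :
    ∀ᵐ a ∂M.νO k t, obsDens g i.1 ζ G u (y, a) ≠ 0 → R (oldObs a) ∧
      totalDens g i.1 ζ G u y (oldObs a) ≠ 0 ∧ totalDens g i.1 ζ G u y (oldObs a) ≠ ∞ := by
  have hτ : Measurable fun o => totalDens g i.1 ζ G u y o :=
    (measurable_totalDens g i u hζ hG).comp measurable_prodMk_left
  have ho : Measurable fun a => obsDens g i.1 ζ G u (y, a) :=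
    (measurable_obsDens g i u hζ hG).comp measurable_prodMk_left
  -- Testing `lintegral_obsDens_mul` with the indicator of `S`: if `totalDens` vanishes almost
  -- everywhere on `S`, then `obsDens` vanishes at almost all `a` with `oldObs a ∈ S`. The key is
  -- applied to a null set containing the exceptions to `R`, to the zeros of `totalDens`, and to its
  -- infinities.
  have key : ∀ S : Set (M.Old k t), MeasurableSet S →
      (∀ᵐ o ∂M.νOld k t, o ∈ S → totalDens g i.1 ζ G u y o = 0) →
      ∀ᵐ a ∂M.νO k t, obsDens g i.1 ζ G u (y, a) ≠ 0 → oldObs a ∉ S := by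
    intro S hS h
    have h1 := lintegral_obsDens_mul g i u hζ hG y (φ := S.indicator 1)
      (measurable_one.indicator hS)
    have h2 : ∫⁻ o, totalDens g i.1 ζ G u y o * S.indicator 1 o ∂M.νOld k t = 0 := by
      rw [lintegral_congr_ae (g := fun _ => 0), lintegral_zero]
      filter_upwards [h] with o ho
      by_cases hoS : o ∈ S
      · rw [ho hoS, zero_mul]
      · rw [Set.indicator_of_notMem hoS, mul_zero]
    have hm : Measurable fun a => obsDens g i.1 ζ G u (y, a) * S.indicator 1 (oldObs a) :=
      ho.mul ((measurable_one.indicator hS).comp measurable_oldObs)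
    rw [h2, lintegral_eq_zero_iff hm] at h1
    filter_upwards [h1] with a ha h3 h4
    simp only [Set.indicator_of_mem h4, Pi.one_apply, mul_one, Pi.zero_apply] at ha
    exact h3 ha
  have hfin : ∀ᵐ o ∂M.νOld k t, totalDens g i.1 ζ G u y o < ∞ := by
    have h1 := lintegral_obsDens_mul g i u hζ hG y (φ := fun _ => 1) measurable_const
    simp only [mul_one] at h1
    exact ae_lt_top hτ (h1 ▸ hy)
  obtain ⟨S, hSR, hS, hS0⟩ := exists_measurable_superset_of_null hR
  have hS' : ∀ᵐ o ∂M.νOld k t, o ∉ S := measure_eq_zero_iff_ae_notMem.mp hS0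
  filter_upwards [key S hS (hS'.mono fun o h1 h2 => absurd h2 h1),
    key {o | totalDens g i.1 ζ G u y o = 0} (hτ (measurableSet_singleton 0))
      (Filter.Eventually.of_forall fun o h => h),
    key {o | totalDens g i.1 ζ G u y o = ∞} (hτ (measurableSet_singleton ∞))
      (hfin.mono fun o h1 h2 => absurd h2 h1.ne)] with a h1 h2 h3 h4
  exact ⟨by_contra fun h => h1 h4 (hSR h), h2 h4, h3 h4⟩

end Total

end Model

end DelayedSharing

namespace DelayedSharing

namespace Model

open scoped NNReal

variable {K : ℕ} {M : Model K} {k : Fin K} {t : ℕ}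
  {ξ : M.Bel k t} {ζ : M.RBel k t} {G : M.OObs k t → M.OAct k t}

/-! ### The operator in terms of the observations of the others -/

/-- The private information of the others at time `t`, recovered from that at time `t + 1`. -/
theorem prevPriv_mkOth_of_oldObs_eq {a₀ : M.OObs k t} {o : M.Old k t} (h : oldObs a₀ = o)
    (w : M.OAct k t) (a : M.OObs k (t + 1)) (v : M.OAct k (t + 1)) :
    (fun j => prevPriv (mkOth a₀ w j) (mkOth a v j) : M.Oth k t) = mkOth (merge o a)
      (fun j => (prevPriv (mkOth a₀ w j) (mkOth a v j)).2) := by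
  subst h
  rfl

theorem prod_delta_eq (l : M.Oth k (t + 1)) (w : ∀ j : {j : Fin K // j ≠ k}, M.U t j) :
    ((∀ (h : 1 < M.n) (j : {j : Fin K // j ≠ k}), (l j).2 ⟨t, Finset.mem_filter.mpr
      ⟨Finset.mem_range.mpr (by omega), by omega⟩⟩ = w j) →
        ∏ j : {j : Fin K // j ≠ k}, delta (l j) (w j) = 1) ∧
    ((¬ ∀ (h : 1 < M.n) (j : {j : Fin K // j ≠ k}), (l j).2 ⟨t, Finset.mem_filter.mpr
      ⟨Finset.mem_range.mpr (by omega), by omega⟩⟩ = w j) →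
        ∏ j : {j : Fin K // j ≠ k}, delta (l j) (w j) = 0) := by
  refine ⟨fun h => Finset.prod_eq_one fun j _ => ?_, fun h => ?_⟩
  · by_cases hn : 1 < M.n
    · simp [delta, hn, h hn j]
    · simp [delta, hn]
  · push Not at h
    obtain ⟨hn, j, hj⟩ := h
    exact Finset.prod_eq_zero (Finset.mem_univ j) (by simp [delta, hn, hj])

theorem nextRule_of_lt (g : M.Profile) (δ : M.Com t) (G : M.OObs k t → M.OAct k t) (o : M.Old k t)
    (a : M.OObs k (t + 1)) (j : {j : Fin K // j ≠ k}) (s : ActWin M.n (t + 1)) (hs : s.1 < t) :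
    nextRule g δ G o a j s = G (merge o a) j ⟨s.1, Finset.mem_filter.mpr
      ⟨Finset.mem_range.mpr hs, by have := actWin_lt' s; omega⟩⟩ := by
  simp only [nextRule, othAct, nextOth, nextPriv, hs, dite_true]
  rfl

theorem nextRule_self (g : M.Profile) (δ : M.Com t) (G : M.OObs k t → M.OAct k t) (o : M.Old k t)
    (a : M.OObs k (t + 1)) (j : {j : Fin K // j ≠ k}) (h : t ∈ (Finset.range (t + 1)).filter
      fun s => t + 1 < s + M.n) :
    nextRule g δ G o a j ⟨t, h⟩ = (g j).1 t (δ, mkOth (merge o a) (G (merge o a)) j) := by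
  simp only [nextRule, othAct, nextOth, nextPriv, lt_irrefl, dite_false]

-- The operator rebuilds the information of time `t`: observations `b = merge o a`, and actions `w`
-- taken from `v`, except for the shared ones, which come from `G a₀`. The density `ξ` requires `w =
-- G b`, and the delta functions require the newest actions in `v` to be those of the strategies.
-- Together these conditions say `v = nextRule g δ G o a`.
open Classical in
theorem opNum_of_rep (g : M.Profile) (δ : M.Com t) (u : M.U t k) (y : M.Y (t + 1) k)
    (hG : Causal G) {a₀ : M.OObs k t} {o : M.Old k t} (ho : oldObs a₀ = o) {a : M.OObs k (t + 1)}
    (h : ∀ᵐ x ∂M.νX t, ∀ w, ξ (x, mkOth (merge o a) w) =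
      if w = G (merge o a) then ζ (x, merge o a) else 0)
    (x' : M.X (t + 1)) (v : M.OAct k (t + 1)) :
    opNum g δ (mkOth a₀ (G a₀)) y u ξ (x', mkOth a v) =
      if v = nextRule g δ G o a then numDens g δ ζ G u y o (x', a) else 0 := by
  have hn := M.one_le_n
  set b := merge o a with hb
  set w : M.OAct k t := fun j => (prevPriv (mkOth a₀ (G a₀) j) (mkOth a v j)).2 with hw
  have hlo : (fun j => prevPriv (mkOth a₀ (G a₀) j) (mkOth a v j) : M.Oth k t) = mkOth b w :=
    prevPriv_mkOth_of_oldObs_eq ho _ _ _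
  have hold : oldObs a₀ = oldObs b := by rw [hb, oldObs_merge, ho]
  have hwG : w = G b ↔ ∀ j (s : ActWin M.n (t + 1)), s.1 < t → v j s = nextRule g δ G o a j s := by
    constructor
    · intro h1 j s hs
      have h2 := actWin_lt' s
      rw [nextRule_of_lt _ _ _ _ _ _ _ hs, ← hb, ← h1]
      simp only [hw, prevPriv, h2, dite_true]
      rfl
    · intro h1
      funext j s
      by_cases hs : t + 1 < s.1 + M.n
      · have h2 := h1 j ⟨s.1, Finset.mem_filter.mpr ⟨Finset.mem_range.mpr
          (by have := actWin_lt s; omega), hs⟩⟩ (actWin_lt s)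
        rw [nextRule_of_lt _ _ _ _ _ _ _ (actWin_lt s)] at h2
        rw [hb, ← h2]
        simp only [hw, prevPriv, hs, dite_true]
        rfl
      -- An entry that becomes shared is taken from `G a₀`. By causality it agrees with `G b`, as
      -- `a₀` and `b` have the same shared observations.
      · rw [← hG.eq_of_oldObs_eq hold j s hs]
        simp only [hw, prevPriv, hs, dite_false]
        rfl
  have hop : opNum g δ (mkOth a₀ (G a₀)) y u ξ (x', mkOth a v) =
      M.Q (t + 1) k x' y * QO M k x' (newest a) *
        ∫⁻ x, M.S t x (jointAct g δ (mkOth b w) u) x' *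
          (∏ j : {j : Fin K // j ≠ k}, delta (mkOth a v j) ((g j).1 t (δ, mkOth b w j))) *
            ξ (x, mkOth b w) ∂M.νX t := by
    rw [← hlo]
    rfl
  rw [hop]
  have hδ := prod_delta_eq (mkOth a v) fun j => (g j).1 t (δ, mkOth b w j)
  by_cases h1 : w = G b
  · by_cases h2 : ∀ (h : 1 < M.n) (j : {j : Fin K // j ≠ k}), (mkOth a v j).2 ⟨t,
      Finset.mem_filter.mpr ⟨Finset.mem_range.mpr (by omega), by omega⟩⟩ =
        (g j).1 t (δ, mkOth b w j)
    · have hv : v = nextRule g δ G o a := by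
        funext j s
        by_cases hs : s.1 < t
        · exact hwG.mp h1 j s hs
        · obtain ⟨s, hs'⟩ := s
          have h3 := actWin_lt ⟨s, hs'⟩
          have h4 := actWin_lt' ⟨s, hs'⟩
          obtain rfl : s = t := by simp only at hs h3; omega
          rw [nextRule_self, ← hb, ← h1]
          exact h2 (by simp only at h4; omega) j
      rw [if_pos hv, hδ.1 h2, numDens, predDens]
      congr 1
      refine lintegral_congr_ae ?_
      filter_upwards [h] with x hx
      rw [hx w, if_pos h1, h1, mul_one]
    · have hv : v ≠ nextRule g δ G o a := by
        rintro rfl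
        refine h2 fun h3 j => ?_
        rw [h1]
        exact nextRule_self _ _ _ _ _ _ _
      rw [if_neg hv, hδ.2 h2]
      simp
  · have hv : v ≠ nextRule g δ G o a := by
      rintro rfl
      exact h1 (hwG.mpr fun _ _ _ => rfl)
    rw [if_neg hv]
    have : ∫⁻ x, M.S t x (jointAct g δ (mkOth b w) u) x' *
          (∏ j : {j : Fin K // j ≠ k}, delta (mkOth a v j) ((g j).1 t (δ, mkOth b w j))) *
            ξ (x, mkOth b w) ∂M.νX t = 0 := by
      rw [lintegral_congr_ae (g := fun _ => 0), lintegral_zero]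
      filter_upwards [h] with x hx
      rw [hx w, if_neg h1, mul_zero]
    rw [this, mul_zero]

/-- A property of almost all observations at time `t`, in terms of those at time `t + 1`. -/
theorem ae_merge {P : M.OObs k t → Prop} (h : ∀ᵐ b ∂M.νO k t, P b) :
    ∀ᵐ o ∂M.νOld k t, ∀ᵐ a ∂M.νO k (t + 1), P (merge o a) := by
  obtain ⟨S, hSP, hS, hS0⟩ := exists_measurable_superset_of_null h
  have hF : Measurable fun p : M.OObs k t × M.NObs k (t + 1) => S.indicator (1 : M.OObs k t → ℝ≥0∞) p.1 :=
    (measurable_one.indicator hS).comp measurable_fst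
  have h1 := lintegral_νO_νN hF
  have h2 : ∫⁻ b, ∫⁻ _, S.indicator (1 : M.OObs k t → ℝ≥0∞) b ∂M.νN k (t + 1) ∂M.νO k t = 0 := by
    rw [lintegral_congr_ae (g := fun _ => 0), lintegral_zero]
    filter_upwards [measure_eq_zero_iff_ae_notMem.mp hS0] with b hb
    simp [hb]
  have hm : Measurable fun p : M.Old k t × M.OObs k (t + 1) =>
      S.indicator (1 : M.OObs k t → ℝ≥0∞) (merge p.1 p.2) :=
    (measurable_one.indicator hS).comp measurable_merge
  dsimp only at h1
  rw [h2, eq_comm, lintegral_eq_zero_iff hm.lintegral_prod_right'] at h1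
  filter_upwards [h1] with o ho
  have hmo : Measurable fun a => S.indicator (1 : M.OObs k t → ℝ≥0∞) (merge o a) :=
    hm.comp measurable_prodMk_left
  simp only [Pi.zero_apply] at ho
  rw [lintegral_eq_zero_iff hmo] at ho
  filter_upwards [ho] with a ha
  by_contra hP
  have : merge o a ∈ S := hSP hP
  simp [this] at ha

theorem measurable_prevPriv {j : Fin K} :
    Measurable fun p : M.Priv t j × M.Priv (t + 1) j => prevPriv p.1 p.2 := by
  refine Measurable.prodMk (measurable_pi_iff.mpr fun s => ?_) (measurable_pi_iff.mpr fun s => ?_)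
  all_goals
    by_cases h : t + 1 < s.1 + M.n
    · simp only [h, dite_true]
      fun_prop
    · simp only [h, dite_false]
      fun_prop

theorem measurable_delta {j : Fin K} :
    Measurable fun p : M.Priv (t + 1) j × M.U t j => delta p.1 p.2 := by
  unfold delta
  by_cases h : 1 < M.n
  · simp only [h, dite_true]
    refine Measurable.ite (measurableSet_eq_fun ?_ measurable_snd) measurable_const measurable_const
    fun_prop
  · simp only [h, dite_false]
    exact measurable_const

theorem measurable_opNum (g : M.Profile) (δ : M.Com t) (old : M.Oth k t) (y : M.Y (t + 1) k)
    (u : M.U t k) (hξ : Measurable ξ) : Measurable (opNum g δ old y u ξ) := by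
  have hlo : Measurable fun p : M.X (t + 1) × M.Oth k (t + 1) =>
      (fun j => prevPriv (old j) (p.2 j) : M.Oth k t) :=
    measurable_pi_iff.mpr fun j => measurable_prevPriv.comp
      (measurable_const.prodMk ((measurable_pi_apply j).comp measurable_snd))
  unfold opNum
  refine Measurable.mul (Measurable.mul ?_ ?_) ?_
  · exact (M.measurable_Q _ _).comp (measurable_fst.prodMk measurable_const)
  · refine Finset.measurable_fun_prod _ fun j _ => ?_
    exact (M.measurable_Q _ _).comp (measurable_fst.prodMk (measurable_newObs.comp
      ((measurable_pi_apply j).comp measurable_snd)))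
  · refine Measurable.lintegral_prod_right' (f := fun q : (M.X (t + 1) × M.Oth k (t + 1)) × M.X t =>
      M.S t q.2 (jointAct g δ (fun j => prevPriv (old j) (q.1.2 j)) u) q.1.1 *
        (∏ j : {j : Fin K // j ≠ k}, delta (q.1.2 j)
          ((g j).1 t (δ, prevPriv (old j) (q.1.2 j)))) *
        ξ (q.2, fun j => prevPriv (old j) (q.1.2 j))) ?_
    have hlo' := hlo.comp (measurable_fst : Measurable fun q :
      (M.X (t + 1) × M.Oth k (t + 1)) × M.X t => q.1)
    refine Measurable.mul (Measurable.mul ?_ ?_) ?_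
    · exact (M.measurable_S t).comp (measurable_snd.prodMk (((measurable_jointAct g).comp
        (measurable_const.prodMk (hlo'.prodMk measurable_const))).prodMk
          (measurable_fst.comp measurable_fst)))
    · refine Finset.measurable_fun_prod _ fun j _ => ?_
      refine measurable_delta.comp (Measurable.prodMk ?_ ?_)
      · exact (measurable_pi_apply j).comp (measurable_snd.comp measurable_fst)
      · exact ((g j).2 t).comp (measurable_const.prodMk ((measurable_pi_apply j).comp hlo'))
    · exact hξ.comp (measurable_snd.prodMk hlo')

theorem measurable_op (g : M.Profile) (δ : M.Com t) (old : M.Oth k t) (y : M.Y (t + 1) k)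
    (u : M.U t k) (hξ : Measurable ξ) : Measurable (op g δ old y u ξ) := by
  unfold op
  by_cases h : intBel (opNum g δ old y u ξ) (fun _ => 1) = 0
  · simp only [h, if_true]
    exact measurable_const
  · simp only [h, if_false]
    exact (measurable_opNum g δ old y u hξ).div_const _

/-- The operator preserves the representation. -/
theorem Good.next (h : Good ξ ζ G) (g : M.Profile) (i : M.Com t × M.Priv t k) (u : M.U t k)
    {y : M.Y (t + 1) k} (hy : ∫⁻ a, obsDens g i.1 ζ G u (y, a) ∂M.νO k t ≠ ∞) :
    ∀ᵐ a₀ ∂M.νO k t, obsDens g i.1 ζ G u (y, a₀) ≠ 0 →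
      Good (op g i.1 (mkOth a₀ (G a₀)) y u ξ) (newDens g i.1 ζ G u y (oldObs a₀))
        (nextRule g i.1 G (oldObs a₀)) := by
  have h1 : ∀ᵐ b ∂M.νO k t, ∀ᵐ x ∂M.νX t, ∀ w, ξ (x, mkOth b w) =
      open Classical in if w = G b then ζ (x, b) else 0 := by
    have h2 := Measure.ae_ae_of_ae_prod
      ((Measure.measurePreserving_swap (μ := M.νO k t) (ν := M.νX t)).quasiMeasurePreserving.ae h.rep)
    exact h2
  -- The representation at almost all observations of time `t` is transferred to almost all shared
  -- observations and almost all later ones. Positivity of the density at `a₀` then puts `oldObs a₀`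
  -- among the good shared observations, with a normalizer in `(0, ∞)`.
  filter_upwards [ae_of_obsDens_ne_zero g i u h.dens h.rule hy (ae_merge h1)] with a₀ ha₀ hne
  obtain ⟨h2, h3, h4⟩ := ha₀ hne
  have hrep : Rep (opNum g i.1 (mkOth a₀ (G a₀)) y u ξ) (numDens g i.1 ζ G u y (oldObs a₀))
      (nextRule g i.1 G (oldObs a₀)) := by
    -- The formula for the numerator holds for every new state, so only the observations have an
    -- exceptional set.
    refine (Measure.quasiMeasurePreserving_snd (μ := M.νX (t + 1)) (ν := M.νO k (t + 1))).ae
      (p := fun a => ∀ x' v, opNum g i.1 (mkOth a₀ (G a₀)) y u ξ (x', mkOth a v) =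
        open Classical in if v = nextRule g i.1 G (oldObs a₀) a then
          numDens g i.1 ζ G u y (oldObs a₀) (x', a) else 0) ?_ |>.mono fun p hp v => hp p.1 v
    filter_upwards [h2] with a ha x' v
    exact opNum_of_rep g i.1 u y h.causal rfl ha x' v
  have hD : intBel (opNum g i.1 (mkOth a₀ (G a₀)) y u ξ) (fun _ => 1) =
      totalDens g i.1 ζ G u y (oldObs a₀) := by
    rw [hrep.intBel]
    simp only [one_mul]
    rfl
  have hrep' : Rep (op g i.1 (mkOth a₀ (G a₀)) y u ξ) (newDens g i.1 ζ G u y (oldObs a₀))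
      (nextRule g i.1 G (oldObs a₀)) := by
    filter_upwards [hrep] with p hp v
    simp only [op, hD, if_neg h3, hp v, newDens]
    split_ifs <;> simp
  have hnum : Measurable (numDens g i.1 ζ G u y (oldObs a₀)) :=
    (measurable_numDens g i u h.dens h.rule).comp (measurable_prodMk_left (x := (y, oldObs a₀)))
  refine ⟨⟨measurable_op _ _ _ _ _ h.pdf.1, ?_⟩, hrep', hnum.div_const _, ?_, h.causal.nextRule _ _ _⟩
  · rw [hrep'.intBel]
    simp only [one_mul, newDens, div_eq_mul_inv]
    have hm : ∀ x, Measurable fun a => numDens g i.1 ζ G u y (oldObs a₀) (x, a) := fun x =>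
      hnum.comp measurable_prodMk_left
    simp only [fun x => lintegral_mul_const (μ := M.νO k (t + 1))
      (totalDens g i.1 ζ G u y (oldObs a₀))⁻¹ (hm x)]
    rw [lintegral_mul_const _ hnum.lintegral_prod_right']
    exact ENNReal.mul_inv_cancel h3 h4
  · have := measurable_nextRule (B := Unit) g (δ := fun _ => i.1) measurable_const
      (G := fun _ => G) (h.rule.comp measurable_snd) (o := fun _ => oldObs a₀) measurable_const
    exact this.comp (measurable_prodMk_left (x := ()))

end Model

end DelayedSharing

namespace DelayedSharing

namespace Model

open scoped NNReal

variable {K : ℕ} {M : Model K} {k : Fin K} {t : ℕ}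
  {ξ : M.Bel k t} {ζ : M.RBel k t} {G : M.OObs k t → M.OAct k t}

/-! ### The value functions in terms of the observations of the others -/

theorem lintegral_withDensity_prod {A B : Type*} [MeasurableSpace A] [MeasurableSpace B]
    (μ : Measure A) [SFinite μ] (ν : Measure B) [SFinite ν] {e : A × B → ℝ≥0∞} (he : Measurable e)
    {f : A × B → ℝ≥0∞} (hf : AEMeasurable f (μ.prod ν)) :
    ∫⁻ p, f p ∂(μ.prod ν).withDensity e = ∫⁻ a, ∫⁻ b, e (a, b) * f (a, b) ∂ν ∂μ := by
  rw [lintegral_withDensity_eq_lintegral_mul₀ he.aemeasurable hf,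
    lintegral_prod _ (he.aemeasurable.mul hf)]
  rfl

/-- The function `f` will contain `V` at the updated density, about which nothing is known where the
predictive density vanishes. So `f` only has to agree with an almost everywhere measurable `f'`
where `obsDens` is not zero. -/
theorem Rep.intPred_eq (h : Rep ξ ζ G) (hζ : Measurable ζ) (hG : Measurable G) (g : M.Profile)
    (i : M.Com t × M.Priv t k) (u : M.U t k) {f : M.Y (t + 1) k × M.Oth k t → ℝ≥0∞}
    {f' : M.Y (t + 1) k × M.OObs k t → ℝ≥0∞}
    (hf' : AEMeasurable f' ((M.νY (t + 1) k).prod (M.νO k t)))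
    (hff : ∀ᵐ y ∂M.νY (t + 1) k, ∀ᵐ a ∂M.νO k t, obsDens g i.1 ζ G u (y, a) ≠ 0 →
      f (y, mkOth a (G a)) = f' (y, a)) :
    Model.intPred g ξ i.1 u (fun q => f (q.1, q.2.1)) =
      ∫⁻ y, ∫⁻ a, obsDens g i.1 ζ G u (y, a) * f' (y, a) ∂M.νO k t ∂M.νY (t + 1) k := by
  have hS := measurable_step_right g i u hG
  rw [h.intPred]
  refine lintegral_congr_ae ?_
  obtain ⟨f'', hf'', hf''ae⟩ := hf'
  filter_upwards [hff, Measure.ae_ae_of_ae_prod hf''ae] with y hy hy'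
  have hf'y : AEMeasurable (fun a => f' (y, a)) (M.νO k t) :=
    ⟨fun a => f'' (y, a), hf''.comp measurable_prodMk_left, hy'⟩
  have hQ : Measurable fun x => M.Q (t + 1) k x y :=
    (M.measurable_Q (t + 1) k).comp (measurable_id.prodMk measurable_const)
  have hm : Measurable fun q : (M.X t × M.OObs k t) × M.X (t + 1) => M.Q (t + 1) k q.2 y *
      M.S t q.1.1 (jointAct g i.1 (mkOth q.1.2 (G q.1.2)) u) q.2 * ζ q.1 :=
    ((hQ.comp measurable_snd).mul (hS.comp ((measurable_fst.comp measurable_fst).prodMk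
      ((measurable_snd.comp measurable_fst).prodMk measurable_snd)))).mul (hζ.comp measurable_fst)
  have he : Measurable fun p : M.X t × M.OObs k t => ∫⁻ x', M.Q (t + 1) k x' y *
      M.S t p.1 (jointAct g i.1 (mkOth p.2 (G p.2)) u) x' * ζ p ∂M.νX (t + 1) :=
    hm.lintegral_prod_right'
  have hE : ∀ a, ∫⁻ x, ∫⁻ x', M.Q (t + 1) k x' y *
      M.S t x (jointAct g i.1 (mkOth a (G a)) u) x' * ζ (x, a) ∂M.νX (t + 1) ∂M.νX t =
      obsDens g i.1 ζ G u (y, a) := by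
    intro a
    rw [lintegral_lintegral_swap]
    · refine lintegral_congr fun x' => ?_
      simp only [mul_assoc, predDens]
      rw [lintegral_const_mul]
      exact (hS.comp (f := fun x => (x, a, x')) (measurable_id.prodMk measurable_const)).mul
        (hζ.comp (measurable_id.prodMk measurable_const))
    · exact (hm.comp ((measurable_fst.prodMk measurable_const).prodMk
        measurable_snd)).aemeasurable
  have key := lintegral_lintegral_mul_swap (M.νX t) (M.νO k t) he
    (f := fun a => f (y, mkOth a (G a))) hf'y (by
      filter_upwards [hy] with a ha h1
      exact ha (by rwa [← hE a]))
  simp only [hE] at key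
  rw [← key]
  refine lintegral_congr fun x => lintegral_congr fun a => ?_
  rw [lintegral_const_mul]
  exact hm.comp (measurable_prodMk_left (x := (x, a)))

theorem Good.lintegral_eq_one (h : Good ξ ζ G) : ∫⁻ x, ∫⁻ a, ζ (x, a) ∂M.νO k t ∂M.νX t = 1 := by
  have := h.pdf.2
  rw [h.rep.intBel] at this
  simpa only [one_mul] using this

/-- Integration against a represented density is expectation under the probability measure with
density `ζ`, so constants can be split off. -/
theorem Good.extInt_intBel (h : Good ξ ζ G) {C : ℝ≥0} {φ : M.X t × M.Oth k t → EReal}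
    {F : M.X t × M.OObs k t → ℝ≥0∞} (hF : Measurable F)
    (hφ : ∀ x a, φ (x, mkOth a (G a)) = shift C (F (x, a))) :
    extInt (intBel ξ) φ = shift C (∫⁻ x, ∫⁻ a, F (x, a) * ζ (x, a) ∂M.νO k t ∂M.νX t) := by
  have hm : ∀ {F' : M.X t × M.OObs k t → ℝ≥0∞}, Measurable F' →
      ∫⁻ x, ∫⁻ a, F' (x, a) * ζ (x, a) ∂M.νO k t ∂M.νX t =
      ∫⁻ p, F' p ∂((M.νX t).prod (M.νO k t)).withDensity ζ := fun hF' => by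
    rw [lintegral_withDensity_prod _ _ h.dens hF'.aemeasurable]
    simp only [mul_comm]
  have : IsProbabilityMeasure (((M.νX t).prod (M.νO k t)).withDensity ζ) := ⟨by
    rw [← lintegral_one, lintegral_withDensity_prod _ _ h.dens aemeasurable_const]
    simpa only [mul_one] using h.lintegral_eq_one⟩
  rw [hm hF, ← expect_shift_of_isProbabilityMeasure _ C hF.aemeasurable, extInt, expect, extInt,
    h.rep.intBel, h.rep.intBel]
  simp only [hφ, toENNReal_shift, toENNReal_neg_shift]
  rw [hm (F' := fun p => F p - C) (hF.sub_const _),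
    hm (F' := fun p => C - F p) (measurable_const.sub hF)]

/-- The same for the predictive density: `obsDens` has total mass `1`, and conditions are imposed on
`φ` only where it does not vanish. -/
theorem Good.extInt_intPred (h : Good ξ ζ G) (g : M.Profile) (i : M.Com t × M.Priv t k)
    (u : M.U t k) {C : ℝ≥0} {φ : M.Y (t + 1) k × M.Oth k t → EReal}
    {F : M.Y (t + 1) k × M.OObs k t → ℝ≥0∞}
    (hF : AEMeasurable F ((M.νY (t + 1) k).prod (M.νO k t)))
    (hφ : ∀ᵐ y ∂M.νY (t + 1) k, ∀ᵐ a ∂M.νO k t, obsDens g i.1 ζ G u (y, a) ≠ 0 →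
      φ (y, mkOth a (G a)) = shift C (F (y, a))) :
    extInt (intPred g ξ i.1 u) (fun q => φ (q.1, q.2.1)) = shift C (∫⁻ y, ∫⁻ a,
      obsDens g i.1 ζ G u (y, a) * F (y, a) ∂M.νO k t ∂M.νY (t + 1) k) := by
  have ho := measurable_obsDens (t := t) g i u h.dens h.rule
  have : IsProbabilityMeasure (((M.νY (t + 1) k).prod (M.νO k t)).withDensity
      (obsDens g i.1 ζ G u)) := ⟨by
    rw [← lintegral_one, lintegral_withDensity_prod _ _ ho aemeasurable_const]
    simp only [mul_one]
    rw [lintegral_obsDens g i u h.dens h.rule, h.lintegral_eq_one]⟩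
  have hac := withDensity_absolutelyContinuous ((M.νY (t + 1) k).prod (M.νO k t))
    (obsDens g i.1 ζ G u)
  rw [← lintegral_withDensity_prod _ _ ho hF,
    ← expect_shift_of_isProbabilityMeasure _ C (hF.mono_ac hac), extInt, expect, extInt,
    h.rep.intPred_eq h.dens h.rule g i u (f := fun p => (φ p).toENNReal)
      (f' := fun p => F p - C) (hF.sub_const _) ?_,
    h.rep.intPred_eq h.dens h.rule g i u (f := fun p => (-φ p).toENNReal)
      (f' := fun p => C - F p) (aemeasurable_const.sub hF) ?_]
  · simp only [toENNReal_shift, toENNReal_neg_shift]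
    rw [lintegral_withDensity_prod _ _ ho (hF.sub_const _),
      lintegral_withDensity_prod _ _ ho (f := fun p => C - F p) (aemeasurable_const.sub hF)]
  · filter_upwards [hφ] with y hy
    filter_upwards [hy] with a ha h1
    rw [ha h1, toENNReal_neg_shift]
  · filter_upwards [hφ] with y hy
    filter_upwards [hy] with a ha h1
    rw [ha h1, toENNReal_shift]

theorem aemeasurable_nextVal [∀ t, Nonempty (M.U t k)] {g : M.Profile} {v : RVal M k}
    (hv : IsRed g v) (ht : t < M.T) (hζ : Measurable ζ) (hG : Measurable G)
    (i : M.Com t × M.Priv t k) (u : M.U t k) :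
    AEMeasurable (nextVal g v ζ G i u) ((M.νY (t + 1) k).prod (M.νO k t)) := by
  have h1 := lsa_value hv (t := t + 1) ht
    ((MFam.const hζ hG i Unit).next g (u := fun _ => u) measurable_const)
  exact (h1.comp (measurable_prodMk_left (x := ()))).aemeasurable _

/-- Almost everywhere where `obsDens` is positive, the updated density is represented by the updated
data, by `Good.next`. There the next value of `V` is the shifted reduced value, and the shifts of
the running cost and of the next value add up. -/
theorem Good.dpStep_eq [∀ t, Nonempty (M.U t k)] {g : M.Profile} {v : RVal M k} (hv : IsRed g v)
    (ht : t < M.T) {V' : M.Bel k (t + 1) → M.Com (t + 1) × M.Priv (t + 1) k → EReal}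
    (hV : ∀ {ξ : M.Bel k (t + 1)} {ζ : M.RBel k (t + 1)} {G : M.OObs k (t + 1) → M.OAct k (t + 1)}
      (i : M.Com (t + 1) × M.Priv (t + 1) k), Good ξ ζ G →
      V' ξ i = shift (slack M (t + 1)) (v (t + 1) ζ G i))
    (h : Good ξ ζ G) (i : M.Com t × M.Priv t k) (u : M.U t k) :
    dpStep g V' ξ i u = shift (slack M t) (redStep g v ζ G i u) := by
  have ho := measurable_obsDens (t := t) g i u h.dens h.rule
  have hfin : ∀ᵐ y ∂M.νY (t + 1) k, ∫⁻ a, obsDens g i.1 ζ G u (y, a) ∂M.νO k t < ∞ := by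
    refine ae_lt_top ho.lintegral_prod_right' ?_
    rw [lintegral_obsDens g i u h.dens h.rule, h.lintegral_eq_one]
    exact ENNReal.one_ne_top
  rw [dpStep, redStep, slack_of_lt ht, ← shift_add_shift]
  congr 1
  · refine h.extInt_intBel (F := fun p => posC t p.1 (jointAct g i.1 (mkOth p.2 (G p.2)) u))
      ?_ fun x a => (shift_posC _ _ _).symm
    exact (measurable_posC t).comp (measurable_fst.prodMk ((measurable_jointAct g).comp
      (measurable_const.prodMk ((measurable_mkOth.comp (measurable_snd.prodMk
        (h.rule.comp measurable_snd))).prodMk measurable_const))))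
  · refine (h.extInt_intPred g i u (C := slack M (t + 1))
      (φ := fun p => V' (op g i.1 p.2 p.1 u ξ) (nextInfo g i u p.1 p.2))
      (aemeasurable_nextVal hv ht h.dens h.rule i u) ?_).trans ?_
    rotate_left
    · congr 1
      refine lintegral_congr_ae ?_
      filter_upwards [hfin] with y hy
      refine lintegral_congr_ae ?_
      have hoy : Measurable fun a => obsDens g i.1 ζ G u (y, a) := ho.comp measurable_prodMk_left
      -- The density of a probability measure is almost everywhere finite, so its truncation by
      -- `toNNReal` is harmless.
      filter_upwards [ae_lt_top hoy hy.ne] with a ha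
      rw [ENNReal.coe_toNNReal ha.ne]
    · filter_upwards [hfin] with y hy
      filter_upwards [h.next g i u hy.ne] with a ha hne
      exact hV _ (ha hne)

/-- The value functions at represented densities. -/
theorem Good.value_eq [∀ t, Nonempty (M.U t k)] {g : M.Profile} {v : RVal M k} (hv : IsRed g v)
    {V : ∀ t, M.Bel k t → M.Com t × M.Priv t k → EReal} (hV : IsDPSolution g k V) :
    ∀ (m t : ℕ), t + m = M.T → ∀ {ξ : M.Bel k t} {ζ : M.RBel k t} {G : M.OObs k t → M.OAct k t}
      (i : M.Com t × M.Priv t k), Good ξ ζ G → V t ξ i = shift (slack M t) (v t ζ G i) := by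
  intro m
  induction m with
  | zero =>
    intro t ht ξ ζ G i h
    obtain rfl : t = M.T := ht
    rw [hV.1 ξ i h.pdf, hv.1, slack_T, dpTerm]
    exact h.extInt_intBel (F := fun p => posT p.1) (measurable_posT.comp measurable_fst)
      fun x a => (shift_posT _).symm
  | succ m ih =>
    intro t ht ξ ζ G i h
    have htT : t < M.T := by omega
    rw [hV.2 t htT ξ i h.pdf, hv.2 t htT, shift_iInf]
    exact iInf_congr fun u => h.dpStep_eq hv htT (fun i h' => ih (t + 1) (by omega) i h') i u

theorem Good.value_eq_of_le [∀ t, Nonempty (M.U t k)] {g : M.Profile} {v : RVal M k}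
    (hv : IsRed g v) {V : ∀ t, M.Bel k t → M.Com t × M.Priv t k → EReal} (hV : IsDPSolution g k V)
    (ht : t ≤ M.T) (h : Good ξ ζ G) (i : M.Com t × M.Priv t k) :
    V t ξ i = shift (slack M t) (v t ζ G i) :=
  Good.value_eq hv hV (M.T - t) t (by omega) i h

theorem Good.step_eq [∀ t, Nonempty (M.U t k)] {g : M.Profile} {v : RVal M k}
    (hv : IsRed g v) {V : ∀ t, M.Bel k t → M.Com t × M.Priv t k → EReal} (hV : IsDPSolution g k V)
    (ht : t < M.T) (h : Good ξ ζ G) (i : M.Com t × M.Priv t k) (u : M.U t k) :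
    dpStep g (V (t + 1)) ξ i u = shift (slack M t) (redStep g v ζ G i u) :=
  h.dpStep_eq hv ht (fun i h' => h'.value_eq_of_le hv hV ht i) i u

theorem Good.isMinimizer_iff [∀ t, Nonempty (M.U t k)] {g : M.Profile} {v : RVal M k}
    (hv : IsRed g v) {V : ∀ t, M.Bel k t → M.Com t × M.Priv t k → EReal} (hV : IsDPSolution g k V)
    (ht : t < M.T) (h : Good ξ ζ G) (i : M.Com t × M.Priv t k) (u : M.U t k) :
    IsMinimizer g k V t ξ i u ↔ ∀ u', redStep g v ζ G i u ≤ redStep g v ζ G i u' := by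
  simp only [IsMinimizer, h.step_eq hv hV ht, shift_le_shift]

end Model

end DelayedSharing

namespace DelayedSharing

/-! ### Reversing the order of iterated integrals -/

section Tonelli

variable {A B C D : Type*} [MeasurableSpace A] [MeasurableSpace B] [MeasurableSpace C]
  [MeasurableSpace D] (α : Measure A) [SFinite α] (β : Measure B) [SFinite β]
  (γ : Measure C) [SFinite γ] (δ : Measure D) [SFinite δ]

theorem lintegral_reverse_three {f : A × B × C → ℝ≥0∞} (hf : Measurable f) :
    ∫⁻ a, ∫⁻ b, ∫⁻ c, f (a, b, c) ∂γ ∂β ∂α = ∫⁻ c, ∫⁻ b, ∫⁻ a, f (a, b, c) ∂α ∂β ∂γ := by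
  have h1 : ∀ a, ∫⁻ b, ∫⁻ c, f (a, b, c) ∂γ ∂β = ∫⁻ c, ∫⁻ b, f (a, b, c) ∂β ∂γ := fun a =>
    lintegral_lintegral_swap (f := fun b c => f (a, b, c))
      (hf.comp measurable_prodMk_left).aemeasurable
  have h2 : Measurable fun p : A × C => ∫⁻ b, f (p.1, b, p.2) ∂β :=
    Measurable.lintegral_prod_right' (f := fun q : (A × C) × B => f (q.1.1, q.2, q.1.2))
      (hf.comp (by fun_prop))
  rw [lintegral_congr h1, lintegral_lintegral_swap h2.aemeasurable]
  refine lintegral_congr fun c => lintegral_lintegral_swap (f := fun a b => f (a, b, c)) ?_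
  exact (hf.comp (by fun_prop : Measurable fun p : A × B => (p.1, p.2, c))).aemeasurable

theorem lintegral_reverse_four {f : A × B × C × D → ℝ≥0∞} (hf : Measurable f) :
    ∫⁻ a, ∫⁻ b, ∫⁻ c, ∫⁻ d, f (a, b, c, d) ∂δ ∂γ ∂β ∂α =
      ∫⁻ d, ∫⁻ c, ∫⁻ b, ∫⁻ a, f (a, b, c, d) ∂α ∂β ∂γ ∂δ := by
  have h1 : ∀ a, ∫⁻ b, ∫⁻ c, ∫⁻ d, f (a, b, c, d) ∂δ ∂γ ∂β =
      ∫⁻ d, ∫⁻ c, ∫⁻ b, f (a, b, c, d) ∂β ∂γ ∂δ := fun a =>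
    lintegral_reverse_three β γ δ (f := fun p => f (a, p)) (hf.comp measurable_prodMk_left)
  have h2 : Measurable fun p : (A × D) × C => ∫⁻ b, f (p.1.1, b, p.2, p.1.2) ∂β :=
    Measurable.lintegral_prod_right' (f := fun q : ((A × D) × C) × B =>
      f (q.1.1.1, q.2, q.1.2, q.1.1.2)) (hf.comp (by fun_prop))
  have h3 : Measurable fun p : A × D => ∫⁻ c, ∫⁻ b, f (p.1, b, c, p.2) ∂β ∂γ :=
    h2.lintegral_prod_right'
  rw [lintegral_congr h1, lintegral_lintegral_swap h3.aemeasurable]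
  refine lintegral_congr fun d => ?_
  have h4 : Measurable fun p : A × C × B => f (p.1, p.2.2, p.2.1, d) := hf.comp (by fun_prop)
  have h5 : Measurable fun p : B × C => ∫⁻ a, f (a, p.1, p.2, d) ∂α :=
    Measurable.lintegral_prod_right' (f := fun q : (B × C) × A => f (q.2, q.1.1, q.1.2, d))
      (hf.comp (by fun_prop))
  rw [lintegral_reverse_three α γ β h4, lintegral_lintegral_swap h5.aemeasurable]

end Tonelli

namespace Model

open scoped NNReal

variable {K : ℕ} {M : Model K} {k : Fin K} {t : ℕ}

/-! ### One step of the filter -/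

section Step

variable {ζ : M.RBel k t} {G : M.OObs k t → M.OAct k t} (g : M.Profile) (i : M.Com t × M.Priv t k)
  (u : M.U t k)

/-- The integral over the state and the observations of the others at time `t`, and over the state
and the observation at time `t + 1`. -/
theorem lintegral_step_reverse (hζ : Measurable ζ) (hG : Measurable G)
    {φ : M.Y (t + 1) k × M.X (t + 1) × M.OObs k t → ℝ≥0∞} (hφ : Measurable φ) :
    ∫⁻ x, ∫⁻ a, ζ (x, a) * ∫⁻ x', M.S t x (jointAct g i.1 (mkOth a (G a)) u) x' *
      ∫⁻ y, M.Q (t + 1) k x' y * φ (y, x', a) ∂M.νY (t + 1) k ∂M.νX (t + 1) ∂M.νO k t ∂M.νX t =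
    ∫⁻ y, ∫⁻ x', ∫⁻ a, M.Q (t + 1) k x' y * predDens g i.1 ζ G u (x', a) * φ (y, x', a)
      ∂M.νO k t ∂M.νX (t + 1) ∂M.νY (t + 1) k := by
  have hS := measurable_step_right g i u hG
  have hQ := M.measurable_Q (t + 1) k
  have hf : Measurable fun p : M.X t × M.OObs k t × M.X (t + 1) × M.Y (t + 1) k =>
      ζ (p.1, p.2.1) * (M.S t p.1 (jointAct g i.1 (mkOth p.2.1 (G p.2.1)) u) p.2.2.1 *
        (M.Q (t + 1) k p.2.2.1 p.2.2.2 * φ (p.2.2.2, p.2.2.1, p.2.1))) :=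
    (hζ.comp (by fun_prop)).mul ((hS.comp (by fun_prop :
      Measurable fun p : M.X t × M.OObs k t × M.X (t + 1) × M.Y (t + 1) k =>
        (p.1, p.2.1, p.2.2.1))).mul ((hQ.comp (by fun_prop :
      Measurable fun p : M.X t × M.OObs k t × M.X (t + 1) × M.Y (t + 1) k =>
        (p.2.2.1, p.2.2.2))).mul (hφ.comp (by fun_prop))))
  have key := lintegral_reverse_four (M.νX t) (M.νO k t) (M.νX (t + 1)) (M.νY (t + 1) k) hf
  have h1 : ∀ x a, ∫⁻ x', ∫⁻ y, ζ (x, a) * (M.S t x (jointAct g i.1 (mkOth a (G a)) u) x' *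
      (M.Q (t + 1) k x' y * φ (y, x', a))) ∂M.νY (t + 1) k ∂M.νX (t + 1) =
      ζ (x, a) * ∫⁻ x', M.S t x (jointAct g i.1 (mkOth a (G a)) u) x' *
      ∫⁻ y, M.Q (t + 1) k x' y * φ (y, x', a) ∂M.νY (t + 1) k ∂M.νX (t + 1) := by
    intro x a
    have hm : Measurable fun p : M.X (t + 1) × M.Y (t + 1) k =>
        M.Q (t + 1) k p.1 p.2 * φ (p.2, p.1, a) := hQ.mul (hφ.comp (by fun_prop))
    have h2 : ∀ x', ∫⁻ y, ζ (x, a) * (M.S t x (jointAct g i.1 (mkOth a (G a)) u) x' *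
        (M.Q (t + 1) k x' y * φ (y, x', a))) ∂M.νY (t + 1) k =
        ζ (x, a) * (M.S t x (jointAct g i.1 (mkOth a (G a)) u) x' *
          ∫⁻ y, M.Q (t + 1) k x' y * φ (y, x', a) ∂M.νY (t + 1) k) := by
      intro x'
      have hmx : Measurable fun y => M.Q (t + 1) k x' y * φ (y, x', a) :=
        hm.comp measurable_prodMk_left
      rw [lintegral_const_mul _ (hmx.const_mul _), lintegral_const_mul _ hmx]
    rw [lintegral_congr h2, lintegral_const_mul]
    exact (measurable_S_right _ _).mul hm.lintegral_prod_right'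
  have h2 : ∀ y x' a, ∫⁻ x, ζ (x, a) * (M.S t x (jointAct g i.1 (mkOth a (G a)) u) x' *
      (M.Q (t + 1) k x' y * φ (y, x', a))) ∂M.νX t =
      M.Q (t + 1) k x' y * predDens g i.1 ζ G u (x', a) * φ (y, x', a) := by
    intro y x' a
    have h3 : ∀ x, ζ (x, a) * (M.S t x (jointAct g i.1 (mkOth a (G a)) u) x' *
        (M.Q (t + 1) k x' y * φ (y, x', a))) = M.S t x (jointAct g i.1 (mkOth a (G a)) u) x' *
          ζ (x, a) * (M.Q (t + 1) k x' y * φ (y, x', a)) := fun x => by ring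
    rw [lintegral_congr h3, lintegral_mul_const, predDens]
    · ring
    · exact (hS.comp (by fun_prop : Measurable fun x => (x, a, x'))).mul (hζ.comp (by fun_prop))
  simp only [h1, h2] at key
  exact key

theorem lintegral_step_obs (hζ : Measurable ζ) (hG : Measurable G)
    {φ : M.Y (t + 1) k × M.OObs k t → ℝ≥0∞} (hφ : Measurable φ) :
    ∫⁻ x, ∫⁻ a, ζ (x, a) * ∫⁻ x', M.S t x (jointAct g i.1 (mkOth a (G a)) u) x' *
      ∫⁻ y, M.Q (t + 1) k x' y * φ (y, a) ∂M.νY (t + 1) k ∂M.νX (t + 1) ∂M.νO k t ∂M.νX t =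
    ∫⁻ y, ∫⁻ a, obsDens g i.1 ζ G u (y, a) * φ (y, a) ∂M.νO k t ∂M.νY (t + 1) k := by
  have hp := measurable_predDens g i u hζ hG
  rw [lintegral_step_reverse g i u hζ hG (φ := fun p => φ (p.1, p.2.2)) (hφ.comp (by fun_prop))]
  refine lintegral_congr fun y => ?_
  have hQ : Measurable fun x => M.Q (t + 1) k x y :=
    (M.measurable_Q (t + 1) k).comp (by fun_prop : Measurable fun x => (x, y))
  have hm : Measurable fun p : M.X (t + 1) × M.OObs k t =>
      M.Q (t + 1) k p.1 y * predDens g i.1 ζ G u (p.1, p.2) * φ (y, p.2) :=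
    ((hQ.comp measurable_fst).mul hp).mul (hφ.comp (by fun_prop))
  rw [lintegral_lintegral_swap hm.aemeasurable]
  refine lintegral_congr fun a => ?_
  dsimp only
  rw [lintegral_mul_const]
  · rfl
  · exact hQ.mul (hp.comp (by fun_prop : Measurable fun x => (x, a)))

/-- The integral over the old and the new data, in terms of the unnormalized new densities. -/
theorem lintegral_step_num (hζ : Measurable ζ) (hG : Measurable G)
    {φ : (M.Com (t + 1) × M.Priv (t + 1) k) × (M.X (t + 1) × M.OObs k (t + 1)) → ℝ≥0∞}
    (hφ : Measurable φ) :
    ∫⁻ x, ∫⁻ a, ζ (x, a) * ∫⁻ x', M.S t x (jointAct g i.1 (mkOth a (G a)) u) x' *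
      ∫⁻ y, M.Q (t + 1) k x' y * ∫⁻ n, QO M k x' n * φ (nextInfo g i u y (mkOth a (G a)),
        (x', othObs (nextOth g i.1 (mkOth a (G a)) n))) ∂M.νN k (t + 1)
        ∂M.νY (t + 1) k ∂M.νX (t + 1) ∂M.νO k t ∂M.νX t =
    ∫⁻ y, ∫⁻ o, ∫⁻ x', ∫⁻ a', numDens g i.1 ζ G u y o (x', a') *
      φ (nextInfo g i u y (mkOth (merge o a') (G (merge o a'))), (x', a'))
        ∂M.νO k (t + 1) ∂M.νX (t + 1) ∂M.νOld k t ∂M.νY (t + 1) k := by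
  have hp := measurable_predDens (t := t) g i u hζ hG
  have hmk : Measurable fun a => mkOth a (G a) := measurable_mkOth.comp (measurable_id.prodMk hG)
  have hni : Measurable fun p : M.Y (t + 1) k × M.OObs k t =>
      nextInfo g i u p.1 (mkOth p.2 (G p.2)) :=
    (measurable_nextInfo g).comp (measurable_const.prodMk (measurable_const.prodMk
      (measurable_fst.prodMk (hmk.comp measurable_snd))))
  have hno : Measurable fun p : M.OObs k t × M.NObs k (t + 1) =>
      othObs (nextOth g i.1 (mkOth p.1 (G p.1)) p.2) :=
    measurable_othObs.comp ((measurable_nextOth g).comp (measurable_const.prodMk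
      ((hmk.comp measurable_fst).prodMk measurable_snd)))
  have hφ' : Measurable fun q : (M.Y (t + 1) k × M.X (t + 1) × M.OObs k t) × M.NObs k (t + 1) =>
      QO M k q.1.2.1 q.2 * φ (nextInfo g i u q.1.1 (mkOth q.1.2.2 (G q.1.2.2)),
        (q.1.2.1, othObs (nextOth g i.1 (mkOth q.1.2.2 (G q.1.2.2)) q.2))) :=
    (measurable_QO.comp (by fun_prop : Measurable fun q :
      (M.Y (t + 1) k × M.X (t + 1) × M.OObs k t) × M.NObs k (t + 1) => (q.1.2.1, q.2))).mul
    (hφ.comp ((hni.comp (by fun_prop : Measurable fun q :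
      (M.Y (t + 1) k × M.X (t + 1) × M.OObs k t) × M.NObs k (t + 1) => (q.1.1, q.1.2.2))).prodMk
      (Measurable.prodMk (by fun_prop) (hno.comp (by fun_prop : Measurable fun q :
      (M.Y (t + 1) k × M.X (t + 1) × M.OObs k t) × M.NObs k (t + 1) => (q.1.2.2, q.2))))))
  rw [lintegral_step_reverse g i u hζ hG
    (φ := fun p => ∫⁻ n, QO M k p.2.1 n * φ (nextInfo g i u p.1 (mkOth p.2.2 (G p.2.2)),
        (p.2.1, othObs (nextOth g i.1 (mkOth p.2.2 (G p.2.2)) n))) ∂M.νN k (t + 1))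
    hφ'.lintegral_prod_right']
  refine lintegral_congr fun y => ?_
  have hnum : Measurable fun p : M.Old k t × (M.X (t + 1) × M.OObs k (t + 1)) =>
      numDens g i.1 ζ G u y p.1 p.2 := (measurable_numDens g i u hζ hG).comp (by fun_prop :
    Measurable fun p : M.Old k t × (M.X (t + 1) × M.OObs k (t + 1)) => ((y, p.1), p.2))
  have hm : Measurable fun q : M.X (t + 1) × M.Old k t × M.OObs k (t + 1) =>
      numDens g i.1 ζ G u y q.2.1 (q.1, q.2.2) *
        φ (nextInfo g i u y (mkOth (merge q.2.1 q.2.2) (G (merge q.2.1 q.2.2))), (q.1, q.2.2)) :=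
    (hnum.comp (by fun_prop : Measurable fun q : M.X (t + 1) × M.Old k t × M.OObs k (t + 1) =>
      (q.2.1, (q.1, q.2.2)))).mul (hφ.comp ((hni.comp (measurable_const.prodMk
        (measurable_merge.comp measurable_snd))).prodMk (by fun_prop)))
  have h1 : ∀ x', ∫⁻ a, M.Q (t + 1) k x' y * predDens g i.1 ζ G u (x', a) *
      ∫⁻ n, QO M k x' n * φ (nextInfo g i u y (mkOth a (G a)),
        (x', othObs (nextOth g i.1 (mkOth a (G a)) n))) ∂M.νN k (t + 1) ∂M.νO k t =
      ∫⁻ o, ∫⁻ a', numDens g i.1 ζ G u y o (x', a') *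
        φ (nextInfo g i u y (mkOth (merge o a') (G (merge o a'))), (x', a'))
          ∂M.νO k (t + 1) ∂M.νOld k t := by
    intro x'
    have hF0 : Measurable fun p : M.OObs k t × M.NObs k (t + 1) =>
        QO M k x' p.2 * φ (nextInfo g i u y (mkOth p.1 (G p.1)),
          (x', othObs (nextOth g i.1 (mkOth p.1 (G p.1)) p.2))) :=
      hφ'.comp (by fun_prop : Measurable fun p : M.OObs k t × M.NObs k (t + 1) =>
        ((y, x', p.1), p.2))
    have hF : Measurable fun p : M.OObs k t × M.NObs k (t + 1) =>
        M.Q (t + 1) k x' y * predDens g i.1 ζ G u (x', p.1) *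
        (QO M k x' p.2 * φ (nextInfo g i u y (mkOth p.1 (G p.1)),
          (x', othObs (nextOth g i.1 (mkOth p.1 (G p.1)) p.2)))) :=
      (measurable_const.mul (hp.comp (by fun_prop))).mul hF0
    -- The old private observations and the new ones are exchanged for the shared observations and
    -- the new private ones.
    have h2 := lintegral_νO_νN hF
    dsimp only at h2
    rw [show ∫⁻ a, M.Q (t + 1) k x' y * predDens g i.1 ζ G u (x', a) *
        ∫⁻ n, QO M k x' n * φ (nextInfo g i u y (mkOth a (G a)),
        (x', othObs (nextOth g i.1 (mkOth a (G a)) n))) ∂M.νN k (t + 1) ∂M.νO k t =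
      ∫⁻ a, ∫⁻ n, M.Q (t + 1) k x' y * predDens g i.1 ζ G u (x', a) *
        (QO M k x' n * φ (nextInfo g i u y (mkOth a (G a)),
        (x', othObs (nextOth g i.1 (mkOth a (G a)) n)))) ∂M.νN k (t + 1) ∂M.νO k t from
      lintegral_congr fun a => (lintegral_const_mul _ (hF0.comp measurable_prodMk_left)).symm, h2]
    refine lintegral_congr fun o => lintegral_congr fun a' => ?_
    rw [othObs_nextOth_of_merge (o := o) g i.1 rfl, numDens]
    ring
  rw [lintegral_congr h1, lintegral_lintegral_swap]
  exact (Measurable.lintegral_prod_right' (f := fun q : (M.X (t + 1) × M.Old k t) ×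
    M.OObs k (t + 1) => numDens g i.1 ζ G u y q.1.2 (q.1.1, q.2) *
      φ (nextInfo g i u y (mkOth (merge q.1.2 q.2) (G (merge q.1.2 q.2))), (q.1.1, q.2)))
    (hm.comp (by fun_prop : Measurable fun q : (M.X (t + 1) × M.Old k t) × M.OObs k (t + 1) =>
      (q.1.1, q.1.2, q.2)))).aemeasurable

end Step

end Model

end DelayedSharing

namespace DelayedSharing

/-- Integrals with respect to a normalized density. -/
theorem total_mul_lintegral_div {X A : Type*} [MeasurableSpace X] [MeasurableSpace A]
    (μ : Measure X) [SFinite μ] (ν : Measure A) [SFinite ν] {f : X × A → ℝ≥0∞} (hf : Measurable f)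
    (h : ∫⁻ x, ∫⁻ a, f (x, a) ∂ν ∂μ ≠ ∞) {F : X × A → ℝ≥0∞} (hF : Measurable F) :
    (∫⁻ x, ∫⁻ a, f (x, a) ∂ν ∂μ) *
      ∫⁻ x, ∫⁻ a, f (x, a) / (∫⁻ x, ∫⁻ a, f (x, a) ∂ν ∂μ) * F (x, a) ∂ν ∂μ =
    ∫⁻ x, ∫⁻ a, f (x, a) * F (x, a) ∂ν ∂μ := by
  set c := ∫⁻ x, ∫⁻ a, f (x, a) ∂ν ∂μ with hc
  have hc' : c = ∫⁻ p, f p ∂μ.prod ν := (lintegral_prod _ hf.aemeasurable).symm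
  have h1 : ∫⁻ x, ∫⁻ a, f (x, a) / c * F (x, a) ∂ν ∂μ = ∫⁻ p, f p / c * F p ∂μ.prod ν :=
    (lintegral_prod (fun p => f p / c * F p) ((hf.div_const _).mul hF).aemeasurable).symm
  have h2 : ∫⁻ x, ∫⁻ a, f (x, a) * F (x, a) ∂ν ∂μ = ∫⁻ p, f p * F p ∂μ.prod ν :=
    (lintegral_prod (fun p => f p * F p) (hf.mul hF).aemeasurable).symm
  rw [h1, h2]
  by_cases h0 : c = 0
  · rw [h0, zero_mul]
    rw [hc', lintegral_eq_zero_iff hf] at h0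
    symm
    rw [lintegral_congr_ae (g := fun _ => 0), lintegral_zero]
    filter_upwards [h0] with p hp
    rw [hp, Pi.zero_apply, zero_mul]
  · rw [← lintegral_const_mul' _ _ h]
    refine lintegral_congr fun p => ?_
    rw [← mul_assoc, ENNReal.mul_div_cancel h0 h]

/-- Only an inequality, since the total may be `0` or `∞`. It suffices for finiteness at every value
of the information, including those outside the support of its law. -/
theorem lintegral_div_total_le {X A : Type*} [MeasurableSpace X] [MeasurableSpace A]
    (μ : Measure X) (ν : Measure A) [SFinite ν] {f : X × A → ℝ≥0∞} (hf : Measurable f) :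
    ∫⁻ x, ∫⁻ a, f (x, a) / (∫⁻ x, ∫⁻ a, f (x, a) ∂ν ∂μ) ∂ν ∂μ ≤ 1 := by
  set c := ∫⁻ x, ∫⁻ a, f (x, a) ∂ν ∂μ with hc
  simp only [div_eq_mul_inv]
  have h1 : ∀ x, ∫⁻ a, f (x, a) * c⁻¹ ∂ν = (∫⁻ a, f (x, a) ∂ν) * c⁻¹ := fun x =>
    lintegral_mul_const _ (hf.comp measurable_prodMk_left)
  rw [lintegral_congr h1, lintegral_mul_const _ hf.lintegral_prod_right', ← hc]
  exact ENNReal.mul_inv_le_one c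

namespace Model

open scoped NNReal

variable {K : ℕ} {M : Model K} {k : Fin K} {t : ℕ}

section Step

variable {ζ : M.RBel k t} {G : M.OObs k t → M.OAct k t} (g : M.Profile) (i : M.Com t × M.Priv t k)
  (u : M.U t k)

theorem ae_totalDens_lt_top (hζ : Measurable ζ) (hG : Measurable G)
    (hle : ∫⁻ x, ∫⁻ a, ζ (x, a) ∂M.νO k t ∂M.νX t ≠ ∞) :
    ∀ᵐ y ∂M.νY (t + 1) k, ∀ᵐ o ∂M.νOld k t, totalDens g i.1 ζ G u y o < ∞ := by
  have hτ := measurable_totalDens g i u hζ hG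
  have ho := measurable_obsDens (t := t) g i u hζ hG
  have h1 : ∀ y, ∫⁻ o, totalDens g i.1 ζ G u y o ∂M.νOld k t =
      ∫⁻ a, obsDens g i.1 ζ G u (y, a) ∂M.νO k t := fun y => by
    have := lintegral_obsDens_mul g i u hζ hG y (φ := fun _ => 1) measurable_const
    simpa only [mul_one] using this.symm
  have h2 : ∀ᵐ y ∂M.νY (t + 1) k, ∫⁻ o, totalDens g i.1 ζ G u y o ∂M.νOld k t < ∞ := by
    simp only [h1]
    refine ae_lt_top ho.lintegral_prod_right' ?_
    rwa [lintegral_obsDens g i u hζ hG]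
  filter_upwards [h2] with y hy
  have hτy : Measurable fun o => totalDens g i.1 ζ G u y o := hτ.comp measurable_prodMk_left
  exact ae_lt_top hτy hy.ne

theorem totalDens_mul_lintegral (hζ : Measurable ζ) (hG : Measurable G)
    {y : M.Y (t + 1) k} {o : M.Old k t} (h : totalDens g i.1 ζ G u y o ≠ ∞)
    {F : M.X (t + 1) × M.OObs k (t + 1) → ℝ≥0∞} (hF : Measurable F) :
    totalDens g i.1 ζ G u y o * ∫⁻ x, ∫⁻ a, newDens g i.1 ζ G u y o (x, a) * F (x, a)
      ∂M.νO k (t + 1) ∂M.νX (t + 1) =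
    ∫⁻ x, ∫⁻ a, numDens g i.1 ζ G u y o (x, a) * F (x, a) ∂M.νO k (t + 1) ∂M.νX (t + 1) :=
  total_mul_lintegral_div _ _ ((measurable_numDens g i u hζ hG).comp
    (measurable_prodMk_left (x := (y, o)))) h hF

/-- Averaging over the new density does not change the integral. -/
theorem lintegral_step_newDens (hζ : Measurable ζ) (hG : Measurable G) (hc : Causal G)
    (hle : ∫⁻ x, ∫⁻ a, ζ (x, a) ∂M.νO k t ∂M.νX t ≠ ∞)
    {φ : (M.Com (t + 1) × M.Priv (t + 1) k) × (M.X (t + 1) × M.OObs k (t + 1)) → ℝ≥0∞}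
    (hφ : Measurable φ) {Ψ : M.Com (t + 1) × M.Priv (t + 1) k → ℝ≥0∞}
    (hΨ : ∀ y (o : M.Old k t) (a' : M.OObs k (t + 1)),
      Ψ (nextInfo g i u y (mkOth (merge o a') (G (merge o a')))) =
        ∫⁻ x, ∫⁻ a, newDens g i.1 ζ G u y o (x, a) *
          φ (nextInfo g i u y (mkOth (merge o a') (G (merge o a'))), (x, a))
          ∂M.νO k (t + 1) ∂M.νX (t + 1)) :
    ∫⁻ y, ∫⁻ o, ∫⁻ x', ∫⁻ a', numDens g i.1 ζ G u y o (x', a') *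
      φ (nextInfo g i u y (mkOth (merge o a') (G (merge o a'))), (x', a'))
        ∂M.νO k (t + 1) ∂M.νX (t + 1) ∂M.νOld k t ∂M.νY (t + 1) k =
    ∫⁻ y, ∫⁻ o, ∫⁻ x', ∫⁻ a', numDens g i.1 ζ G u y o (x', a') *
      Ψ (nextInfo g i u y (mkOth (merge o a') (G (merge o a'))))
        ∂M.νO k (t + 1) ∂M.νX (t + 1) ∂M.νOld k t ∂M.νY (t + 1) k := by
  refine lintegral_congr_ae ?_
  filter_upwards [ae_totalDens_lt_top g i u hζ hG hle] with y hy
  refine lintegral_congr_ae ?_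
  filter_upwards [hy] with o ho
  rcases isEmpty_or_nonempty (M.OObs k (t + 1)) with he | ⟨⟨a₁⟩⟩
  · simp only [lintegral_of_isEmpty]
  have hnum : Measurable (numDens g i.1 ζ G u y o) :=
    (measurable_numDens g i u hζ hG).comp (measurable_prodMk_left (x := (y, o)))
  set i₁ := nextInfo g i u y (mkOth (merge o a₁) (G (merge o a₁))) with hi₁
  -- By causality the new information depends on `y` and `o` alone. So `Ψ` is constant in the inner
  -- integrals, and any point `a₁` may be used to evaluate it.
  have h1 : ∀ a' : M.OObs k (t + 1), nextInfo g i u y (mkOth (merge o a') (G (merge o a'))) = i₁ :=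
    fun a' => hc.nextInfo_eq g i u y (by rw [oldObs_merge, oldObs_merge])
  simp only [h1]
  rw [← totalDens_mul_lintegral g i u hζ hG ho.ne (F := fun p => φ (i₁, p))
    (hφ.comp measurable_prodMk_left), hi₁, ← hΨ y o a₁, ← hi₁]
  have h2 : ∀ x, ∫⁻ a, numDens g i.1 ζ G u y o (x, a) * Ψ i₁ ∂M.νO k (t + 1) =
      (∫⁻ a, numDens g i.1 ζ G u y o (x, a) ∂M.νO k (t + 1)) * Ψ i₁ := fun x =>
    lintegral_mul_const _ (hnum.comp measurable_prodMk_left)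
  rw [lintegral_congr h2, lintegral_mul_const _ hnum.lintegral_prod_right']
  rfl

end Step

/-! ### The initial time -/

theorem lintegral_init (g : M.Profile) {φ : M.X 0 × M.Y 0 k × M.NObs k 0 → ℝ≥0∞}
    (hφ : Measurable φ) :
    ∫⁻ ω, φ (state g 0 ω, obs g k 0 ω, fun j => obs g j 0 ω) ∂M.P =
      ∫⁻ x, M.p0 x * ∫⁻ y, M.Q 0 k x y * ∫⁻ n, QO M k x n * φ (x, y, n)
        ∂M.νN k 0 ∂M.νY 0 k ∂M.νX 0 := by
  have hX := M.measurable_X0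
  have hzk := M.measurable_z 0 k
  have hzo := measurable_noiseOth (M := M) (k := k) (t := 0)
  let Own : Set (Unit ⊕ ℕ ⊕ (ℕ × Fin K)) := {Sum.inr (Sum.inr (0, k))}
  let Oths : Set (Unit ⊕ ℕ ⊕ (ℕ × Fin K)) := {i | ∃ j, j ≠ k ∧ i = Sum.inr (Sum.inr (0, j))}
  have mz : ∀ S, Own ⊆ S → Measurable[⨆ i ∈ S, noise M i] (M.z 0 k) := fun S hS =>
    measurable_z_noise (hS rfl)
  have mo : ∀ S, Oths ⊆ S → Measurable[⨆ i ∈ S, noise M i] (noiseOth M k 0) := fun S hS =>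
    (@measurable_pi_iff _ _ _ (⨆ i ∈ S, noise M i) _ _).mpr fun j =>
      measurable_z_noise (hS ⟨j.1, j.2, rfl⟩)
  have i1 : IndepFun M.X0 (fun ω => (M.z 0 k ω, noiseOth M k 0 ω)) M.P := by
    refine indepFun_of_noise (S := {Sum.inl ()}) (S' := Own ∪ Oths) ?_
      (measurable_X0_noise rfl)
      ((mz _ Set.subset_union_left).prodMk (mo _ Set.subset_union_right))
    rw [Set.disjoint_left]
    rintro i rfl (h | ⟨j', hj', h⟩)
    all_goals simp [Own] at h
  have i3 : IndepFun (M.z 0 k) (noiseOth M k 0) M.P := by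
    refine indepFun_of_noise (S := Own) (S' := Oths) ?_ (mz _ le_rfl) (mo _ le_rfl)
    rw [Set.disjoint_left]
    rintro i rfl ⟨j, hj, h⟩
    simp at h
    exact hj h.symm
  let Φ : M.X 0 × M.Z 0 k × (∀ j : {j : Fin K // j ≠ k}, M.Z 0 j) → ℝ≥0∞ := fun p =>
    φ (p.1, M.h 0 k p.1 p.2.1, fun j => M.h 0 j p.1 (p.2.2 j))
  have hΦ : Measurable Φ := by
    refine hφ.comp (measurable_fst.prodMk (Measurable.prodMk ?_ (measurable_pi_iff.mpr fun j => ?_)))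
    · exact (M.measurable_h 0 k).comp (by fun_prop :
        Measurable fun p : M.X 0 × M.Z 0 k × (∀ j : {j : Fin K // j ≠ k}, M.Z 0 j) => (p.1, p.2.1))
    · exact (M.measurable_h 0 j).comp (by fun_prop :
        Measurable fun p : M.X 0 × M.Z 0 k × (∀ j : {j : Fin K // j ≠ k}, M.Z 0 j) =>
          (p.1, p.2.2 j))
  have e0 : ∀ ω, φ (state g 0 ω, obs g k 0 ω, fun j => obs g j 0 ω) =
      Φ (M.X0 ω, (M.z 0 k ω, noiseOth M k 0 ω)) := fun ω => rfl
  simp only [e0]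
  rw [lintegral_of_indepFun hX (hzk.prodMk hzo) i1 hΦ]
  have hΨ0 : Measurable fun p : M.X 0 × M.Y 0 k =>
      ∫⁻ n, QO M k p.1 n * φ (p.1, p.2, n) ∂M.νN k 0 :=
    Measurable.lintegral_prod_right' (f := fun q : (M.X 0 × M.Y 0 k) × M.NObs k 0 =>
      QO M k q.1.1 q.2 * φ (q.1.1, q.1.2, q.2)) ((measurable_QO.comp (by fun_prop :
        Measurable fun q : (M.X 0 × M.Y 0 k) × M.NObs k 0 => (q.1.1, q.2))).mul
          (hφ.comp (by fun_prop)))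
  have hΨ : Measurable fun x => ∫⁻ y, M.Q 0 k x y * ∫⁻ n, QO M k x n * φ (x, y, n)
      ∂M.νN k 0 ∂M.νY 0 k :=
    Measurable.lintegral_prod_right' (f := fun q : M.X 0 × M.Y 0 k =>
      M.Q 0 k q.1 q.2 * ∫⁻ n, QO M k q.1 n * φ (q.1, q.2, n) ∂M.νN k 0)
      ((M.measurable_Q 0 k).mul hΨ0)
  have e1 : ∀ x, ∫⁻ ω'', Φ (x, (M.z 0 k ω'', noiseOth M k 0 ω'')) ∂M.P =
      ∫⁻ y, M.Q 0 k x y * ∫⁻ n, QO M k x n * φ (x, y, n) ∂M.νN k 0 ∂M.νY 0 k := by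
    intro x
    rw [lintegral_of_indepFun hzk hzo i3 (F := fun p => Φ (x, p)) (hΦ.comp measurable_prodMk_left)]
    have e2 : ∀ ω'', ∫⁻ ω₃, Φ (x, (M.z 0 k ω'', noiseOth M k 0 ω₃)) ∂M.P =
        ∫⁻ n, QO M k x n * φ (x, M.h 0 k x (M.z 0 k ω''), n) ∂M.νN k 0 := fun ω'' =>
      lintegral_noise_oth x (F := fun n => φ (x, M.h 0 k x (M.z 0 k ω''), n))
        (hφ.comp (by fun_prop))
    simp only [e2]
    exact lintegral_noise_own x (F := fun y => ∫⁻ n, QO M k x n * φ (x, y, n) ∂M.νN k 0)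
      (hΨ0.comp measurable_prodMk_left)
  simp only [e1]
  rw [← lintegral_map (f := fun x => ∫⁻ y, M.Q 0 k x y * ∫⁻ n, QO M k x n * φ (x, y, n)
      ∂M.νN k 0 ∂M.νY 0 k) hΨ hX, M.law_X0,
    lintegral_withDensity_eq_lintegral_mul _ M.measurable_p0 hΨ]
  rfl

theorem zero_mem_obsWin : 0 ∈ (Finset.range (0 + 1)).filter fun s => 0 < s + M.n :=
  Finset.mem_filter.mpr ⟨by simp, by have := M.one_le_n; omega⟩

/-- The observations of the first time. -/
def firstObs (a : M.OObs k 0) : M.NObs k 0 := fun j => a j ⟨0, zero_mem_obsWin⟩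

theorem measurable_firstObs : Measurable (firstObs : M.OObs k 0 → M.NObs k 0) := by
  unfold firstObs
  fun_prop

theorem measurable_priv0 {j : Fin K} : Measurable (priv0 : M.Y 0 j → M.Priv 0 j) := by
  refine Measurable.prodMk (measurable_pi_iff.mpr fun s => ?_)
      (measurable_pi_iff.mpr fun s => absurd (Finset.mem_filter.mp s.2).1 (by simp))
  exact measurable_cast_family (β := fun s => M.Y s j) _

theorem measurable_priv0_fst {j : Fin K} :
    Measurable fun y : M.Y 0 j => (priv0 y : M.Priv 0 j).1 :=
  measurable_fst.comp measurable_priv0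

theorem obsWin_zero (s : ObsWin M.n 0) : s = ⟨0, zero_mem_obsWin⟩ := by
  have := obsWin_le s
  exact Subtype.ext (by simpa using this)

theorem map_priv0 (j : Fin K) : (M.νY 0 j).map (fun y => (priv0 y : M.Priv 0 j).1) =
    Measure.pi fun s : ObsWin M.n 0 => M.νY s j := by
  symm
  refine Measure.pi_eq fun R hR => ?_
  rw [Measure.map_apply measurable_priv0_fst (MeasurableSet.univ_pi hR),
    Fintype.prod_eq_single ⟨0, zero_mem_obsWin⟩ fun s hs => absurd (obsWin_zero s) hs]
  congr 1
  ext y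
  simp only [Set.mem_preimage, Set.mem_univ_pi]
  refine ⟨fun h => h ⟨0, zero_mem_obsWin⟩, fun h s => ?_⟩
  rw [obsWin_zero s]
  exact h

/-- Integrals over the private observations of the first time. -/
theorem lintegral_νO_zero {F : M.OObs k 0 → ℝ≥0∞} (hF : Measurable F) :
    ∫⁻ a, F a ∂M.νO k 0 = ∫⁻ n, F (fun j => (priv0 (n j)).1) ∂M.νN k 0 := by
  have hm : Measurable fun n : M.NObs k 0 => (fun j => (priv0 (n j)).1 : M.OObs k 0) :=
    measurable_pi_iff.mpr fun j => measurable_priv0_fst.comp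
      (measurable_pi_apply j)
  have hmap : (M.νN k 0).map (fun n => (fun j => (priv0 (n j)).1 : M.OObs k 0)) = M.νO k 0 := by
    symm
    refine Measure.pi_eq fun R hR => ?_
    rw [Measure.map_apply hm (MeasurableSet.univ_pi hR)]
    have : (fun n : M.NObs k 0 => (fun j => (priv0 (n j)).1 : M.OObs k 0)) ⁻¹' Set.univ.pi R =
        Set.univ.pi fun j : {j : Fin K // j ≠ k} =>
          (fun y => (priv0 y : M.Priv 0 j).1) ⁻¹' R j := rfl
    rw [this, Measure.pi_pi]
    refine Finset.prod_congr rfl fun j _ => ?_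
    rw [← map_priv0, Measure.map_apply measurable_priv0_fst (hR j)]
  rw [← hmap, lintegral_map hF hm]

end Model

end DelayedSharing

namespace DelayedSharing

namespace Model

open scoped NNReal

variable {K : ℕ} {M : Model K} {k : Fin K} {t : ℕ}

/-! ### The filter -/

/-- The unnormalized density at time `0`. -/
noncomputable def initNum (y : M.Y 0 k) : M.RBel k 0 := fun p =>
  M.p0 p.1 * M.Q 0 k p.1 y * QO M k p.1 (firstObs p.2)

/-- The normalizing constant at time `0`. -/
noncomputable def initTotal (y : M.Y 0 k) : ℝ≥0∞ :=
  ∫⁻ x, ∫⁻ a, initNum y (x, a) ∂M.νO k 0 ∂M.νX 0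

/-- The own observation of time `0`. -/
def ownFirst (i : M.Com 0 × M.Priv 0 k) : M.Y 0 k := i.2.1 ⟨0, zero_mem_obsWin⟩

/-- There are no private actions at time `0`. -/
def noAct : M.OAct k 0 := fun _ s => absurd (Finset.mem_filter.mp s.2).1 (by simp)

/-- The private a posteriori density in terms of the observations of the others, and the actions of
the others as a function of their observations. -/
noncomputable def filt (g : M.Profile) (gk : M.Strat k) :
    ∀ t, M.Com t × M.Priv t k → M.RBel k t × (M.OObs k t → M.OAct k t)
  | 0 => fun i => (fun p => initNum (ownFirst i) p / initTotal (ownFirst i), fun _ => noAct)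
  | t + 1 => fun i =>
    let r := filt g gk t (prevInfo i)
    (newDens g (prevInfo i).1 r.1 r.2 (gk.1 t (prevInfo i)) (newObs i.2) (sharedObs i),
      nextRule g (prevInfo i).1 r.2 (sharedObs i))

variable (g : M.Profile) (gk : M.Strat k)

theorem measurable_initNum : Measurable fun p : M.Y 0 k × (M.X 0 × M.OObs k 0) =>
    initNum p.1 p.2 := by
  refine Measurable.mul (Measurable.mul ?_ ?_) ?_
  · exact M.measurable_p0.comp (by fun_prop)
  · exact (M.measurable_Q 0 k).comp (by fun_prop :
      Measurable fun p : M.Y 0 k × (M.X 0 × M.OObs k 0) => (p.2.1, p.1))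
  · exact measurable_QO.comp ((measurable_fst.comp measurable_snd).prodMk
      (measurable_firstObs.comp (measurable_snd.comp measurable_snd)))

theorem measurable_initTotal : Measurable (initTotal : M.Y 0 k → ℝ≥0∞) := by
  have h : Measurable fun p : M.Y 0 k × M.X 0 => ∫⁻ a, initNum p.1 (p.2, a) ∂M.νO k 0 :=
    Measurable.lintegral_prod_right' (f := fun q : (M.Y 0 k × M.X 0) × M.OObs k 0 =>
      initNum q.1.1 (q.1.2, q.2)) (measurable_initNum.comp (by fun_prop :
        Measurable fun q : (M.Y 0 k × M.X 0) × M.OObs k 0 => (q.1.1, (q.1.2, q.2))))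
  exact h.lintegral_prod_right'

theorem measurable_ownFirst : Measurable (ownFirst : M.Com 0 × M.Priv 0 k → M.Y 0 k) := by
  unfold ownFirst
  fun_prop

theorem mFam_filt (t : ℕ) :
    MFam (fun i => (filt g gk t i).1) (fun i => (filt g gk t i).2) fun i => i := by
  induction t with
  | zero =>
    refine ⟨?_, measurable_const, measurable_id⟩
    have h1 : Measurable fun p : (M.Com 0 × M.Priv 0 k) × (M.X 0 × M.OObs k 0) =>
        initNum (ownFirst p.1) p.2 :=
      measurable_initNum.comp ((measurable_ownFirst.comp measurable_fst).prodMk measurable_snd)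
    have h2 : Measurable fun p : (M.Com 0 × M.Priv 0 k) × (M.X 0 × M.OObs k 0) =>
        initTotal (ownFirst p.1) := measurable_initTotal.comp (measurable_ownFirst.comp measurable_fst)
    exact h1.div h2
  | succ t ih =>
    have hp : Measurable (prevInfo : M.Com (t + 1) × M.Priv (t + 1) k → _) := measurable_prevInfo
    have h := ih.comp hp
    have hy : Measurable fun i : M.Com (t + 1) × M.Priv (t + 1) k => newObs i.2 :=
      measurable_newObs.comp measurable_snd
    have hu : Measurable fun i : M.Com (t + 1) × M.Priv (t + 1) k => gk.1 t (prevInfo i) :=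
      (gk.2 t).comp hp
    have h1 := h.newDens g hu hy measurable_sharedObs
    refine ⟨h1, ?_, measurable_id⟩
    have hδ : Measurable fun i : M.Com (t + 1) × M.Priv (t + 1) k => (prevInfo i).1 :=
      measurable_fst.comp hp
    exact measurable_nextRule g hδ (G := fun i => (filt g gk t (prevInfo i)).2) h.rule
      measurable_sharedObs

theorem causal_filt (t : ℕ) (i : M.Com t × M.Priv t k) : Causal (filt g gk t i).2 := by
  induction t with
  | zero => exact fun a₁ a₂ s => absurd (Finset.mem_filter.mp s.2).1 (by simp)
  | succ t ih => exact (ih (prevInfo i)).nextRule g _ _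

theorem measurable_filt_dens (t : ℕ) (i : M.Com t × M.Priv t k) : Measurable (filt g gk t i).1 :=
  (mFam_filt g gk t).dens.comp measurable_prodMk_left

theorem measurable_filt_rule (t : ℕ) (i : M.Com t × M.Priv t k) : Measurable (filt g gk t i).2 :=
  (mFam_filt g gk t).rule.comp measurable_prodMk_left

theorem lintegral_filt_le (t : ℕ) (i : M.Com t × M.Priv t k) :
    ∫⁻ x, ∫⁻ a, (filt g gk t i).1 (x, a) ∂M.νO k t ∂M.νX t ≤ 1 := by
  cases t with
  | zero =>
    exact lintegral_div_total_le _ _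
      (measurable_initNum.comp (measurable_prodMk_left (x := ownFirst i)))
  | succ t =>
    refine lintegral_div_total_le _ _ (f := numDens g (prevInfo i).1 (filt g gk t (prevInfo i)).1
      (filt g gk t (prevInfo i)).2 (gk.1 t (prevInfo i)) (newObs i.2) (sharedObs i)) ?_
    exact (measurable_numDens g (prevInfo i) _ (measurable_filt_dens g gk t _)
      (measurable_filt_rule g gk t _)).comp
        (measurable_prodMk_left (x := (newObs i.2, sharedObs i)))

/-- The actions of the others are a function of their observations. -/
theorem oth_eq_mkOth (t : ℕ) (ω : M.Ω) :
    oth (Function.update g k gk) k t ω = mkOth (othObs (oth (Function.update g k gk) k t ω))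
      ((filt g gk t (info (Function.update g k gk) k t ω)).2
        (othObs (oth (Function.update g k gk) k t ω))) := by
  induction t with
  | zero =>
    rw [← mkOth_othObs_othAct (oth (Function.update g k gk) k 0 ω)]
    congr 1
  | succ t ih =>
    set lo := oth (Function.update g k gk) k t ω with hlo
    set i := info (Function.update g k gk) k t ω with hi
    rw [info_succ g gk t ω, oth_succ g gk t ω, ← hlo, ← hi]
    set n : M.NObs k (t + 1) := fun j => obs (Function.update g k gk) j (t + 1) ω
    have h1 : merge (oldObs (othObs lo)) (othObs (nextOth g i.1 lo n)) = othObs lo :=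
      merge_oldObs_nextOth g i.1 lo n
    have h2 := nextOth_eq_mkOth g i.1 (filt g gk t i).2 (oldObs (othObs lo))
      (othObs (nextOth g i.1 lo n))
    rw [h1, newest_othObs_nextOth, ← ih] at h2
    simp only [filt, prevInfo_nextInfo, sharedObs_nextInfo]
    exact h2

/-- The filter recomputes the own action from `gk` at the previous information; this matches the
update because the action taken is `gk.1 t i`. -/
theorem filt_nextInfo (i : M.Com t × M.Priv t k) (y : M.Y (t + 1) k) (lo : M.Oth k t) :
    filt g gk (t + 1) (nextInfo g i (gk.1 t i) y lo) =
      (newDens g i.1 (filt g gk t i).1 (filt g gk t i).2 (gk.1 t i) y (oldObs (othObs lo)),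
        nextRule g i.1 (filt g gk t i).2 (oldObs (othObs lo))) := by
  have h : newObs (nextInfo g i (gk.1 t i) y lo).2 = y := newObs_nextPriv _ _ _
  simp only [filt, prevInfo_nextInfo, sharedObs_nextInfo, h]

theorem measurable_lintegral_filt (t : ℕ)
    {φ : (M.Com t × M.Priv t k) × (M.X t × M.OObs k t) → ℝ≥0∞} (hφ : Measurable φ) :
    Measurable fun i => ∫⁻ x, ∫⁻ a, (filt g gk t i).1 (x, a) * φ (i, (x, a)) ∂M.νO k t ∂M.νX t := by
  have h : Measurable fun p : (M.Com t × M.Priv t k) × M.X t =>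
      ∫⁻ a, (filt g gk t p.1).1 (p.2, a) * φ (p.1, (p.2, a)) ∂M.νO k t :=
    Measurable.lintegral_prod_right' (f := fun q : ((M.Com t × M.Priv t k) × M.X t) × M.OObs k t =>
      (filt g gk t q.1.1).1 (q.1.2, q.2) * φ (q.1.1, (q.1.2, q.2)))
      (((mFam_filt g gk t).dens.mul hφ).comp (by fun_prop : Measurable fun q :
        ((M.Com t × M.Priv t k) × M.X t) × M.OObs k t => (q.1.1, (q.1.2, q.2))))
  exact h.lintegral_prod_right'

/-- Bayes' formula at time `0`: expectations are integrals against the joint density `initNum`, and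
averaging over the normalized density leaves them unchanged. -/
theorem lintegral_filt_zero
    {φ : (M.Com 0 × M.Priv 0 k) × (M.X 0 × M.OObs k 0) → ℝ≥0∞} (hφ : Measurable φ) :
    ∫⁻ ω, φ (info (Function.update g k gk) k 0 ω, (state (Function.update g k gk) 0 ω,
      othObs (oth (Function.update g k gk) k 0 ω))) ∂M.P =
    ∫⁻ ω, ∫⁻ x, ∫⁻ a, (filt g gk 0 (info (Function.update g k gk) k 0 ω)).1 (x, a) *
      φ (info (Function.update g k gk) k 0 ω, (x, a)) ∂M.νO k 0 ∂M.νX 0 ∂M.P := by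
  set g' := Function.update g k gk
  have hpo : Measurable fun n : M.NObs k 0 => (fun j => (priv0 (n j)).1 : M.OObs k 0) :=
    measurable_pi_iff.mpr fun j => measurable_priv0_fst.comp (measurable_pi_apply j)
  have hinf : Measurable fun y : M.Y 0 k => ((com0, priv0 y) : M.Com 0 × M.Priv 0 k) :=
    measurable_const.prodMk measurable_priv0
  have key : ∀ {φ : (M.Com 0 × M.Priv 0 k) × (M.X 0 × M.OObs k 0) → ℝ≥0∞}, Measurable φ →
      ∫⁻ ω, φ (info g' k 0 ω, (state g' 0 ω, othObs (oth g' k 0 ω))) ∂M.P =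
      ∫⁻ y, ∫⁻ x, ∫⁻ a, initNum y (x, a) * φ ((com0, priv0 y), (x, a))
        ∂M.νO k 0 ∂M.νX 0 ∂M.νY 0 k := by
    intro φ hφ
    have hφ' : Measurable fun p : M.X 0 × M.Y 0 k × M.NObs k 0 =>
        φ ((com0, priv0 p.2.1), (p.1, fun j => (priv0 (p.2.2 j)).1)) :=
      hφ.comp ((hinf.comp (measurable_fst.comp measurable_snd)).prodMk
        (measurable_fst.prodMk (hpo.comp (measurable_snd.comp measurable_snd))))
    refine (lintegral_init g' hφ').trans ?_
    have h1 : ∀ x, M.p0 x * ∫⁻ y, M.Q 0 k x y * ∫⁻ n, QO M k x n *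
        φ ((com0, priv0 y), (x, fun j => (priv0 (n j)).1)) ∂M.νN k 0 ∂M.νY 0 k =
        ∫⁻ y, ∫⁻ a, initNum y (x, a) * φ ((com0, priv0 y), (x, a)) ∂M.νO k 0 ∂M.νY 0 k := by
      intro x
      have hm : Measurable fun p : M.Y 0 k × M.NObs k 0 =>
          QO M k x p.2 * φ ((com0, priv0 p.1), (x, fun j => (priv0 (p.2 j)).1)) :=
        (measurable_QO.comp (measurable_const.prodMk measurable_snd)).mul
          (hφ'.comp (by fun_prop : Measurable fun p : M.Y 0 k × M.NObs k 0 => (x, p.1, p.2)))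
      have hmQ : Measurable fun y => M.Q 0 k x y * ∫⁻ n, QO M k x n *
          φ ((com0, priv0 y), (x, fun j => (priv0 (n j)).1)) ∂M.νN k 0 :=
        (measurable_Q_right x k).mul hm.lintegral_prod_right'
      rw [← lintegral_const_mul _ hmQ]
      refine lintegral_congr fun y => ?_
      have hmy : Measurable fun n =>
          QO M k x n * φ ((com0, priv0 y), (x, fun j => (priv0 (n j)).1)) :=
        hm.comp measurable_prodMk_left
      rw [← lintegral_const_mul _ hmy, ← lintegral_const_mul _ (hmy.const_mul _), lintegral_νO_zero]
      · refine lintegral_congr fun n => ?_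
        have h2 : firstObs (fun j => (priv0 (n j)).1 : M.OObs k 0) = n := rfl
        rw [initNum, h2]
        ring
      · exact (measurable_initNum.comp (by fun_prop : Measurable fun a => (y, (x, a)))).mul
          (hφ.comp (by fun_prop))
    rw [lintegral_congr h1, lintegral_lintegral_swap]
    refine (Measurable.lintegral_prod_right' (f := fun q : (M.X 0 × M.Y 0 k) × M.OObs k 0 =>
      initNum q.1.2 (q.1.1, q.2) * φ ((com0, priv0 q.1.2), (q.1.1, q.2))) ?_).aemeasurable
    exact (measurable_initNum.comp (by fun_prop : Measurable fun q :
      (M.X 0 × M.Y 0 k) × M.OObs k 0 => (q.1.2, (q.1.1, q.2)))).mul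
      (hφ.comp ((hinf.comp (measurable_snd.comp measurable_fst)).prodMk (by fun_prop)))
  have hΨ := measurable_lintegral_filt g gk 0 hφ
  rw [key hφ]
  refine Eq.trans ?_ (key (hΨ.comp measurable_fst)).symm
  have hnum : ∀ y : M.Y 0 k, Measurable (initNum y) := fun y =>
    measurable_initNum.comp measurable_prodMk_left
  -- The normalizer is the density of the first own observation, so its integral is `1`.
  have hfin : ∀ᵐ y ∂M.νY 0 k, initTotal y < ∞ := by
    refine ae_lt_top measurable_initTotal ?_
    have h1 := key (φ := fun _ => 1) measurable_const
    simp only [lintegral_one, measure_univ, mul_one] at h1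
    exact ne_of_eq_of_ne h1.symm ENNReal.one_ne_top
  refine lintegral_congr_ae ?_
  filter_upwards [hfin] with y hy
  have hφy : Measurable fun p => φ ((com0, priv0 y), p) := hφ.comp measurable_prodMk_left
  have h2 : ∀ x, ∫⁻ a, initNum y (x, a) * ∫⁻ x, ∫⁻ a, (filt g gk 0 (com0, priv0 y)).1 (x, a) *
      φ ((com0, priv0 y), (x, a)) ∂M.νO k 0 ∂M.νX 0 ∂M.νO k 0 =
      (∫⁻ a, initNum y (x, a) ∂M.νO k 0) * ∫⁻ x, ∫⁻ a, (filt g gk 0 (com0, priv0 y)).1 (x, a) *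
      φ ((com0, priv0 y), (x, a)) ∂M.νO k 0 ∂M.νX 0 := fun x =>
    lintegral_mul_const _ ((hnum y).comp measurable_prodMk_left)
  dsimp only [Function.comp_apply]
  rw [lintegral_congr h2, lintegral_mul_const _ (hnum y).lintegral_prod_right']
  exact (total_mul_lintegral_div _ _ (hnum y) hy.ne hφy).symm

end Model

end DelayedSharing

namespace DelayedSharing

/-! ### The filter as conditional law -/

namespace Model

open scoped NNReal

variable {K : ℕ} {M : Model K} {k : Fin K} {t : ℕ} (g : M.Profile) (gk : M.Strat k)

/-- The joint conditional law of the old and the new data, given that of the old data. -/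
theorem lintegral_filt_step
    (h : ∀ {φ : (M.Com t × M.Priv t k) × (M.X t × M.OObs k t) → ℝ≥0∞}, Measurable φ →
      ∫⁻ ω, φ (info (Function.update g k gk) k t ω, (state (Function.update g k gk) t ω,
        othObs (oth (Function.update g k gk) k t ω))) ∂M.P =
      ∫⁻ ω, ∫⁻ x, ∫⁻ a, (filt g gk t (info (Function.update g k gk) k t ω)).1 (x, a) *
        φ (info (Function.update g k gk) k t ω, (x, a)) ∂M.νO k t ∂M.νX t ∂M.P)
    {φ : ((M.Com t × M.Priv t k) × (M.X t × M.OObs k t)) ×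
      M.X (t + 1) × M.Y (t + 1) k × M.NObs k (t + 1) → ℝ≥0∞} (hφ : Measurable φ) :
    ∫⁻ ω, φ ((info (Function.update g k gk) k t ω, (state (Function.update g k gk) t ω,
        othObs (oth (Function.update g k gk) k t ω))), state (Function.update g k gk) (t + 1) ω,
        obs (Function.update g k gk) k (t + 1) ω,
        fun j => obs (Function.update g k gk) j (t + 1) ω) ∂M.P =
      ∫⁻ ω, ∫⁻ x, ∫⁻ a, (filt g gk t (info (Function.update g k gk) k t ω)).1 (x, a) *
        ∫⁻ x', M.S t x (jointAct g (info (Function.update g k gk) k t ω).1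
          (mkOth a ((filt g gk t (info (Function.update g k gk) k t ω)).2 a))
          (gk.1 t (info (Function.update g k gk) k t ω))) x' *
        ∫⁻ y, M.Q (t + 1) k x' y * ∫⁻ n, QO M k x' n *
          φ ((info (Function.update g k gk) k t ω, (x, a)), x', y, n)
          ∂M.νN k (t + 1) ∂M.νY (t + 1) k ∂M.νX (t + 1) ∂M.νO k t ∂M.νX t ∂M.P := by
  have hF := mFam_filt g gk t
  have hφ1 : Measurable fun q : (((M.Com t × M.Priv t k) × (M.X t × M.OObs k t)) ×
      M.X (t + 1)) × M.Y (t + 1) k => ∫⁻ n, QO M k q.1.2 n * φ (q.1.1, q.1.2, q.2, n)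
        ∂M.νN k (t + 1) :=
    Measurable.lintegral_prod_right' (f := fun r : ((((M.Com t × M.Priv t k) ×
      (M.X t × M.OObs k t)) × M.X (t + 1)) × M.Y (t + 1) k) × M.NObs k (t + 1) =>
      QO M k r.1.1.2 r.2 * φ (r.1.1.1, r.1.1.2, r.1.2, r.2))
      ((measurable_QO.comp (by fun_prop : Measurable fun r : ((((M.Com t × M.Priv t k) ×
      (M.X t × M.OObs k t)) × M.X (t + 1)) × M.Y (t + 1) k) × M.NObs k (t + 1) =>
        (r.1.1.2, r.2))).mul (hφ.comp (by fun_prop)))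
  have hφ2 : Measurable fun q : ((M.Com t × M.Priv t k) × (M.X t × M.OObs k t)) ×
      M.X (t + 1) => ∫⁻ y, M.Q (t + 1) k q.2 y * ∫⁻ n, QO M k q.2 n * φ (q.1, q.2, y, n)
        ∂M.νN k (t + 1) ∂M.νY (t + 1) k :=
    Measurable.lintegral_prod_right' (f := fun r : (((M.Com t × M.Priv t k) ×
      (M.X t × M.OObs k t)) × M.X (t + 1)) × M.Y (t + 1) k => M.Q (t + 1) k r.1.2 r.2 *
        ∫⁻ n, QO M k r.1.2 n * φ (r.1.1, r.1.2, r.2, n) ∂M.νN k (t + 1))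
      (((M.measurable_Q (t + 1) k).comp (by fun_prop : Measurable fun r : (((M.Com t × M.Priv t k) ×
      (M.X t × M.OObs k t)) × M.X (t + 1)) × M.Y (t + 1) k => (r.1.2, r.2))).mul hφ1)
  have hJ : Measurable fun q : (M.Com t × M.Priv t k) × (M.X t × M.OObs k t) =>
      jointAct g q.1.1 (mkOth q.2.2 ((filt g gk t q.1).2 q.2.2)) (gk.1 t q.1) :=
    (hF.jointAct g (gk.2 t)).comp (by fun_prop :
      Measurable fun q : (M.Com t × M.Priv t k) × (M.X t × M.OObs k t) => (q.1, q.2.2))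
  have hφ3 : Measurable fun q : (M.Com t × M.Priv t k) × (M.X t × M.OObs k t) =>
      ∫⁻ x', M.S t q.2.1 (jointAct g q.1.1 (mkOth q.2.2 ((filt g gk t q.1).2 q.2.2))
        (gk.1 t q.1)) x' * ∫⁻ y, M.Q (t + 1) k x' y * ∫⁻ n, QO M k x' n * φ (q, x', y, n)
        ∂M.νN k (t + 1) ∂M.νY (t + 1) k ∂M.νX (t + 1) :=
    Measurable.lintegral_prod_right' (f := fun r : ((M.Com t × M.Priv t k) ×
      (M.X t × M.OObs k t)) × M.X (t + 1) => M.S t r.1.2.1 (jointAct g r.1.1.1 (mkOth r.1.2.2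
        ((filt g gk t r.1.1).2 r.1.2.2)) (gk.1 t r.1.1)) r.2 * ∫⁻ y, M.Q (t + 1) k r.2 y *
        ∫⁻ n, QO M k r.2 n * φ (r.1, r.2, y, n) ∂M.νN k (t + 1) ∂M.νY (t + 1) k)
      (((M.measurable_S t).comp ((measurable_fst.comp (measurable_snd.comp measurable_fst)).prodMk
        ((hJ.comp measurable_fst).prodMk measurable_snd))).mul hφ2)
  refine Eq.trans ?_ (h hφ3)
  have hφ' : Measurable fun p : (M.X t × M.Com t × (∀ j, M.Priv t j)) × M.X (t + 1) ×
      M.Y (t + 1) k × M.NObs k (t + 1) => φ ((((p.1.2.1, p.1.2.2 k), (p.1.1,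
        othObs (fun j => p.1.2.2 j : M.Oth k t))) :
          (M.Com t × M.Priv t k) × (M.X t × M.OObs k t)), p.2) := by
    unfold othObs
    exact hφ.comp (by fun_prop)
  refine (lintegral_step (Function.update g k gk) hφ').trans (lintegral_congr fun ω => ?_)
  rw [act_update]
  conv_lhs => rw [oth_eq_mkOth g gk t ω]
  rfl

/-- The filter is the conditional law. -/
theorem lintegral_filt (t : ℕ)
    {φ : (M.Com t × M.Priv t k) × (M.X t × M.OObs k t) → ℝ≥0∞} (hφ : Measurable φ) :
    ∫⁻ ω, φ (info (Function.update g k gk) k t ω, (state (Function.update g k gk) t ω,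
      othObs (oth (Function.update g k gk) k t ω))) ∂M.P =
    ∫⁻ ω, ∫⁻ x, ∫⁻ a, (filt g gk t (info (Function.update g k gk) k t ω)).1 (x, a) *
      φ (info (Function.update g k gk) k t ω, (x, a)) ∂M.νO k t ∂M.νX t ∂M.P := by
  induction t with
  | zero => exact lintegral_filt_zero g gk hφ
  | succ t ih =>
    set g' := Function.update g k gk with hg'
    have hF := mFam_filt g gk t
    -- Expectations at time `t + 1` are written with unnormalized densities. This is applied to `φ`
    -- and to its average over the new filter density; `lintegral_step_newDens` identifies the two
    -- results.
    have key : ∀ {φ : (M.Com (t + 1) × M.Priv (t + 1) k) × (M.X (t + 1) × M.OObs k (t + 1)) →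
        ℝ≥0∞}, Measurable φ →
        ∫⁻ ω, φ (info g' k (t + 1) ω, (state g' (t + 1) ω, othObs (oth g' k (t + 1) ω))) ∂M.P =
        ∫⁻ ω, ∫⁻ y, ∫⁻ o, ∫⁻ x', ∫⁻ a', numDens g (info g' k t ω).1 (filt g gk t (info g' k t ω)).1
          (filt g gk t (info g' k t ω)).2 (gk.1 t (info g' k t ω)) y o (x', a') *
          φ (nextInfo g (info g' k t ω) (gk.1 t (info g' k t ω)) y (mkOth (merge o a')
            ((filt g gk t (info g' k t ω)).2 (merge o a'))), (x', a'))
          ∂M.νO k (t + 1) ∂M.νX (t + 1) ∂M.νOld k t ∂M.νY (t + 1) k ∂M.P := by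
      intro φ hφ
      have hmk : Measurable fun q : ((M.Com t × M.Priv t k) × (M.X t × M.OObs k t)) ×
          M.X (t + 1) × M.Y (t + 1) k × M.NObs k (t + 1) =>
          mkOth q.1.2.2 ((filt g gk t q.1.1).2 q.1.2.2) :=
        hF.mkOth.comp (by fun_prop : Measurable fun q : ((M.Com t × M.Priv t k) ×
          (M.X t × M.OObs k t)) × M.X (t + 1) × M.Y (t + 1) k × M.NObs k (t + 1) =>
          (q.1.1, q.1.2.2))
      have hu : Measurable fun q : ((M.Com t × M.Priv t k) × (M.X t × M.OObs k t)) ×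
          M.X (t + 1) × M.Y (t + 1) k × M.NObs k (t + 1) => gk.1 t q.1.1 :=
        (gk.2 t).comp (measurable_fst.comp measurable_fst)
      have hφ' : Measurable fun q : ((M.Com t × M.Priv t k) × (M.X t × M.OObs k t)) ×
          M.X (t + 1) × M.Y (t + 1) k × M.NObs k (t + 1) =>
          φ (nextInfo g q.1.1 (gk.1 t q.1.1) q.2.2.1 (mkOth q.1.2.2 ((filt g gk t q.1.1).2 q.1.2.2)),
            (q.2.1, othObs (nextOth g q.1.1.1 (mkOth q.1.2.2 ((filt g gk t q.1.1).2 q.1.2.2))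
              q.2.2.2))) := by
        refine hφ.comp (Measurable.prodMk ?_ (Measurable.prodMk (by fun_prop) ?_))
        · exact (measurable_nextInfo g).comp ((measurable_fst.comp measurable_fst).prodMk
            (hu.prodMk (Measurable.prodMk (by fun_prop) hmk)))
        · exact measurable_othObs.comp ((measurable_nextOth g).comp (Measurable.prodMk
            (by fun_prop) (hmk.prodMk (by fun_prop))))
      refine Eq.trans ?_ ((lintegral_filt_step g gk ih hφ').trans (lintegral_congr fun ω =>
        lintegral_step_num g (info g' k t ω) (gk.1 t (info g' k t ω))
          (measurable_filt_dens g gk t _) (measurable_filt_rule g gk t _) hφ))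
      refine lintegral_congr fun ω => ?_
      dsimp only
      rw [← oth_eq_mkOth g gk t ω, info_succ, oth_succ]
    rw [key hφ]
    refine Eq.trans ?_ (key ((measurable_lintegral_filt g gk (t + 1) hφ).comp measurable_fst)).symm
    refine lintegral_congr fun ω => ?_
    refine lintegral_step_newDens g (info g' k t ω) (gk.1 t (info g' k t ω))
      (measurable_filt_dens g gk t _) (measurable_filt_rule g gk t _) (causal_filt g gk t _)
      (ne_top_of_le_ne_top ENNReal.one_ne_top (lintegral_filt_le g gk t _)) hφ
      (Ψ := fun i => ∫⁻ x, ∫⁻ a, (filt g gk (t + 1) i).1 (x, a) * φ (i, (x, a))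
        ∂M.νO k (t + 1) ∂M.νX (t + 1)) fun y o a' => ?_
    have h1 : oldObs (othObs (mkOth (merge o a')
        ((filt g gk t (info g' k t ω)).2 (merge o a')))) = o := oldObs_merge o a'
    rw [filt_nextInfo, h1]

theorem lintegral_QO_mul_const (c : ℝ≥0∞) (x : M.X t) : ∫⁻ n, QO M k x n * c ∂M.νN k t = c := by
  have : Measurable (QO M k x) := measurable_QO.comp measurable_prodMk_left
  rw [lintegral_mul_const _ this, lintegral_QO, one_mul]

/-- The conditional law of the new observation and of the observations of the others. -/
theorem lintegral_filt_obs (t : ℕ)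
    {φ : (M.Com t × M.Priv t k) × (M.Y (t + 1) k × M.OObs k t) → ℝ≥0∞} (hφ : Measurable φ) :
    ∫⁻ ω, φ (info (Function.update g k gk) k t ω, (obs (Function.update g k gk) k (t + 1) ω,
      othObs (oth (Function.update g k gk) k t ω))) ∂M.P =
    ∫⁻ ω, ∫⁻ y, ∫⁻ a, obsDens g (info (Function.update g k gk) k t ω).1
      (filt g gk t (info (Function.update g k gk) k t ω)).1
      (filt g gk t (info (Function.update g k gk) k t ω)).2
      (gk.1 t (info (Function.update g k gk) k t ω)) (y, a) *
      φ (info (Function.update g k gk) k t ω, (y, a)) ∂M.νO k t ∂M.νY (t + 1) k ∂M.P := by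
  have h1 := lintegral_filt_step g gk (lintegral_filt g gk t)
    (φ := fun q => φ (q.1.1, (q.2.2.1, q.1.2.2))) (hφ.comp (by fun_prop))
  refine h1.trans (lintegral_congr fun ω => ?_)
  simp only [lintegral_QO_mul_const]
  exact lintegral_step_obs g _ _ (measurable_filt_dens g gk t _) (measurable_filt_rule g gk t _)
    (φ := fun q => φ (info (Function.update g k gk) k t ω, q)) (hφ.comp measurable_prodMk_left)

end Model

end DelayedSharing

namespace DelayedSharing

namespace Model

open scoped NNReal

variable {K : ℕ} {M : Model K} {k : Fin K} {t : ℕ}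

/-! ### A posteriori densities -/

open Classical in
/-- The density that is represented by `ζ` and `G`. -/
noncomputable def liftBel (ζ : M.RBel k t) (G : M.OObs k t → M.OAct k t) : M.Bel k t := fun p =>
  if othAct p.2 = G (othObs p.2) then ζ (p.1, othObs p.2) else 0

theorem rep_liftBel (ζ : M.RBel k t) (G : M.OObs k t → M.OAct k t) : Rep (liftBel ζ G) ζ G :=
  Filter.Eventually.of_forall fun _ _ => rfl

variable (g : M.Profile) (gk : M.Strat k)

theorem isPosterior_filt (t : ℕ) : IsPosterior (Function.update g k gk) k t
    fun i => liftBel (filt g gk t i).1 (filt g gk t i).2 := by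
  have hF := mFam_filt g gk t
  have hm : Measurable fun p : (M.Com t × M.Priv t k) × (M.X t × M.Oth k t) =>
      (p.1, othObs p.2.2) :=
    measurable_fst.prodMk (measurable_othObs.comp (measurable_snd.comp measurable_snd))
  refine ⟨?_, fun φ hφ => ?_⟩
  · refine Measurable.ite (measurableSet_eq_fun
      (measurable_othAct.comp (measurable_snd.comp measurable_snd)) (hF.rule.comp hm)) ?_
      measurable_const
    exact hF.dens.comp (measurable_fst.prodMk ((measurable_fst.comp measurable_snd).prodMk
      (measurable_othObs.comp (measurable_snd.comp measurable_snd))))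
  · have hφ' : Measurable fun p : (M.Com t × M.Priv t k) × (M.X t × M.OObs k t) =>
        φ (p.1, (p.2.1, mkOth p.2.2 ((filt g gk t p.1).2 p.2.2))) :=
      hφ.comp (measurable_fst.prodMk ((measurable_fst.comp measurable_snd).prodMk
        (hF.mkOth.comp (measurable_fst.prodMk (measurable_snd.comp measurable_snd)))))
    have h1 := lintegral_filt g gk t hφ'
    simp only [← oth_eq_mkOth] at h1
    rw [h1]
    refine lintegral_congr fun ω => ?_
    rw [(rep_liftBel _ _).intBel]
    exact lintegral_congr fun x => lintegral_congr fun a => mul_comm _ _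

theorem lintegral_info_prod (g : M.Profile) {F : (M.Com t × M.Priv t k) × (M.X t × M.OObs k t) → ℝ≥0∞}
    (hF : Measurable F) :
    ∫⁻ ω, ∫⁻ x, ∫⁻ a, F (info g k t ω, (x, a)) ∂M.νO k t ∂M.νX t ∂M.P =
      ∫⁻ q, F q ∂(M.P.map (info g k t)).prod ((M.νX t).prod (M.νO k t)) := by
  rw [lintegral_prod _ hF.aemeasurable, lintegral_map hF.lintegral_prod_right' (measurable_info g k t)]
  refine lintegral_congr fun ω => ?_
  exact (lintegral_prod (fun p => F (info g k t ω, p))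
    (hF.comp measurable_prodMk_left).aemeasurable).symm

/-- The mass of the filter is at most `1` everywhere and has expectation `1`. -/
theorem ae_lintegral_filt_eq_one (t : ℕ) : ∀ᵐ i ∂M.P.map (info (Function.update g k gk) k t),
    ∫⁻ x, ∫⁻ a, (filt g gk t i).1 (x, a) ∂M.νO k t ∂M.νX t = 1 := by
  have hm := measurable_lintegral_filt g gk t (φ := fun _ => 1) measurable_const
  simp only [mul_one] at hm
  have h1 := lintegral_filt g gk t (φ := fun _ => 1) measurable_const
  simp only [mul_one, lintegral_one, measure_univ] at h1
  have hi := measurable_info (Function.update g k gk) k t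
  have := Measure.isProbabilityMeasure_map (μ := M.P) hi.aemeasurable
  refine ae_eq_of_ae_le_of_lintegral_le
    (Filter.Eventually.of_forall fun i => lintegral_filt_le g gk t i) ?_ aemeasurable_const ?_
  · rw [lintegral_map hm hi, ← h1]
    exact ENNReal.one_ne_top
  · rw [lintegral_map hm hi, ← h1]
    simp

variable {ξ : M.Com t × M.Priv t k → M.Bel k t}

/-- For each single rule `v` the claim is immediate, but there may be uncountably many. A measurable
selection `s` picks an action vector off the graph of `G` where the density is nonzero, if there is
one. Testing the posterior with the indicator of the graph of `s` off that of `G` gives zero, as the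
true actions lie on the graph of `G`. -/
theorem ae_forall_ne_eq_zero (hξ : IsPosterior (Function.update g k gk) k t ξ) :
    ∀ᵐ q ∂(M.P.map (info (Function.update g k gk) k t)).prod ((M.νX t).prod (M.νO k t)),
      ∀ v, v ≠ (filt g gk t q.1).2 q.2.2 → ξ q.1 (q.2.1, mkOth q.2.2 v) = 0 := by
  set g' := Function.update g k gk with hg'
  have hF := mFam_filt g gk t
  have hi := measurable_info g' k t
  have := Measure.isProbabilityMeasure_map (μ := M.P) hi.aemeasurable
  have : Nonempty (M.OAct k t) := by
    obtain ⟨ω⟩ : Nonempty M.Ω := nonempty_of_isProbabilityMeasure M.P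
    exact ⟨othAct (oth g' k t ω)⟩
  have hG : Measurable fun q : (M.Com t × M.Priv t k) × (M.X t × M.OObs k t) =>
      (filt g gk t q.1).2 q.2.2 :=
    hF.rule.comp (by fun_prop : Measurable fun q :
      (M.Com t × M.Priv t k) × (M.X t × M.OObs k t) => (q.1, q.2.2))
  have hξm : Measurable fun p : ((M.Com t × M.Priv t k) × (M.X t × M.OObs k t)) × M.OAct k t =>
      ξ p.1.1 (p.1.2.1, mkOth p.1.2.2 p.2) :=
    hξ.1.comp ((measurable_fst.comp measurable_fst).prodMk (Measurable.prodMk (by fun_prop)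
      (measurable_mkOth.comp (by fun_prop : Measurable fun p :
        ((M.Com t × M.Priv t k) × (M.X t × M.OObs k t)) × M.OAct k t => (p.1.2.2, p.2)))))
  obtain ⟨s, hs, hsae⟩ := exists_measurable_ae_selection
    ((M.P.map (info g' k t)).prod ((M.νX t).prod (M.νO k t)))
    (A := {p : ((M.Com t × M.Priv t k) × (M.X t × M.OObs k t)) × M.OAct k t |
      p.2 ≠ (filt g gk t p.1.1).2 p.1.2.2 ∧ ξ p.1.1 (p.1.2.1, mkOth p.1.2.2 p.2) ≠ 0})
    ((measurableSet_eq_fun measurable_snd (hG.comp measurable_fst)).compl.inter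
      (hξm (measurableSet_singleton 0)).compl)
  have hsm : Measurable fun p : (M.Com t × M.Priv t k) × (M.X t × M.Oth k t) =>
      s (p.1, (p.2.1, othObs p.2.2)) :=
    hs.comp (measurable_fst.prodMk ((measurable_fst.comp measurable_snd).prodMk
      (measurable_othObs.comp (measurable_snd.comp measurable_snd))))
  have hGm : Measurable fun p : (M.Com t × M.Priv t k) × (M.X t × M.Oth k t) =>
      (filt g gk t p.1).2 (othObs p.2.2) :=
    hF.rule.comp (measurable_fst.prodMk
      (measurable_othObs.comp (measurable_snd.comp measurable_snd)))
  have hA : Measurable fun p : (M.Com t × M.Priv t k) × (M.X t × M.Oth k t) => othAct p.2.2 :=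
    measurable_othAct.comp (measurable_snd.comp measurable_snd)
  classical
  let φ : (M.Com t × M.Priv t k) × (M.X t × M.Oth k t) → ℝ≥0∞ := fun p =>
    if othAct p.2.2 = s (p.1, (p.2.1, othObs p.2.2)) ∧
      othAct p.2.2 ≠ (filt g gk t p.1).2 (othObs p.2.2) then 1 else 0
  have hφ : Measurable φ := Measurable.ite ((measurableSet_eq_fun hA hsm).inter
    (measurableSet_eq_fun hA hGm).compl) measurable_const measurable_const
  let F : (M.Com t × M.Priv t k) × (M.X t × M.OObs k t) → ℝ≥0∞ := fun q =>
    if s q ≠ (filt g gk t q.1).2 q.2.2 then ξ q.1 (q.2.1, mkOth q.2.2 (s q)) else 0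
  have hFm : Measurable F := Measurable.ite (measurableSet_eq_fun hs hG).compl
    (hξm.comp (measurable_id.prodMk hs)) measurable_const
  have h1 := hξ.2 φ hφ
  have h2 : ∀ ω, φ (info g' k t ω, (state g' t ω, oth g' k t ω)) = 0 := fun ω =>
    if_neg fun h => h.2 (congrArg othAct (oth_eq_mkOth g gk t ω))
  have h3 : ∀ i, intBel (ξ i) (fun p => φ (i, p)) = ∫⁻ x, ∫⁻ a, F (i, (x, a)) ∂M.νO k t ∂M.νX t := by
    intro i
    refine lintegral_congr fun x => lintegral_congr fun a => ?_
    change ∑' v, φ (i, (x, mkOth a v)) * ξ i (x, mkOth a v) = _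
    have h4 : ∀ v, φ (i, (x, mkOth a v)) = if v = s (i, (x, a)) ∧ v ≠ (filt g gk t i).2 a then 1
      else 0 := fun v => rfl
    rw [tsum_eq_single (s (i, (x, a))), h4]
    · by_cases h : s (i, (x, a)) = (filt g gk t i).2 a
      · simp [F, h]
      · simp [F, h]
    · intro v hv
      rw [h4, if_neg fun h => hv h.1, zero_mul]
  simp only [h2, lintegral_zero, h3] at h1
  rw [lintegral_info_prod g' hFm, eq_comm, lintegral_eq_zero_iff hFm] at h1
  filter_upwards [h1, hsae] with q hq hq'
  by_contra! hcon
  obtain ⟨v, hv, hv'⟩ := hcon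
  obtain ⟨h5, h6⟩ := hq' ⟨v, hv, hv'⟩
  refine h6 ?_
  simpa [F, show s q ≠ (filt g gk t q.1).2 q.2.2 from h5] using hq

/-- All versions of the a posteriori density are represented by the filter. -/
theorem ae_good (hξ : IsPosterior (Function.update g k gk) k t ξ) :
    ∀ᵐ i ∂M.P.map (info (Function.update g k gk) k t),
      Good (ξ i) (filt g gk t i).1 (filt g gk t i).2 := by
  set g' := Function.update g k gk with hg'
  have hF := mFam_filt g gk t
  have hi := measurable_info g' k t
  have := Measure.isProbabilityMeasure_map (μ := M.P) hi.aemeasurable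
  let ζ' : (M.Com t × M.Priv t k) × (M.X t × M.OObs k t) → ℝ≥0∞ := fun q =>
    ξ q.1 (q.2.1, mkOth q.2.2 ((filt g gk t q.1).2 q.2.2))
  have hmk : Measurable fun q : (M.Com t × M.Priv t k) × (M.X t × M.OObs k t) =>
      mkOth q.2.2 ((filt g gk t q.1).2 q.2.2) :=
    hF.mkOth.comp (by fun_prop : Measurable fun q :
      (M.Com t × M.Priv t k) × (M.X t × M.OObs k t) => (q.1, q.2.2))
  have hζ' : Measurable ζ' :=
    hξ.1.comp (measurable_fst.prodMk ((measurable_fst.comp measurable_snd).prodMk hmk))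
  have hrep : ∀ᵐ i ∂M.P.map (info g' k t), Rep (ξ i) (fun p => ζ' (i, p)) (filt g gk t i).2 := by
    filter_upwards [Measure.ae_ae_of_ae_prod (ae_forall_ne_eq_zero g gk hξ)] with i h
    filter_upwards [h] with p hp v
    by_cases hv : v = (filt g gk t i).2 p.2
    · rw [if_pos hv, hv]
    · rw [if_neg hv, hp v hv]
  have hlaw : ∀ {φ : (M.Com t × M.Priv t k) × (M.X t × M.OObs k t) → ℝ≥0∞}, Measurable φ →
      ∫⁻ q, ζ' q * φ q ∂(M.P.map (info g' k t)).prod ((M.νX t).prod (M.νO k t)) =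
      ∫⁻ q, (filt g gk t q.1).1 q.2 * φ q
        ∂(M.P.map (info g' k t)).prod ((M.νX t).prod (M.νO k t)) := by
    intro φ hφ
    have hφ1 : Measurable fun q => ζ' q * φ q := hζ'.mul hφ
    have hφ2 : Measurable fun q => (filt g gk t q.1).1 q.2 * φ q := hF.dens.mul hφ
    rw [← lintegral_info_prod g' hφ1, ← lintegral_info_prod g' hφ2]
    refine Eq.trans ?_ (lintegral_filt g gk t hφ)
    symm
    have h1 := hξ.2 (fun p => φ (p.1, (p.2.1, othObs p.2.2))) (hφ.comp (measurable_fst.prodMk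
      ((measurable_fst.comp measurable_snd).prodMk
        (measurable_othObs.comp (measurable_snd.comp measurable_snd)))))
    dsimp only at h1
    rw [h1]
    refine lintegral_congr_ae ?_
    filter_upwards [ae_of_ae_map hi.aemeasurable hrep] with ω hω
    rw [hω.intBel]
    refine lintegral_congr fun x => lintegral_congr fun a => ?_
    exact mul_comm _ _
  -- Both densities give the same integral to every nonnegative measurable test function with
  -- respect to a σ-finite measure, so they agree almost everywhere.
  have heq : ζ' =ᵐ[(M.P.map (info g' k t)).prod ((M.νX t).prod (M.νO k t))]
      fun q => (filt g gk t q.1).1 q.2 := by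
    refine ae_eq_of_forall_setLIntegral_eq_of_sigmaFinite hζ' hF.dens fun S hS _ => ?_
    have h1 := hlaw (φ := S.indicator 1) (measurable_one.indicator hS)
    rw [← lintegral_indicator hS, ← lintegral_indicator hS]
    have h2 : ∀ f : (M.Com t × M.Priv t k) × (M.X t × M.OObs k t) → ℝ≥0∞,
        S.indicator f = fun q => f q * S.indicator 1 q := fun f => by
      funext q
      by_cases hq : q ∈ S <;> simp [hq]
    rw [h2 ζ', h2 fun q => (filt g gk t q.1).1 q.2]
    exact h1
  filter_upwards [hrep, Measure.ae_ae_of_ae_prod heq, ae_lintegral_filt_eq_one g gk t]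
    with i h1 h2 h3
  have h4 : Rep (ξ i) (filt g gk t i).1 (filt g gk t i).2 := by
    filter_upwards [h1, h2] with p hp hp' v
    rw [hp v, hp']
  refine ⟨⟨hξ.1.comp measurable_prodMk_left, ?_⟩, h4, measurable_filt_dens g gk t i,
    measurable_filt_rule g gk t i, causal_filt g gk t i⟩
  rw [h4.intBel]
  simpa only [one_mul] using h3

/-- The joint predictive density is the conditional density. -/
theorem lintegral_pred (hξ : IsPosterior (Function.update g k gk) k t ξ)
    {φ : (M.Com t × M.Priv t k) × (M.Y (t + 1) k × M.Oth k t × M.X t × M.X (t + 1)) → ℝ≥0∞}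
    (hφ : Measurable φ) :
    ∫⁻ ω, φ (info (Function.update g k gk) k t ω, (obs (Function.update g k gk) k (t + 1) ω,
      oth (Function.update g k gk) k t ω, state (Function.update g k gk) t ω,
      state (Function.update g k gk) (t + 1) ω)) ∂M.P =
    ∫⁻ ω, intPred g (ξ (info (Function.update g k gk) k t ω))
      (info (Function.update g k gk) k t ω).1 (gk.1 t (info (Function.update g k gk) k t ω))
      (fun q => φ (info (Function.update g k gk) k t ω, q)) ∂M.P := by
  set g' := Function.update g k gk with hg'
  have hF := mFam_filt g gk t
  have hi := measurable_info g' k t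
  have hφ' : Measurable fun q : ((M.Com t × M.Priv t k) × (M.X t × M.OObs k t)) ×
      M.X (t + 1) × M.Y (t + 1) k × M.NObs k (t + 1) =>
      φ (q.1.1, (q.2.2.1, mkOth q.1.2.2 ((filt g gk t q.1.1).2 q.1.2.2), q.1.2.1, q.2.1)) := by
    have hmk : Measurable fun q : ((M.Com t × M.Priv t k) × (M.X t × M.OObs k t)) ×
        M.X (t + 1) × M.Y (t + 1) k × M.NObs k (t + 1) =>
        mkOth q.1.2.2 ((filt g gk t q.1.1).2 q.1.2.2) :=
      hF.mkOth.comp (by fun_prop : Measurable fun q : ((M.Com t × M.Priv t k) ×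
        (M.X t × M.OObs k t)) × M.X (t + 1) × M.Y (t + 1) k × M.NObs k (t + 1) =>
        (q.1.1, q.1.2.2))
    exact hφ.comp (Measurable.prodMk (by fun_prop) (Measurable.prodMk (by fun_prop)
      (hmk.prodMk (by fun_prop))))
  have h1 := lintegral_filt_step g gk (lintegral_filt g gk t) hφ'
  simp only [← oth_eq_mkOth, lintegral_QO_mul_const] at h1
  refine h1.trans (lintegral_congr_ae ?_)
  filter_upwards [ae_of_ae_map hi.aemeasurable (ae_good g gk hξ)] with ω hω
  rw [hω.rep.intPred]
  set i := info g' k t ω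
  set ζ := (filt g gk t i).1
  set G := (filt g gk t i).2
  set u := gk.1 t i
  have hS := measurable_step_right g i u hω.rule
  have hQ := M.measurable_Q (t + 1) k
  have hmk : Measurable fun a => mkOth a (G a) :=
    measurable_mkOth.comp (measurable_id.prodMk hω.rule)
  have hφi : Measurable fun p : M.X t × M.OObs k t × M.X (t + 1) × M.Y (t + 1) k =>
      φ (i, (p.2.2.2, mkOth p.2.1 (G p.2.1), p.1, p.2.2.1)) := by
    have := hmk.comp (by fun_prop : Measurable fun p : M.X t × M.OObs k t × M.X (t + 1) ×
      M.Y (t + 1) k => p.2.1)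
    exact hφ.comp (measurable_const.prodMk (Measurable.prodMk (by fun_prop)
      (this.prodMk (by fun_prop))))
  have hm : Measurable fun p : M.X t × M.OObs k t × M.X (t + 1) × M.Y (t + 1) k =>
      φ (i, (p.2.2.2, mkOth p.2.1 (G p.2.1), p.1, p.2.2.1)) * (M.Q (t + 1) k p.2.2.1 p.2.2.2 *
        M.S t p.1 (jointAct g i.1 (mkOth p.2.1 (G p.2.1)) u) p.2.2.1 * ζ (p.1, p.2.1)) :=
    hφi.mul (((hQ.comp (by fun_prop : Measurable fun p : M.X t × M.OObs k t × M.X (t + 1) ×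
      M.Y (t + 1) k => (p.2.2.1, p.2.2.2))).mul (hS.comp (by fun_prop : Measurable fun p :
      M.X t × M.OObs k t × M.X (t + 1) × M.Y (t + 1) k => (p.1, p.2.1, p.2.2.1)))).mul
      (hω.dens.comp (by fun_prop)))
  have h2 : ∀ x a, ζ (x, a) * ∫⁻ x', M.S t x (jointAct g i.1 (mkOth a (G a)) u) x' *
      ∫⁻ y, M.Q (t + 1) k x' y * φ (i, (y, mkOth a (G a), x, x')) ∂M.νY (t + 1) k ∂M.νX (t + 1) =
      ∫⁻ x', ∫⁻ y, φ (i, (y, mkOth a (G a), x, x')) * (M.Q (t + 1) k x' y *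
        M.S t x (jointAct g i.1 (mkOth a (G a)) u) x' * ζ (x, a))
        ∂M.νY (t + 1) k ∂M.νX (t + 1) := by
    intro x a
    have hmx : Measurable fun p : M.X (t + 1) × M.Y (t + 1) k =>
        M.Q (t + 1) k p.1 p.2 * φ (i, (p.2, mkOth a (G a), x, p.1)) :=
      hQ.mul (hφi.comp (by fun_prop : Measurable fun p : M.X (t + 1) × M.Y (t + 1) k =>
        (x, a, p.1, p.2)))
    have hmy : Measurable fun x' => M.S t x (jointAct g i.1 (mkOth a (G a)) u) x' *
        ∫⁻ y, M.Q (t + 1) k x' y * φ (i, (y, mkOth a (G a), x, x')) ∂M.νY (t + 1) k :=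
      (measurable_S_right _ _).mul hmx.lintegral_prod_right'
    rw [← lintegral_const_mul _ hmy]
    refine lintegral_congr fun x' => ?_
    have hmz : Measurable fun y => M.Q (t + 1) k x' y * φ (i, (y, mkOth a (G a), x, x')) :=
      hmx.comp measurable_prodMk_left
    rw [← lintegral_const_mul _ hmz, ← lintegral_const_mul _ (hmz.const_mul _)]
    refine lintegral_congr fun y => ?_
    ring
  refine (lintegral_congr fun x => lintegral_congr fun a => h2 x a).trans ?_
  rw [lintegral_reverse_four (M.νX t) (M.νO k t) (M.νX (t + 1)) (M.νY (t + 1) k) hm]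
  refine lintegral_congr fun y => ?_
  exact lintegral_reverse_three (M.νX (t + 1)) (M.νO k t) (M.νX t)
    (f := fun p => φ (i, (y, mkOth p.2.1 (G p.2.1), p.2.2, p.1)) * (M.Q (t + 1) k p.1 y *
        M.S t p.2.2 (jointAct g i.1 (mkOth p.2.1 (G p.2.1)) u) p.1 * ζ (p.2.2, p.2.1)))
    (hm.comp (by fun_prop : Measurable fun p : M.X (t + 1) × M.OObs k t × M.X t =>
      (p.2.2, p.2.1, p.1, y)))

end Model

end DelayedSharing

namespace DelayedSharing

namespace Model

open scoped NNReal

variable {K : ℕ} {M : Model K} {k : Fin K} {t : ℕ} (g : M.Profile) (gk : M.Strat k)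

/-! ### The value functions along the filter -/

/-- The value function along the filter. -/
noncomputable def curVal (v : RVal M k) (t : ℕ) (i : M.Com t × M.Priv t k) : ℝ≥0∞ :=
  v t (filt g gk t i).1 (filt g gk t i).2 i

/-- The expression under the infimum along the filter. -/
noncomputable def stepVal (v : RVal M k) (t : ℕ) (i : M.Com t × M.Priv t k) (u : M.U t k) : ℝ≥0∞ :=
  redStep g v (filt g gk t i).1 (filt g gk t i).2 i u

/-- The random shifted cost over `{t, …, T}`. -/
noncomputable def posCost (g : M.Profile) (t : ℕ) (ω : M.Ω) : ℝ≥0∞ :=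
  (∑ s ∈ Finset.Ico t M.T, posC s (state g s ω) (act g s ω)) + posT (state g M.T ω)

theorem posCost_T (ω : M.Ω) : posCost g M.T ω = posT (state g M.T ω) := by simp [posCost]

theorem posCost_of_lt (ht : t < M.T) (ω : M.Ω) :
    posCost g t ω = posC t (state g t ω) (act g t ω) + posCost g (t + 1) ω := by
  rw [posCost, posCost, Finset.sum_eq_sum_Ico_succ_bot ht, add_assoc]

theorem measurable_posC_run (s : ℕ) : Measurable fun ω => posC s (state g s ω) (act g s ω) :=
  (measurable_posC s).comp ((measurable_state g s).prodMk (measurable_act g s))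

theorem measurable_posCost (t : ℕ) : Measurable (posCost g t) :=
  (Finset.measurable_fun_sum _ fun s _ => measurable_posC_run g s).add
    (measurable_posT.comp (measurable_state g M.T))

theorem costFrom_of_lt (ht : t < M.T) (ω : M.Ω) :
    costFrom g t ω = M.c t (state g t ω) (act g t ω) + costFrom g (t + 1) ω := by
  rw [costFrom, costFrom, Finset.sum_eq_sum_Ico_succ_bot ht, add_assoc]

theorem costFrom_eq_shift (ht : t ≤ M.T) (ω : M.Ω) :
    costFrom g t ω = shift (slack M t) (posCost g t ω) := by
  induction ht using Nat.decreasingInduction with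
  | self => rw [posCost_T, slack_T, shift_posT, costFrom]; simp
  | of_succ s hs ih =>
    rw [costFrom_of_lt g hs, posCost_of_lt g hs, slack_of_lt hs, ← shift_add_shift, shift_posC, ih]

theorem cost_eq_shift : cost g = shift (slack M 0) (∫⁻ ω, posCost g 0 ω ∂M.P) := by
  rw [cost, ← expect_shift_of_isProbabilityMeasure _ _ (measurable_posCost g 0).aemeasurable]
  exact congrArg _ (funext fun ω => costFrom_eq_shift g (Nat.zero_le _) ω)

theorem setLIntegral_eq_indicator_mul {S : Set M.Ω} (hS : MeasurableSet S) (f : M.Ω → ℝ≥0∞) :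
    ∫⁻ ω in S, f ω ∂M.P = ∫⁻ ω, S.indicator 1 ω * f ω ∂M.P := by
  rw [← lintegral_indicator hS]
  refine lintegral_congr fun ω => ?_
  by_cases h : ω ∈ S <;> simp [h]

theorem setLIntegral_posC {A : Set (M.Com t × M.Priv t k)} (hA : MeasurableSet A) :
    ∫⁻ ω in info (Function.update g k gk) k t ⁻¹' A, posC t (state (Function.update g k gk) t ω)
      (act (Function.update g k gk) t ω) ∂M.P =
    ∫⁻ ω in info (Function.update g k gk) k t ⁻¹' A,
      runCost g (filt g gk t (info (Function.update g k gk) k t ω)).1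
        (filt g gk t (info (Function.update g k gk) k t ω)).2 (info (Function.update g k gk) k t ω)
        (gk.1 t (info (Function.update g k gk) k t ω)) ∂M.P := by
  have hF := mFam_filt g gk t
  have hi := measurable_info (Function.update g k gk) k t
  have hJ : Measurable fun q : (M.Com t × M.Priv t k) × (M.X t × M.OObs k t) =>
      jointAct g q.1.1 (mkOth q.2.2 ((filt g gk t q.1).2 q.2.2)) (gk.1 t q.1) :=
    (hF.jointAct g (gk.2 t)).comp (by fun_prop :
      Measurable fun q : (M.Com t × M.Priv t k) × (M.X t × M.OObs k t) => (q.1, q.2.2))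
  have hφ : Measurable fun q : (M.Com t × M.Priv t k) × (M.X t × M.OObs k t) =>
      A.indicator (1 : M.Com t × M.Priv t k → ℝ≥0∞) q.1 * posC t q.2.1
        (jointAct g q.1.1 (mkOth q.2.2 ((filt g gk t q.1).2 q.2.2)) (gk.1 t q.1)) :=
    ((measurable_one.indicator hA).comp measurable_fst).mul
      ((measurable_posC t).comp ((measurable_fst.comp measurable_snd).prodMk hJ))
  have h1 := lintegral_filt g gk t hφ
  simp only [← oth_eq_mkOth] at h1
  rw [setLIntegral_eq_indicator_mul (hi hA), setLIntegral_eq_indicator_mul (hi hA)]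
  simp only [act_update]
  refine h1.trans (lintegral_congr fun ω => ?_)
  rw [runCost]
  by_cases h : info (Function.update g k gk) k t ω ∈ A
  · simp only [Set.indicator_of_mem h, Set.indicator_of_mem (show ω ∈
      info (Function.update g k gk) k t ⁻¹' A from h), Pi.one_apply, one_mul]
    exact lintegral_congr fun x => lintegral_congr fun a => mul_comm _ _
  · simp [Set.indicator_of_notMem h, Set.indicator_of_notMem (show ω ∉
      info (Function.update g k gk) k t ⁻¹' A from h)]

section Value

variable {v : RVal M k}

theorem curVal_succ (ω : M.Ω) :
    curVal g gk v (t + 1) (info (Function.update g k gk) k (t + 1) ω) =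
      nextVal g v (filt g gk t (info (Function.update g k gk) k t ω)).1
        (filt g gk t (info (Function.update g k gk) k t ω)).2 (info (Function.update g k gk) k t ω)
        (gk.1 t (info (Function.update g k gk) k t ω))
        (obs (Function.update g k gk) k (t + 1) ω, othObs (oth (Function.update g k gk) k t ω)) := by
  rw [curVal, info_succ, filt_nextInfo, nextVal, ← oth_eq_mkOth]

/-- This law is absolutely continuous with respect to a product measure. Hence functions that are
only universally measurable can be integrated by Tonelli's theorem. -/
theorem map_obs_eq (t : ℕ) : M.P.map (fun ω => (info (Function.update g k gk) k t ω,
      (obs (Function.update g k gk) k (t + 1) ω, othObs (oth (Function.update g k gk) k t ω)))) =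
    ((M.P.map (info (Function.update g k gk) k t)).prod
      ((M.νY (t + 1) k).prod (M.νO k t))).withDensity fun q =>
        obsDens g q.1.1 (filt g gk t q.1).1 (filt g gk t q.1).2 (gk.1 t q.1) q.2 := by
  have hi := measurable_info (Function.update g k gk) k t
  have hD := (mFam_filt g gk t).obsDens g (gk.2 t)
  refine Measure.ext_of_lintegral _ fun φ hφ => ?_
  have hmap : Measurable fun ω => (info (Function.update g k gk) k t ω,
      (obs (Function.update g k gk) k (t + 1) ω, othObs (oth (Function.update g k gk) k t ω))) :=
    hi.prodMk ((measurable_obs _ k (t + 1)).prodMk (measurable_othObs.comp (measurable_oth _ k t)))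
  have hm : Measurable fun q : (M.Com t × M.Priv t k) × (M.Y (t + 1) k × M.OObs k t) =>
      obsDens g q.1.1 (filt g gk t q.1).1 (filt g gk t q.1).2 (gk.1 t q.1) q.2 * φ q := hD.mul hφ
  rw [lintegral_map hφ hmap, lintegral_filt_obs g gk t hφ,
    lintegral_withDensity_eq_lintegral_mul _ hD hφ, lintegral_prod _ (hD.mul hφ).aemeasurable,
    lintegral_map (hD.mul hφ).lintegral_prod_right' hi]
  refine lintegral_congr fun ω => ?_
  exact (lintegral_prod (fun p => obsDens g (info (Function.update g k gk) k t ω).1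
    (filt g gk t (info (Function.update g k gk) k t ω)).1
    (filt g gk t (info (Function.update g k gk) k t ω)).2
    (gk.1 t (info (Function.update g k gk) k t ω)) p *
      φ (info (Function.update g k gk) k t ω, p)) (hm.comp measurable_prodMk_left).aemeasurable).symm

theorem lsa_curVal [∀ t, Nonempty (M.U t k)] (hv : IsRed g v) 
    (ht : t ≤ M.T) : LSA (curVal g gk v t) := lsa_value hv ht (mFam_filt g gk t)

theorem lsa_stepVal [∀ t, Nonempty (M.U t k)] (hv : IsRed g v) 
    (ht : t < M.T) :
    LSA fun p : (M.Com t × M.Priv t k) × M.U t k => stepVal g gk v t p.1 p.2 :=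
  lsa_redStep hv ht (mFam_filt g gk t)

theorem curVal_eq_iInf (hv : IsRed g v) (ht : t < M.T) (i : M.Com t × M.Priv t k) :
    curVal g gk v t i = ⨅ u, stepVal g gk v t i u := hv.2 t ht _ _ _

theorem aemeasurable_curVal [∀ t, Nonempty (M.U t k)] (hv : IsRed g v) 
    (ht : t ≤ M.T) :
    AEMeasurable (fun ω => curVal g gk v t (info (Function.update g k gk) k t ω)) M.P :=
  ((lsa_curVal g gk hv ht).aemeasurable _).comp_measurable (measurable_info _ k t)

/-- The next value is a function of the old information, the new own observation and the others'
private observations. Their joint law has density `obsDens` for each value of the information, which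
is almost everywhere finite. -/
theorem setLIntegral_curVal_succ [∀ t, Nonempty (M.U t k)] (hv : IsRed g v) 
    (ht : t < M.T) {A : Set (M.Com t × M.Priv t k)}
    (hA : MeasurableSet A) :
    ∫⁻ ω in info (Function.update g k gk) k t ⁻¹' A,
      curVal g gk v (t + 1) (info (Function.update g k gk) k (t + 1) ω) ∂M.P =
    ∫⁻ ω in info (Function.update g k gk) k t ⁻¹' A, ∫⁻ y, ∫⁻ a,
      ((obsDens g (info (Function.update g k gk) k t ω).1
        (filt g gk t (info (Function.update g k gk) k t ω)).1
        (filt g gk t (info (Function.update g k gk) k t ω)).2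
        (gk.1 t (info (Function.update g k gk) k t ω)) (y, a)).toNNReal : ℝ≥0∞) *
      nextVal g v (filt g gk t (info (Function.update g k gk) k t ω)).1
        (filt g gk t (info (Function.update g k gk) k t ω)).2 (info (Function.update g k gk) k t ω)
        (gk.1 t (info (Function.update g k gk) k t ω)) (y, a)
        ∂M.νO k t ∂M.νY (t + 1) k ∂M.P := by
  have hi := measurable_info (Function.update g k gk) k t
  have hD := (mFam_filt g gk t).obsDens g (gk.2 t)
  have hmap : Measurable fun ω => (info (Function.update g k gk) k t ω,
      (obs (Function.update g k gk) k (t + 1) ω, othObs (oth (Function.update g k gk) k t ω))) :=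
    hi.prodMk ((measurable_obs _ k (t + 1)).prodMk (measurable_othObs.comp (measurable_oth _ k t)))
  let f : (M.Com t × M.Priv t k) × (M.Y (t + 1) k × M.OObs k t) → ℝ≥0∞ := fun q =>
    A.indicator 1 q.1 * nextVal g v (filt g gk t q.1).1 (filt g gk t q.1).2 q.1 (gk.1 t q.1) q.2
  have hf : ∀ μ : Measure ((M.Com t × M.Priv t k) × (M.Y (t + 1) k × M.OObs k t)), SFinite μ →
      AEMeasurable f μ := fun μ _ =>
    ((measurable_one.indicator hA).comp measurable_fst).aemeasurable.mul
      ((lsa_value hv (t := t + 1) ht ((mFam_filt g gk t).next g (gk.2 t))).aemeasurable μ)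
  have hprod := hf ((M.P.map (info (Function.update g k gk) k t)).prod
    ((M.νY (t + 1) k).prod (M.νO k t))) inferInstance
  have hDf := hD.aemeasurable.mul hprod
  have h1 : ∫⁻ ω in info (Function.update g k gk) k t ⁻¹' A,
      curVal g gk v (t + 1) (info (Function.update g k gk) k (t + 1) ω) ∂M.P =
      ∫⁻ ω, f (info (Function.update g k gk) k t ω, (obs (Function.update g k gk) k (t + 1) ω,
        othObs (oth (Function.update g k gk) k t ω))) ∂M.P := by
    rw [setLIntegral_eq_indicator_mul (hi hA)]
    refine lintegral_congr fun ω => ?_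
    rw [curVal_succ]
    rfl
  rw [h1, ← lintegral_map' (hf _ inferInstance) hmap.aemeasurable, map_obs_eq,
    lintegral_withDensity_eq_lintegral_mul₀ hD.aemeasurable hprod, lintegral_prod _ hDf,
    lintegral_map' hDf.lintegral_prod_right' hi.aemeasurable,
    setLIntegral_eq_indicator_mul (hi hA)]
  refine lintegral_congr_ae ?_
  filter_upwards [ae_of_ae_map hi.aemeasurable (Measure.ae_ae_of_ae_prod hDf.ae_eq_mk)] with ω hω
  set i := info (Function.update g k gk) k t ω with hidef
  have hDi : Measurable fun p => obsDens g i.1 (filt g gk t i).1 (filt g gk t i).2 (gk.1 t i) p :=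
    measurable_obsDens g i _ (measurable_filt_dens g gk t i) (measurable_filt_rule g gk t i)
  have hfin : ∀ᵐ y ∂M.νY (t + 1) k, ∀ᵐ a ∂M.νO k t,
      obsDens g i.1 (filt g gk t i).1 (filt g gk t i).2 (gk.1 t i) (y, a) < ∞ := by
    refine Measure.ae_ae_of_ae_prod (ae_lt_top hDi ?_)
    rw [lintegral_prod _ hDi.aemeasurable, lintegral_obsDens g i _ (measurable_filt_dens g gk t i)
      (measurable_filt_rule g gk t i)]
    exact ne_top_of_le_ne_top ENNReal.one_ne_top (lintegral_filt_le g gk t i)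
  have hsec : AEMeasurable (fun p => obsDens g i.1 (filt g gk t i).1 (filt g gk t i).2
      (gk.1 t i) p * f (i, p)) ((M.νY (t + 1) k).prod (M.νO k t)) :=
    ⟨fun p => hDf.mk _ (i, p), hDf.measurable_mk.comp measurable_prodMk_left, hω⟩
  refine (lintegral_prod _ hsec).trans ?_
  by_cases h : i ∈ A
  · rw [Set.indicator_of_mem (show ω ∈ info (Function.update g k gk) k t ⁻¹' A from h),
      Pi.one_apply, one_mul]
    refine lintegral_congr_ae ?_
    filter_upwards [hfin] with y hy
    refine lintegral_congr_ae ?_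
    filter_upwards [hy] with a ha
    simp only [f, Set.indicator_of_mem h, Pi.one_apply, one_mul]
    rw [ENNReal.coe_toNNReal ha.ne]
  · rw [Set.indicator_of_notMem (show ω ∉ info (Function.update g k gk) k t ⁻¹' A from h), zero_mul]
    simp [f, Set.indicator_of_notMem h]

/-- The expression under the infimum is a conditional expectation. -/
theorem setLIntegral_stepVal [∀ t, Nonempty (M.U t k)] (hv : IsRed g v) 
    (ht : t < M.T) {A : Set (M.Com t × M.Priv t k)}
    (hA : MeasurableSet A) :
    ∫⁻ ω in info (Function.update g k gk) k t ⁻¹' A,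
      (posC t (state (Function.update g k gk) t ω) (act (Function.update g k gk) t ω) +
        curVal g gk v (t + 1) (info (Function.update g k gk) k (t + 1) ω)) ∂M.P =
    ∫⁻ ω in info (Function.update g k gk) k t ⁻¹' A,
      stepVal g gk v t (info (Function.update g k gk) k t ω)
        (gk.1 t (info (Function.update g k gk) k t ω)) ∂M.P := by
  have hi := measurable_info (Function.update g k gk) k t
  have hr : Measurable fun i => runCost g (filt g gk t i).1 (filt g gk t i).2 i (gk.1 t i) :=
    ((mFam_filt g gk t).runCost g).comp (measurable_id.prodMk (gk.2 t))
  have hr' : Measurable fun ω => runCost g (filt g gk t (info (Function.update g k gk) k t ω)).1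
      (filt g gk t (info (Function.update g k gk) k t ω)).2 (info (Function.update g k gk) k t ω)
      (gk.1 t (info (Function.update g k gk) k t ω)) := hr.comp hi
  rw [lintegral_add_left (measurable_posC_run _ t), setLIntegral_posC g gk hA,
    setLIntegral_curVal_succ g gk hv ht hA, ← lintegral_add_left hr']
  rfl

theorem setLIntegral_curVal_T (hv : IsRed g v)
    {A : Set (M.Com M.T × M.Priv M.T k)} (hA : MeasurableSet A) :
    ∫⁻ ω in info (Function.update g k gk) k M.T ⁻¹' A,
      posT (state (Function.update g k gk) M.T ω) ∂M.P =
    ∫⁻ ω in info (Function.update g k gk) k M.T ⁻¹' A,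
      curVal g gk v M.T (info (Function.update g k gk) k M.T ω) ∂M.P := by
  have hi := measurable_info (Function.update g k gk) k M.T
  have hφ : Measurable fun q : (M.Com M.T × M.Priv M.T k) × (M.X M.T × M.OObs k M.T) =>
      A.indicator (1 : M.Com M.T × M.Priv M.T k → ℝ≥0∞) q.1 * posT q.2.1 :=
    ((measurable_one.indicator hA).comp measurable_fst).mul
      (measurable_posT.comp (measurable_fst.comp measurable_snd))
  rw [setLIntegral_eq_indicator_mul (hi hA), setLIntegral_eq_indicator_mul (hi hA)]
  refine (lintegral_filt g gk M.T hφ).trans (lintegral_congr fun ω => ?_)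
  rw [curVal, hv.1, termCost]
  by_cases h : info (Function.update g k gk) k M.T ω ∈ A
  · simp only [Set.indicator_of_mem h, Set.indicator_of_mem (show ω ∈
      info (Function.update g k gk) k M.T ⁻¹' A from h), Pi.one_apply, one_mul]
    exact lintegral_congr fun x => lintegral_congr fun a => mul_comm _ _
  · simp [Set.indicator_of_notMem h, Set.indicator_of_notMem (show ω ∉
      info (Function.update g k gk) k M.T ⁻¹' A from h)]

end Value

end Model

end DelayedSharing

namespace DelayedSharing

open scoped NNReal

/-! ### Almost sure inequalities and conditional expectations under the law of the information -/

section General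

variable {Ω β : Type*} [MeasurableSpace Ω] [MeasurableSpace β] {P : Measure Ω} {ι : Ω → β}

/-- The set where the inequality holds need not be measurable, so it is passed to the law of `ι`
through measurable versions. -/
theorem ae_map_le_of_ae_le {γ : Type*} [MeasurableSpace γ] [TopologicalSpace γ] [LinearOrder γ]
    [OrderClosedTopology γ] [SecondCountableTopology γ] [OpensMeasurableSpace γ]
    (hι : Measurable ι) {f f' : β → γ} (hf : AEMeasurable f (P.map ι))
    (hf' : AEMeasurable f' (P.map ι)) (h : ∀ᵐ ω ∂P, f (ι ω) ≤ f' (ι ω)) :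
    ∀ᵐ i ∂P.map ι, f i ≤ f' i := by
  have h1 : ∀ᵐ i ∂P.map ι, hf.mk f i ≤ hf'.mk f' i := by
    rw [ae_map_iff hι.aemeasurable (measurableSet_le hf.measurable_mk hf'.measurable_mk)]
    filter_upwards [h, ae_of_ae_map hι.aemeasurable hf.ae_eq_mk,
      ae_of_ae_map hι.aemeasurable hf'.ae_eq_mk] with ω h h1 h2
    rwa [← h1, ← h2]
  filter_upwards [h1, hf.ae_eq_mk, hf'.ae_eq_mk] with i h h1 h2
  rwa [h1, h2]

theorem ae_map_le_of_setLIntegral_le [IsFiniteMeasure P] (hι : Measurable ι) {f f' : β → ℝ≥0∞}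
    (hf : AEMeasurable f (P.map ι)) (hf' : AEMeasurable f' (P.map ι))
    (h : ∀ A, MeasurableSet A → ∫⁻ ω in ι ⁻¹' A, f (ι ω) ∂P ≤ ∫⁻ ω in ι ⁻¹' A, f' (ι ω) ∂P) :
    ∀ᵐ i ∂P.map ι, f i ≤ f' i := by
  refine ae_le_of_forall_setLIntegral_le_of_sigmaFinite₀ hf fun A hA _ => ?_
  rw [Measure.restrict_map hι hA, lintegral_map' (hf.mono_measure ?_) hι.aemeasurable,
    lintegral_map' (hf'.mono_measure ?_) hι.aemeasurable]
  · exact h A hA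
  all_goals
    rw [← Measure.restrict_map hι hA]
    exact Measure.restrict_le_self

theorem isCondExp_of_ae_map_shift [IsFiniteMeasure P] (hι : Measurable ι) {C : ℝ≥0}
    {Z : Ω → EReal} {j : β → EReal} {Z' : Ω → ℝ≥0∞} {j' : β → ℝ≥0∞}
    (hZ' : AEMeasurable Z' P) (hj' : AEMeasurable j' (P.map ι))
    (hZ : Z =ᵐ[P] fun ω => shift C (Z' ω)) (hj : ∀ᵐ i ∂P.map ι, j i = shift C (j' i))
    (h : ∀ A, MeasurableSet A → ∫⁻ ω in ι ⁻¹' A, Z' ω ∂P = ∫⁻ ω in ι ⁻¹' A, j' (ι ω) ∂P) :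
    IsCondExp P ι Z j :=
  isCondExp_of_shift hι hZ' hj' hZ (ae_of_ae_map hι.aemeasurable hj)
    (((measurable_shift C).comp_aemeasurable hj').congr (Filter.EventuallyEq.symm hj)) h

theorem iInf_add_mul_inv_natCast_add_one (x : ℝ≥0∞) (m : ℕ) :
    ⨅ n : ℕ, (x + m * ((n : ℝ≥0∞) + 1)⁻¹) = x := by
  refine le_antisymm ?_ (le_iInf fun n => le_self_add)
  have h : Filter.Tendsto (fun n : ℕ => ((n : ℝ≥0∞) + 1)⁻¹) Filter.atTop (nhds 0) := by
    simpa [Function.comp_def] using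
      ENNReal.tendsto_inv_nat_nhds_zero.comp (Filter.tendsto_add_atTop_nat 1)
  have h1 := (ENNReal.Tendsto.const_mul h (Or.inr (ENNReal.natCast_ne_top m))).const_add x
  rw [mul_zero, add_zero] at h1
  exact ge_of_tendsto' h1 fun n => iInf_le _ n

end General

namespace Model

open scoped NNReal

variable {K : ℕ} {M : Model K} {k : Fin K} {t : ℕ} (g : M.Profile)

/-! ### Strategies with common past -/

section Congr

variable {gk gk' : M.Strat k}

theorem info_congr (h : ∀ s < t, gk.1 s = gk'.1 s) :
    info (Function.update g k gk) k t = info (Function.update g k gk') k t := by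
  funext ω
  rw [info, info, run_congr g h ω]

theorem filt_congr (h : ∀ s < t, gk.1 s = gk'.1 s) : filt g gk t = filt g gk' t := by
  induction t with
  | zero => rfl
  | succ t ih =>
    funext i
    rw [filt, filt, ih fun s hs => h s (by omega), h t (by omega)]

theorem curVal_congr (v : RVal M k) (h : ∀ s < t, gk.1 s = gk'.1 s) :
    curVal g gk v t = curVal g gk' v t := by
  funext i
  rw [curVal, curVal, filt_congr g h]

theorem stepVal_congr (v : RVal M k) (h : ∀ s < t, gk.1 s = gk'.1 s) :
    stepVal g gk v t = stepVal g gk' v t := by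
  funext i u
  rw [stepVal, stepVal, filt_congr g h]

end Congr

/-- Perfect recall makes every event of time `t` an event of time `t + 1`. This is what replaces the
tower property in the inductions. -/
theorem preimage_info_succ (gk : M.Strat k) (t : ℕ) (A : Set (M.Com t × M.Priv t k)) :
    info (Function.update g k gk) k t ⁻¹' A =
      info (Function.update g k gk) k (t + 1) ⁻¹' (prevInfo ⁻¹' A) := by
  ext ω
  simp only [Set.mem_preimage, info_succ, prevInfo_nextInfo]

theorem exists_strat_update (gk : M.Strat k) (t : ℕ) {u : M.Com t × M.Priv t k → M.U t k}
    (hu : Measurable u) : ∃ gk' : M.Strat k, (∀ s < t, gk'.1 s = gk.1 s) ∧ gk'.1 t = u := by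
  refine ⟨⟨Function.update gk.1 t u, fun s => ?_⟩, fun s hs => ?_, ?_⟩
  · by_cases h : s = t
    · subst h
      simpa using hu
    · simpa [Function.update_of_ne h] using gk.2 s
  · exact Function.update_of_ne hs.ne _ _
  · exact Function.update_self _ _ _

/-- Strategies may be constructed forward in time. -/
theorem exists_strat_forall {p : ℕ → M.Strat k → Prop}
    (hp : ∀ s (gk gk' : M.Strat k), (∀ r ≤ s, gk.1 r = gk'.1 r) → p s gk → p s gk')
    (hp' : ∀ s (gk : M.Strat k), ∃ gk' : M.Strat k, (∀ r < s, gk'.1 r = gk.1 r) ∧ p s gk')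
    (gk : M.Strat k) (t m : ℕ) :
    ∃ gk' : M.Strat k, (∀ s < t, gk'.1 s = gk.1 s) ∧ ∀ s, t ≤ s → s < t + m → p s gk' := by
  induction m with
  | zero => exact ⟨gk, fun _ _ => rfl, fun s h h' => by omega⟩
  | succ m ih =>
    obtain ⟨g1, h1, h2⟩ := ih
    obtain ⟨g2, h3, h4⟩ := hp' (t + m) g1
    refine ⟨g2, fun s hs => (h3 s (by omega)).trans (h1 s hs), fun s hs hs' => ?_⟩
    rcases Nat.lt_or_ge s (t + m) with h | h
    · exact hp s g1 g2 (fun r hr => (h3 r (by omega)).symm) (h2 s hs h)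
    · obtain rfl : s = t + m := by omega
      exact h4

/-! ### Bounds for the conditional costs and construction of strategies -/

section Value

variable {v : RVal M k}

/-- Backward induction: the value is at most the step expression at the action taken, which
integrates to the running cost plus the next value over each event of the information. -/
theorem setLIntegral_curVal_le_posCost [∀ t, Nonempty (M.U t k)] (hv : IsRed g v)
    (gk : M.Strat k) (ht : t ≤ M.T) : ∀ {A : Set (M.Com t × M.Priv t k)}, MeasurableSet A →
    ∫⁻ ω in info (Function.update g k gk) k t ⁻¹' A,
      curVal g gk v t (info (Function.update g k gk) k t ω) ∂M.P ≤
    ∫⁻ ω in info (Function.update g k gk) k t ⁻¹' A,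
      posCost (Function.update g k gk) t ω ∂M.P := by
  induction ht using Nat.decreasingInduction with
  | self =>
    intro A hA
    rw [← setLIntegral_curVal_T g gk hv hA]
    simp only [posCost_T, le_refl]
  | of_succ s hs ih =>
    intro A hA
    calc _ ≤ ∫⁻ ω in info (Function.update g k gk) k s ⁻¹' A,
          stepVal g gk v s (info (Function.update g k gk) k s ω)
            (gk.1 s (info (Function.update g k gk) k s ω)) ∂M.P :=
          lintegral_mono fun ω => by
            rw [curVal_eq_iInf g gk hv hs]
            exact iInf_le _ _
      _ ≤ _ := by
          simp only [posCost_of_lt _ hs]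
          rw [← setLIntegral_stepVal g gk hv hs hA, lintegral_add_left (measurable_posC_run _ s),
            lintegral_add_left (measurable_posC_run _ s), preimage_info_succ g gk s]
          exact add_le_add le_rfl (ih (measurable_prevInfo hA))

/-- The same induction in the other direction; each of the `T - t` steps adds an error of at most
`ε`. -/
theorem setLIntegral_posCost_le_curVal [∀ t, Nonempty (M.U t k)] (hv : IsRed g v)
    (gk : M.Strat k) {ε : ℝ≥0∞} (ht : t ≤ M.T) :
    (∀ s, t ≤ s → s < M.T → ∀ᵐ ω ∂M.P,
      stepVal g gk v s (info (Function.update g k gk) k s ω)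
        (gk.1 s (info (Function.update g k gk) k s ω)) ≤
      curVal g gk v s (info (Function.update g k gk) k s ω) + ε) →
    ∀ {A : Set (M.Com t × M.Priv t k)}, MeasurableSet A →
    ∫⁻ ω in info (Function.update g k gk) k t ⁻¹' A,
      posCost (Function.update g k gk) t ω ∂M.P ≤
    ∫⁻ ω in info (Function.update g k gk) k t ⁻¹' A,
      (curVal g gk v t (info (Function.update g k gk) k t ω) + ((M.T - t : ℕ) : ℝ≥0∞) * ε) ∂M.P := by
  induction ht using Nat.decreasingInduction with
  | self =>
    intro _ A hA
    simp only [posCost_T, Nat.sub_self, Nat.cast_zero, zero_mul, add_zero]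
    rw [setLIntegral_curVal_T g gk hv hA]
  | of_succ s hs ih =>
    intro h A hA
    have ih := ih (fun r hr => h r (by omega)) (measurable_prevInfo hA)
    rw [← preimage_info_succ g gk s, lintegral_add_right _ measurable_const] at ih
    have hm : M.T - s = M.T - (s + 1) + 1 := by omega
    simp only [posCost_of_lt _ hs]
    rw [lintegral_add_left (measurable_posC_run _ s)]
    refine (add_le_add le_rfl ih).trans ?_
    rw [← add_assoc, ← lintegral_add_left (measurable_posC_run _ s),
      setLIntegral_stepVal g gk hv hs hA, ← lintegral_add_right _ measurable_const]
    refine lintegral_mono_ae (ae_restrict_of_ae ?_)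
    filter_upwards [h s le_rfl hs] with ω hω
    refine (add_le_add hω le_rfl).trans (le_of_eq ?_)
    rw [hm, Nat.cast_add, Nat.cast_one, add_mul, one_mul]
    ring

theorem isCondExp_costFrom_shift (ht : t ≤ M.T) {J : M.Com t × M.Priv t k → ℝ≥0∞}
    (hJ : Measurable J) (h : ∀ A, MeasurableSet A → ∫⁻ ω in info g k t ⁻¹' A, posCost g t ω ∂M.P =
      ∫⁻ ω in info g k t ⁻¹' A, J (info g k t ω) ∂M.P) :
    IsCondCost g k t fun i => shift (slack M t) (J i) :=
  isCondExp_of_ae_map_shift (measurable_info g k t) (measurable_posCost g t).aemeasurable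
    hJ.aemeasurable (Filter.Eventually.of_forall (costFrom_eq_shift g ht))
    (Filter.Eventually.of_forall fun _ => rfl) h

/-- The value function along the filter is a lower bound of the conditional costs. -/
theorem ae_curVal_le [∀ t, Nonempty (M.U t k)] (hv : IsRed g v) (gk : M.Strat k) (ht : t ≤ M.T)
    {J : M.Com t × M.Priv t k → EReal} (hJ : IsCondCost (Function.update g k gk) k t J) :
    ∀ᵐ i ∂M.P.map (info (Function.update g k gk) k t),
      shift (slack M t) (curVal g gk v t i) ≤ J i := by
  have hi := measurable_info (Function.update g k gk) k t
  have := Measure.isProbabilityMeasure_map (μ := M.P) hi.aemeasurable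
  have hc := (lsa_curVal g gk hv ht).aemeasurable (M.P.map (info (Function.update g k gk) k t))
  obtain ⟨J', hJ', hJJ, h⟩ := hJ.exists_shift hi (measurable_posCost _ t).aemeasurable
    (Filter.Eventually.of_forall (costFrom_eq_shift _ ht))
  have hle := ae_map_le_of_setLIntegral_le hi hc hJ'.aemeasurable fun A hA =>
    (setLIntegral_curVal_le_posCost g hv gk ht hA).trans (h A hA).le
  refine ae_map_le_of_ae_le hi ((measurable_shift _).comp_aemeasurable hc) hJ.1 ?_
  filter_upwards [hJJ, ae_of_ae_map hi.aemeasurable hle] with ω h1 h2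
  rw [h1]
  exact shift_le_shift.mpr h2

/-- A selector is good only almost surely for the law of the information at its time, and this law
depends on the earlier actions. The strategy is therefore built forward, each choice leaving the
earlier conditions intact. -/
theorem exists_strat_le_add [∀ t, Nonempty (M.U t k)] (hv : IsRed g v) {ε : ℝ≥0∞} (hε : 0 < ε)
    (gk : M.Strat k) (t : ℕ) : ∃ gk' : M.Strat k, (∀ s < t, gk'.1 s = gk.1 s) ∧
      ∀ s, t ≤ s → s < M.T → ∀ᵐ i ∂M.P.map (info (Function.update g k gk') k s),
        stepVal g gk' v s i (gk'.1 s i) ≤ curVal g gk' v s i + ε := by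
  obtain ⟨gk', h1, h2⟩ := exists_strat_forall (M := M) (k := k)
    (p := fun s gk => s < M.T → ∀ᵐ i ∂M.P.map (info (Function.update g k gk) k s),
      stepVal g gk v s i (gk.1 s i) ≤ curVal g gk v s i + ε)
    (fun s g1 g2 h h' hs => by
      have hlt : ∀ r < s, g1.1 r = g2.1 r := fun r hr => h r hr.le
      have := h' hs
      rwa [info_congr g hlt, stepVal_congr g v hlt, curVal_congr g v hlt, h s le_rfl] at this)
    (fun s gk => by
      by_cases hs : s < M.T
      · obtain ⟨u, hu, hu'⟩ := (lsa_stepVal g gk hv hs).exists_measurable_le_iInf_add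
          (M.P.map (info (Function.update g k gk) k s)) hε
        obtain ⟨gk', h1, h2⟩ := exists_strat_update gk s hu
        refine ⟨gk', h1, fun _ => ?_⟩
        rw [info_congr g h1, stepVal_congr g v h1, h2]
        filter_upwards [hu'] with i hi
        rwa [curVal_congr g v h1, curVal_eq_iInf g gk hv hs]
      · exact ⟨gk, fun _ _ => rfl, fun h => absurd h hs⟩) gk t (M.T - t)
  exact ⟨gk', h1, fun s hs hs' => h2 s hs (by omega) hs'⟩

/-- The forward construction with exact minimizers. Attainment is a premise at each value of the
information, since it is only known almost surely and under the strategy that results. -/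
theorem exists_strat_minimizer [∀ t, Nonempty (M.U t k)] (hv : IsRed g v) (gk : M.Strat k) :
    ∃ gk' : M.Strat k, ∀ s < M.T, ∀ᵐ i ∂M.P.map (info (Function.update g k gk') k s),
      (∃ u, ∀ u', stepVal g gk' v s i u ≤ stepVal g gk' v s i u') →
        ∀ u', stepVal g gk' v s i (gk'.1 s i) ≤ stepVal g gk' v s i u' := by
  obtain ⟨gk', -, h2⟩ := exists_strat_forall (M := M) (k := k)
    (p := fun s gk => s < M.T → ∀ᵐ i ∂M.P.map (info (Function.update g k gk) k s),
      (∃ u, ∀ u', stepVal g gk v s i u ≤ stepVal g gk v s i u') →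
        ∀ u', stepVal g gk v s i (gk.1 s i) ≤ stepVal g gk v s i u')
    (fun s g1 g2 h h' hs => by
      have hlt : ∀ r < s, g1.1 r = g2.1 r := fun r hr => h r hr.le
      have := h' hs
      rwa [info_congr g hlt, stepVal_congr g v hlt, h s le_rfl] at this)
    (fun s gk => by
      by_cases hs : s < M.T
      · obtain ⟨u, hu, hu'⟩ := (lsa_stepVal g gk hv hs).exists_measurable_minimizer
          (M.P.map (info (Function.update g k gk) k s))
        obtain ⟨gk', h1, h2⟩ := exists_strat_update gk s hu
        refine ⟨gk', h1, fun _ => ?_⟩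
        rw [info_congr g h1, stepVal_congr g v h1, h2]
        exact hu'
      · exact ⟨gk, fun _ _ => rfl, fun h => absurd h hs⟩) gk 0 M.T
  exact ⟨gk', fun s hs => h2 s (Nat.zero_le _) (by omega) hs⟩

/-- A strategy that attains the infima is optimal. -/
theorem cost_le_of_ae_minimizer [∀ t, Nonempty (M.U t k)] (hv : IsRed g v) (gk : M.Strat k)
    (h : ∀ s < M.T, ∀ᵐ ω ∂M.P, ∀ u', stepVal g gk v s (info (Function.update g k gk) k s ω)
        (gk.1 s (info (Function.update g k gk) k s ω)) ≤
      stepVal g gk v s (info (Function.update g k gk) k s ω) u') :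
    cost (Function.update g k gk) ≤ cost g := by
  have h1 := setLIntegral_posCost_le_curVal g hv gk (ε := 0) (Nat.zero_le M.T) (fun s _ hs => by
    filter_upwards [h s hs] with ω hω
    rw [add_zero, curVal_eq_iInf g gk hv hs]
    exact le_iInf hω) MeasurableSet.univ
  have h2 := setLIntegral_curVal_le_posCost g hv (g k) (Nat.zero_le M.T) MeasurableSet.univ
  have h0 : ∀ s < 0, gk.1 s = (g k).1 s := fun s hs => absurd hs (Nat.not_lt_zero s)
  simp only [mul_zero, add_zero, Set.preimage_univ, Measure.restrict_univ] at h1 h2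
  rw [info_congr g h0, curVal_congr g v h0] at h1
  rw [cost_eq_shift, cost_eq_shift, shift_le_shift]
  refine h1.trans (h2.trans (le_of_eq ?_))
  rw [Function.update_eq_self]

variable {gk : M.Strat k} {V : ∀ t, M.Bel k t → M.Com t × M.Priv t k → EReal}
  {ξ : M.Com t × M.Priv t k → M.Bel k t}

theorem ae_value_eq [∀ t, Nonempty (M.U t k)] (hv : IsRed g v) (hV : IsDPSolution g k V)
    (hξ : IsPosterior (Function.update g k gk) k t ξ) (ht : t ≤ M.T) :
    ∀ᵐ i ∂M.P.map (info (Function.update g k gk) k t),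
      V t (ξ i) i = shift (slack M t) (curVal g gk v t i) := by
  filter_upwards [ae_good g gk hξ] with i hi
  exact hi.value_eq_of_le hv hV ht i

theorem ae_dpStep_eq [∀ t, Nonempty (M.U t k)] (hv : IsRed g v) (hV : IsDPSolution g k V)
    (hξ : IsPosterior (Function.update g k gk) k t ξ) (ht : t < M.T) :
    ∀ᵐ i ∂M.P.map (info (Function.update g k gk) k t), ∀ u,
      dpStep g (V (t + 1)) (ξ i) i u = shift (slack M t) (stepVal g gk v t i u) := by
  filter_upwards [ae_good g gk hξ] with i hi u
  exact hi.step_eq hv hV ht i u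

theorem ae_isMinimizer_iff [∀ t, Nonempty (M.U t k)] (hv : IsRed g v) (hV : IsDPSolution g k V)
    (hξ : IsPosterior (Function.update g k gk) k t ξ) (ht : t < M.T) :
    ∀ᵐ i ∂M.P.map (info (Function.update g k gk) k t), ∀ u,
      IsMinimizer g k V t (ξ i) i u ↔ ∀ u', stepVal g gk v t i u ≤ stepVal g gk v t i u' := by
  filter_upwards [ae_good g gk hξ] with i hi u
  exact hi.isMinimizer_iff hv hV ht i u

theorem isCondExp_dpTerm [∀ t, Nonempty (M.U t k)] (hV : IsDPSolution g k V)
    {ξ : M.Com M.T × M.Priv M.T k → M.Bel k M.T}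
    (hξ : IsPosterior (Function.update g k gk) k M.T ξ) :
    IsCondExp M.P (info (Function.update g k gk) k M.T)
      (fun ω => M.cT (state (Function.update g k gk) M.T ω)) (fun i => dpTerm (ξ i)) := by
  obtain ⟨v, hv⟩ := exists_isRed (k := k) g
  have hi := measurable_info (Function.update g k gk) k M.T
  refine isCondExp_of_ae_map_shift hi
    (measurable_posT.comp (measurable_state _ M.T)).aemeasurable
    ((lsa_curVal g gk hv le_rfl).aemeasurable _)
    (Filter.Eventually.of_forall fun ω => (shift_posT _).symm) ?_
    fun A hA => setLIntegral_curVal_T g gk hv hA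
  filter_upwards [ae_good g gk hξ] with i hi
  rw [← hV.1 _ i hi.pdf, hi.value_eq_of_le hv hV le_rfl i, slack_T]
  rfl

theorem isCondExp_dpStep [∀ t, Nonempty (M.U t k)] (hV : IsDPSolution g k V)
    {ξ' : M.Com (t + 1) × M.Priv (t + 1) k → M.Bel k (t + 1)}
    (hξ : IsPosterior (Function.update g k gk) k t ξ)
    (hξ' : IsPosterior (Function.update g k gk) k (t + 1) ξ') (ht : t < M.T) :
    IsCondExp M.P (info (Function.update g k gk) k t)
      (fun ω => M.c t (state (Function.update g k gk) t ω) (act (Function.update g k gk) t ω) +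
        V (t + 1) (ξ' (info (Function.update g k gk) k (t + 1) ω))
          (info (Function.update g k gk) k (t + 1) ω))
      (fun i => dpStep g (V (t + 1)) (ξ i) i (gk.1 t i)) := by
  obtain ⟨v, hv⟩ := exists_isRed (k := k) g
  have hi := measurable_info (Function.update g k gk) k t
  refine isCondExp_of_ae_map_shift hi (C := slack M t)
    ((measurable_posC_run _ t).aemeasurable.add (aemeasurable_curVal g gk hv ht))
    (((lsa_stepVal g gk hv ht).comp (measurable_id.prodMk (gk.2 t))).aemeasurable _) ?_ ?_
    fun A hA => setLIntegral_stepVal g gk hv ht hA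
  · filter_upwards [ae_of_ae_map (measurable_info _ k (t + 1)).aemeasurable
      (ae_value_eq g hv hV hξ' ht)] with ω hω
    rw [hω, slack_of_lt ht, Pi.add_apply, ← shift_add_shift, shift_posC]
  · filter_upwards [ae_dpStep_eq g hv hV hξ ht] with i hi
    exact hi _

/-- The value is a lower bound by `ae_curVal_le`, and the greatest one because almost minimizing
continuations of `gk` come arbitrarily close. They share the past of `gk`, hence the law of the
information and the filter at time `t`. -/
theorem isCostToGo_value [∀ t, Nonempty (M.U t k)] (hV : IsDPSolution g k V)
    (hξ : IsPosterior (Function.update g k gk) k t ξ) (ht : t ≤ M.T) :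
    IsCostToGo (Function.update g k gk) k t fun i => V t (ξ i) i := by
  obtain ⟨v, hv⟩ := exists_isRed (k := k) g
  have hVv := ae_value_eq g hv hV hξ ht
  have hi := measurable_info (Function.update g k gk) k t
  have := Measure.isProbabilityMeasure_map (μ := M.P) hi.aemeasurable
  have hc := (lsa_curVal g gk hv ht).aemeasurable (M.P.map (info (Function.update g k gk) k t))
  refine ⟨⟨((measurable_shift _).comp_aemeasurable hc).congr
    (Filter.EventuallyEq.symm hVv), fun g2 h2 J hJ => ?_⟩,
    fun v' hv' => ?_⟩
  · rw [Function.update_self] at h2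
    rw [Function.update_idem] at hJ
    have := ae_curVal_le g hv g2 ht hJ
    rw [info_congr g h2, curVal_congr g v h2] at this
    filter_upwards [hVv, this] with i h3 h4
    exact h3.trans_le h4
  -- With tolerance `1/(n+1)` at each step, the continuation costs at most the value plus `(T -
  -- t)/(n+1)`. Countably many `n` suffice to let the error tend to zero outside one null set.
  · have hn : ∀ n : ℕ, ∀ᵐ i ∂M.P.map (info (Function.update g k gk) k t), v' i ≤
        shift (slack M t) (curVal g gk v t i + ((M.T - t : ℕ) : ℝ≥0∞) * ((n : ℝ≥0∞) + 1)⁻¹) := by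
      intro n
      obtain ⟨g2, h2, h2'⟩ := exists_strat_le_add g hv (ε := ((n : ℝ≥0∞) + 1)⁻¹)
        (ENNReal.inv_pos.mpr (by simp)) gk t
      obtain ⟨J, hJ, hJ'⟩ := exists_setLIntegral_comp_eq (P := M.P)
        (measurable_info (Function.update g k g2) k t)
        (measurable_posCost (Function.update g k g2) t)
      have h3 := hv'.2 g2 (by rwa [Function.update_self]) (fun i => shift (slack M t) (J i)) (by
        rw [Function.update_idem]
        exact isCondExp_costFrom_shift _ ht hJ hJ')
      have h4 : ∀ A, MeasurableSet A → _ := fun A hA => (hJ' A hA).symm.trans_le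
        (setLIntegral_posCost_le_curVal g hv g2 ht (fun s hs hs' =>
          ae_of_ae_map (measurable_info _ k s).aemeasurable (h2' s hs hs')) hA)
      rw [info_congr g h2, curVal_congr g v h2] at h4
      have h5 := ae_map_le_of_setLIntegral_le hi hJ.aemeasurable (hc.add_const _) h4
      filter_upwards [h3, h5] with i h3 h5
      exact h3.trans (shift_le_shift.mpr h5)
    filter_upwards [hVv, ae_all_iff.mpr hn] with i h3 h4
    rw [h3, ← iInf_add_mul_inv_natCast_add_one (curVal g gk v t i) (M.T - t), shift_iInf]
    exact le_iInf h4

end Value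

end Model

end DelayedSharing

/-! ### Existence, necessary conditions and verification -/

theorem mainTheorem2 {K : ℕ} (M : Model K) (go : M.Profile) (k : Fin K) :
    -- the a posteriori densities exist, for every strategy of player `k`
    (∀ (gk : M.Strat k), ∀ t ≤ M.T,
      ∃ ξ, IsPosterior (Function.update go k gk) k t ξ) ∧
    -- the recursions have a solution
    (∃ V, IsDPSolution go k V) ∧
    ∀ V, IsDPSolution go k V →
      (∀ (gk : M.Strat k)
        (ξ : ∀ t, M.Com t × M.Priv t k → M.Bel k t),
        let g : M.Profile := Function.update go k gk
        (∀ t ≤ M.T, IsPosterior g k t (ξ t)) →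
          -- the integrals of the recursions are the conditional expectations
          IsCondExp M.P (info g k M.T)
            (fun ω => M.cT (state g M.T ω))
            (fun i => dpTerm (ξ M.T i)) ∧
          (∀ t < M.T,
            IsCondExp M.P (info g k t)
              (fun ω => M.c t (state g t ω) (act g t ω) +
                V (t + 1) (ξ (t + 1) (info g k (t + 1) ω))
                  (info g k (t + 1) ω))
              (fun i => dpStep go (V (t + 1)) (ξ t i) i (gk.1 t i))) ∧
          -- the joint predictive density
          (∀ t < M.T,
            ∀ φ : (M.Com t × M.Priv t k) × (M.Y (t + 1) k × M.Oth k t × M.X t × M.X (t + 1)) →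
              ℝ≥0∞, Measurable φ →
              ∫⁻ ω, φ (info g k t ω,
                (obs g k (t + 1) ω, oth g k t ω,
                  state g t ω, state g (t + 1) ω)) ∂M.P =
              ∫⁻ ω, intPred go (ξ t (info g k t ω))
                (info g k t ω).1 (gk.1 t (info g k t ω))
                (fun q => φ (info g k t ω, q)) ∂M.P) ∧
          -- (2) verification
          (∀ t ≤ M.T, ∀ J, IsCondCost g k t J →
            ∀ᵐ ω ∂M.P, V t (ξ t (info g k t ω))
              (info g k t ω) ≤ J (info g k t ω))) ∧
      (IsPbPOptimal go →
        -- (1.1) the cost-to-go is the value function, whatever player `k` did before time `t`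
        -- (in particular if `go k` was used, `Function.update go k (go k)` being `go`)
        (∀ gk : M.Strat k, ∀ t ≤ M.T, ∀ ξ,
          IsPosterior (Function.update go k gk) k t ξ →
            IsCostToGo (Function.update go k gk) k t (fun i => V t (ξ i) i)) ∧
        -- (1.2) strategies that attain the infima are optimal
        (∀ gk : M.Strat k,
          (∀ t < M.T, ∀ ξ, IsPosterior (Function.update go k gk) k t ξ →
            ∀ᵐ ω ∂M.P,
              let i := info (Function.update go k gk) k t ω
              IsMinimizer go k V t (ξ i) i (gk.1 t i)) →
          cost (Function.update go k gk) = cost go) ∧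
        -- (1.2) if the infima are attained, there is an optimal semi-separated strategy
        ((∀ gk : M.Strat k, ∀ t < M.T, ∀ ξ,
          IsPosterior (Function.update go k gk) k t ξ →
            ∀ᵐ ω ∂M.P,
              let i := info (Function.update go k gk) k t ω
              ∃ u, IsMinimizer go k V t (ξ i) i u) →
          ∃ γ : ∀ t, M.Bel k t → M.Com t × M.Priv t k → M.U t k,
            (∀ t < M.T, ∀ (ξ : M.Bel k t) (i : M.Com t × M.Priv t k),
              (∃ u, IsMinimizer go k V t ξ i u) →
                IsMinimizer go k V t ξ i (γ t ξ i)) ∧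
            ∃ gk : M.Strat k,
              (∀ t < M.T, ∀ ξ,
                IsPosterior (Function.update go k gk) k t ξ →
                ∀ᵐ ω ∂M.P,
                  let i := info (Function.update go k gk) k t ω
                  gk.1 t i = γ t (ξ i) i) ∧
              cost (Function.update go k gk) =
                cost go)) := by
  -- The given profile provides actions, as the sample space of a probability measure is not empty.
  have : ∀ t, Nonempty (M.U t k) := fun t =>
    (nonempty_of_isProbabilityMeasure M.P).map fun ω => (go k).1 t (info go k t ω)
  refine ⟨fun gk t _ => ⟨_, isPosterior_filt go gk t⟩, exists_isDPSolution go k, fun V hV => ?_⟩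
  obtain ⟨v, hv⟩ := exists_isRed (k := k) go
  refine ⟨fun gk ξ hξ => ⟨isCondExp_dpTerm go hV (hξ _ le_rfl), fun t ht =>
    isCondExp_dpStep go hV (hξ t ht.le) (hξ (t + 1) ht) ht, fun t ht φ hφ =>
    lintegral_pred go gk (hξ t ht.le) hφ, fun t ht J hJ => ?_⟩, fun hgo => ?_⟩
  · have hi := (measurable_info (Function.update go k gk) k t).aemeasurable (μ := M.P)
    filter_upwards [ae_of_ae_map hi (ae_value_eq go hv hV (hξ t ht) ht),
      ae_of_ae_map hi (ae_curVal_le go hv gk ht hJ)] with ω h1 h2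
    exact h1.trans_le h2
  · refine ⟨fun gk t ht ξ hξ => isCostToGo_value go hV hξ ht, fun gk h => ?_, fun h => ?_⟩
    -- A minimizing strategy costs at most as much as `go`; person-by-person optimality of `go`
    -- gives the converse.
    · refine le_antisymm (cost_le_of_ae_minimizer go hv gk fun t ht => ?_) (hgo k gk)
      have hξ := isPosterior_filt go gk t
      filter_upwards [h t ht _ hξ, ae_of_ae_map (measurable_info _ k t).aemeasurable
        (ae_isMinimizer_iff go hv hV hξ ht)] with ω h1 h2
      exact (h2 _).mp h1
    · obtain ⟨gk, hgk⟩ := exists_strat_minimizer go hv (go k)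
      have hmin : ∀ t < M.T, ∀ ξ, IsPosterior (Function.update go k gk) k t ξ → ∀ᵐ ω ∂M.P,
          IsMinimizer go k V t (ξ (info (Function.update go k gk) k t ω))
            (info (Function.update go k gk) k t ω)
            (gk.1 t (info (Function.update go k gk) k t ω)) := by
        intro t ht ξ hξ
        have hi := (measurable_info (Function.update go k gk) k t).aemeasurable (μ := M.P)
        filter_upwards [h gk t ht ξ hξ, ae_of_ae_map hi (hgk t ht),
          ae_of_ae_map hi (ae_isMinimizer_iff go hv hV hξ ht)] with ω ⟨u, hu⟩ h2 h3
        exact (h3 _).mpr (h2 ⟨u, (h3 u).mp hu⟩)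
      classical
      -- The rule `γ` returns the action of `gk` whenever it is a minimizer, and otherwise an
      -- arbitrary minimizer if there is one. So `γ` is minimizing wherever possible, while
      -- measurability of the strategy comes from `gk`, with which `γ` agrees almost surely.
      refine ⟨fun t ξ i => if IsMinimizer go k V t ξ i (gk.1 t i) then gk.1 t i else
        if hu : ∃ u, IsMinimizer go k V t ξ i u then hu.choose else gk.1 t i,
        fun t _ ξ i hu => ?_, gk, fun t ht ξ hξ => ?_, ?_⟩
      · beta_reduce
        split_ifs with h1
        · exact h1
        · exact hu.choose_spec
      · filter_upwards [hmin t ht ξ hξ] with ω hω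
        exact (if_pos hω).symm
      · refine le_antisymm (cost_le_of_ae_minimizer go hv gk fun t ht => ?_) (hgo k gk)
        have hξ := isPosterior_filt go gk t
        filter_upwards [hmin t ht _ hξ, ae_of_ae_map (measurable_info _ k t).aemeasurable
          (ae_isMinimizer_iff go hv hV hξ ht)] with ω h1 h2
        exact (h2 _).mp h1
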